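/- **Algebras.** Let $\mathbb Z_{q,u,v}=\mathbb Z[q^{\pm1/4},u_i^{\pm1/2},v_i^{\pm1/2}\ (i=0,1)]$ and $\mathbb Z_{q,t}=\mathbb Z[q^{\pm1/4},t^{\pm1/2}]$ be Laurent polynomial rings in independent variables. * $\mathcal H_{q,u,v}$ (the DAHA of type $C^\vee C_1$) is the $\mathbb Z_{q,u,v}$-algebra with invertible generators $U_0,U_1,V_0,V_1$ and relations $(U_i-u_i^{1/2})(U_i+u_i^{-1/2})=0$, $(V_i-v_i^{1/2})(V_i+v_i^{-1/2})=0$, $q^{1/4}V_1V_0U_0U_1=1$. Put $\mathbb X=V_1^{-1}U_1^{-1}$, $\mathbb Y=U_0U_1$. It has the automorphisms $\tau_+$: $U_0\mapsto V_0$, $V_0\mapsto V_0U_0V_0^{-1}$, $U_1\mapsto U_1$, $V_1\mapsto V_1$, $u_0\leftrightarrow v_0$; $\tau_-$: $V_1\mapsto V_0$, $V_0\mapsto V_0^{-1}V_1V_0$, $U_i\mapsto U_i$, $v_0\leftrightarrow v_1$; $\eta$: $U_i\mapsto U_i^{-1}$, $V_1\mapsto U_1V_1^{-1}U_1^{-1}$,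 $V_0\mapsto U_0^{-1}V_0^{-1}U_0$, all parameters inverted; and the anti-involutions $\varphi$: $U_0\leftrightarrow V_1$, $U_1\mapsto U_1$, $V_0\mapsto V_0$, $u_0\leftrightarrow v_1$, and $\star$: all generators and all parameters are inverted. (The other parameters are fixed.) * $\mathcal H^{A_1}_{q,t}$ is the $\mathbb Z_{q,t}$-algebra with invertible generators $X,Y,T$ and relations $(T-t^{1/2})(T+t^{-1/2})=0$, $TXT=X^{-1}$, $T^{-1}YT^{-1}=Y^{-1}$, $Y^{-1}X^{-1}YXT^2q^{1/2}=1$. It has the automorphisms $\tau_+$: $X\mapsto X$, $T\mapsto T$, $Y\mapsto q^{-1/4}XY$; $\tau_-$: $Y\mapsto Y$, $T\mapsto T$, $X\mapsto q^{1/4}YX$; $\eta$: $X\mapsto X^{-1}$, $Y\mapsto TY^{-1}T^{-1}$, $T\mapsto T^{-1}$, $q,t\mapsto q^{-1},t^{-1}$; and the anti-involutions $\varphi$: $X\mapsto Y^{-1}$, $Y\mapsto X^{-1}$, $T\mapsto T$ (parameters fixed) and $\star$: $X,Y,T$ and all parameters are inverted. **Groups.** $GL_2^\wedge(\mathbb Z)$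 is the group with generators $\tau_+,\tau_-,\eta$ and relations $\tau_+\tau_-^{-1}\tau_+=\tau_-^{-1}\tau_+\tau_-^{-1}$, $\eta^2=1$, $\eta\tau_\pm\eta=\tau_\pm^{-1}$; it acts on both algebras by the automorphisms above. $\Gamma_0^\wedge(2)$ is its subgroup generated by $\tau_+^2,\tau_-,\eta$. **Polynomial representations.** $\mathcal H_{q,u,v}$ acts on $\mathcal V_{\mathbb X}=\mathbb Z_{q,u,v}[\mathbb X^{\pm1}]$ by $$\widehat U_i=u_i^{1/2}s_i+\frac{(u_i^{1/2}-u_i^{-1/2})+(v_i^{1/2}-v_i^{-1/2})\mathbb X_i}{1-\mathbb X_i^2}(1-s_i),\quad \mathbb X_1=\mathbb X,\ \mathbb X_0=q^{1/4}\mathbb X^{-1},\ s_1(\mathbb X^m)=\mathbb X^{-m},\ s_0(\mathbb X^m)=q^{m/2}\mathbb X^{-m},$$ $\widehat V_1=\widehat U_1^{-1}\mathbb X^{-1}$, $\widehat V_0=q^{-1/4}\mathbb X\widehat U_0^{-1}$. $\mathcal H^{A_1}_{q,t}$ acts on $\mathcal V_X=\mathbb Z_{q,t}[X^{\pm1}]$: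 $X$ by multiplication, $T$ by $t^{1/2}s+\frac{t^{1/2}-t^{-1/2}}{1-X^2}(1-s)$ with $s(X^m)=X^{-m}$, and $Y$ by $\pi T$ with $\pi(X^m)=q^{m/2}X^{-m}$. **Nonsymmetric polynomials.** Let $\operatorname{sgn}(n)=1$ for $n>0$ and $-1$ for $n\le 0$. Over the fraction field $\mathbb Q_{q,u,v}$ of $\mathbb Z_{q,u,v}$, $\mathcal E_n$ ($n\in\mathbb Z$) is the Laurent polynomial with $\mathbb Y(\mathcal E_n)=(u_0u_1)^{-\operatorname{sgn}(n)/2}q^{-n/2}\mathcal E_n$, involving only $\mathbb X^m$ with $|m|\le|n|$, with coefficient $1$ at $\mathbb X^n$, and with no $\mathbb X^{-n}$ for $n>0$. Over the fraction field of $\mathbb Z_{q,t}$, $E_n$ is the Laurent polynomial with $Y(E_n)=t^{-\operatorname{sgn}(n)/2}q^{-n/2}E_n$ and with coefficient $1$ at $X^n$. A rational function $x$ *specializes* to $y$ under a substitution $\sigma$ of parameters if $x=a/d$ with $a,d$ in the parameter ring, $\sigma(d)\ne0$ and $y=\sigma(a)/\sigma(d)$; Laurent polynomials specialize coefficientwise.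 **Theorem 2.1.** For every $n\in\mathbb Z$ the polynomials $\mathcal E_n$ and $E_n$ exist and are unique, and the following holds. (i) Let $\sigma_1$ be the substitution $u_1^{1/2}\mapsto t^{1/2}$, $u_0^{1/2},v_0^{1/2},v_1^{1/2}\mapsto1$, $q^{1/4}\mapsto q^{1/4}$. There is a ring homomorphism $\xi:\mathcal H_{q,u,v}\to\mathcal H^{A_1}_{q,t}$, equal to $\sigma_1$ on the parameters, with $$U_1\mapsto T,\quad U_0\mapsto YT^{-1},\quad V_0\mapsto q^{1/4}YT^{-1}X^{-1},\quad V_1\mapsto XT,\quad \mathbb X\mapsto X,\quad \mathbb Y\mapsto Y;$$ it intertwines $\tau_+,\tau_-,\eta,\varphi,\star$ of the two algebras. Under $\sigma_1$, $\mathcal E_n(\mathbb X)$ specializes to $E_n(X)$ and $\mathcal E_n((u_1v_1)^{-1/2})$ specializes to $$E_n(t^{-1/2})=t^{-|n|/2}\prod_{j=1}^{N}\frac{1-q^jt^2}{1-q^jt},\qquad N=n-1\ (n>0),\quad N=|n|\ (n\le0).$$ Moreover, for $m\ge0$, with $\varepsilon=0$ for $n=m+1$ and $\varepsilon=1$ for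 $n=-m-1$, the right-hand side of the evaluation formula for $\mathcal E_n((u_1v_1)^{-1/2})$, $$\frac{(u_1v_0v_1)^{-(m+1)/2}\prod_{j=1}^{m+\varepsilon}(1+q^{j/2}u_1)}{\prod_{j=m+1+\varepsilon}^{2m+1+\varepsilon}(1-q^{j/2}u_0u_1)}\prod_{i=0}^m\bigl(v_0^{1/2}+q^{\frac{2i+1}4}u_0^{1/2}u_1^{1/2}v_1^{1/2}\bigr)\bigl(1-q^{\frac{2i+1}4}u_0^{1/2}u_1^{1/2}v_0^{1/2}v_1^{1/2}\bigr),$$ specializes under $\sigma_1$ to the right-hand side of the above formula for $E_n(t^{-1/2})$. (ii) Let $\sigma_2$ be the substitution $u_0^{1/2},u_1^{1/2}\mapsto t^{1/2}$, $v_0^{1/2},v_1^{1/2}\mapsto1$, $q^{1/4}\mapsto q^{1/2}$. There is a ring homomorphism $\zeta:\mathcal H_{q,u,v}\to\mathcal H^{A_1}_{q,t}$, equal to $\sigma_2$ on the parameters (i.e. a homomorphism $\mathcal H_{q^2,u,v}\to\mathcal H^{A_1}_{q,t}$), with $$U_1\mapsto T,\quad U_0\mapsto Y^2T^{-1},\quad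 V_0\mapsto q^{1/4}YT^{-1}X^{-1},\quad V_1\mapsto q^{1/4}XTY,\quad \mathbb X\mapsto q^{-1/4}Y^{-1}X=\tau_-^{-1}(X),\quad \mathbb Y\mapsto Y^2.$$ It induces a group homomorphism $\zeta_*:\Gamma_0^\wedge(2)\to GL_2^\wedge(\mathbb Z)$ with $\tau_+^2\mapsto\tau_-^{-1}\tau_+\tau_-$, $\tau_-\mapsto\tau_-^2$, $\eta\mapsto\tau_-^{-1}\eta\tau_-$, in the sense that $\zeta(\gamma(H))=\zeta_*(\gamma)(\zeta(H))$ for all $\gamma\in\Gamma_0^\wedge(2)$, $H\in\mathcal H_{q,u,v}$. (iii) The same $\zeta$ is compatible with the map of the polynomial representations $\mathcal V_{\mathbb X}\to\mathcal V_X$, $F(\mathbb X)\mapsto\widetilde F:=\tau_-^{-1}(F(X))(1)$, where $\sigma_2$ is applied to the coefficients of $F$: one has $\widetilde{H(F)}=\zeta(H)(\widetilde F)$ for all $H\in\mathcal H_{q,u,v}$, $F\in\mathcal V_{\mathbb X}$. Under $\sigma_2$, $\mathcal E_n(\mathbb X)$ specializes to $E_n(X)$ and $\mathcal E_n((u_1v_1)^{-1/2})$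 specializes to $E_n(t^{-1/2})$, for all $n\in\mathbb Z$. -/

import Mathlib

set_option linter.unusedSimpArgs false

noncomputable section

namespace DAHA

/-! ### Parameter rings -/

/-- The ring `ℤ[x_i^{±1} : i ∈ ι]` of Laurent polynomials with integer coefficients in the
variables indexed by `ι` (the group ring of the free abelian group on `ι`). -/
abbrev Params (ι : Type) : Type := AddMonoidAlgebra ℤ (ι →₀ ℤ)

namespace Params

variable {ι : Type} {S : Type*}

/-- The invertible variable `x_i`. -/
def var (i : ι) : (Params ι)ˣ where
  val := AddMonoidAlgebra.single (Finsupp.single i 1) 1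
  inv := AddMonoidAlgebra.single (Finsupp.single i (-1)) 1
  val_inv := by
    rw [AddMonoidAlgebra.single_mul_single, ← Finsupp.single_add]; simp [AddMonoidAlgebra.one_def]
  inv_val := by
    rw [AddMonoidAlgebra.single_mul_single, ← Finsupp.single_add]; simp [AddMonoidAlgebra.one_def]

/-- The substitution homomorphism `x_i ↦ a_i`, for invertible elements `a_i` of a commutative
ring. -/
def subst [CommRing S] (a : ι → Sˣ) : Params ι →+* S :=
  (AddMonoidAlgebra.lift ℤ S (ι →₀ ℤ)
    ((Units.coeHom S).comp (AddMonoidHom.toMultiplicativeLeft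
      (Finsupp.liftAddHom fun i => zmultiplesHom (Additive Sˣ) (Additive.ofMul (a i)))))).toRingHom

theorem map_subst_var [CommRing S] (a : ι → Sˣ) (i : ι) :
    Units.map (subst a : Params ι →* S) (var i) = a i := by
  ext
  simp [subst, var]

theorem hom_ext [Ring S] {f g : Params ι →+* S} 
    (h : ∀ i, f ((var i : (Params ι)ˣ) : Params ι) = g ((var i : (Params ι)ˣ) : Params ι)) :
    f = g := by
  refine AddMonoidAlgebra.ringHom_ext' (RingHom.ext_int _ _) (MonoidHom.ext fun x => ?_)
  have key : ∀ (f g : Multiplicative (ι →₀ ℤ) →* Sˣ),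
      (∀ i, f (.ofAdd (Finsupp.single i 1)) = g (.ofAdd (Finsupp.single i 1))) → f = g := by
    intro f g h
    refine MonoidHom.ext fun x => ?_
    induction x using Multiplicative.rec with | ofAdd x =>
    induction x using Finsupp.induction_linear with
    | zero => simp
    | add a b ha hb => rw [ofAdd_add, map_mul, map_mul, ha, hb]
    | single i n =>
      have : Finsupp.single i n = n • Finsupp.single i (1 : ℤ) := by simp
      rw [this, ofAdd_zsmul, map_zpow, map_zpow, h i]
  have h2 := key ((f : Params ι →* S).comp (AddMonoidAlgebra.of ℤ (ι →₀ ℤ))).toHomUnits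
    ((g : Params ι →* S).comp (AddMonoidAlgebra.of ℤ (ι →₀ ℤ))).toHomUnits
    (fun i => Units.ext (by simpa [var] using h i))
  simpa using congrArg (fun k => ((k x : Sˣ) : S)) h2

end Params

/-! ### Presentations -/

section Presentations

variable {R R' S : Type*} [CommRing R] [CommRing R'] [Ring S] [Algebra R' S]

/-- An invertible scalar, as an invertible element of an algebra. -/
def scalar (S : Type*) [Ring S] [Algebra R' S] (a : R'ˣ) : Sˣ :=
  Units.map (algebraMap R' S : R' →* S) a

theorem scalar_inv (a : R'ˣ) : scalar S a⁻¹ = (scalar S a)⁻¹ := map_inv _ _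

theorem scalar_comm (a : R'ˣ) (x : Sˣ) : scalar S a * x = x * scalar S a :=
  Units.ext (Algebra.commutes _ _)

/-- The Hecke relation `(x - a)(x + a⁻¹) = 0`. -/
def IsHecke (a : R'ˣ) (x : Sˣ) : Prop :=
  ((x : S) - algebraMap R' S a) * ((x : S) + algebraMap R' S ((a⁻¹ : R'ˣ) : R')) = 0

theorem IsHecke.conj {a : R'ˣ} {x : Sˣ} (h : IsHecke a x) (g : Sˣ) :
    IsHecke a (g * x * g⁻¹) := by
  unfold IsHecke at *
  have e1 : ∀ c : R', algebraMap R' S c = g * algebraMap R' S c * (g⁻¹ : Sˣ) := fun c => by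
    rw [← Algebra.commutes, mul_assoc, Units.mul_inv, mul_one]
  have e2 : ((g * x * g⁻¹ : Sˣ) : S) - algebraMap R' S a
      = g * ((x : S) - algebraMap R' S a) * (g⁻¹ : Sˣ) := by
    rw [mul_sub, sub_mul, ← e1]; simp
  have e3 : ((g * x * g⁻¹ : Sˣ) : S) + algebraMap R' S ((a⁻¹ : R'ˣ) : R')
      = g * ((x : S) + algebraMap R' S ((a⁻¹ : R'ˣ) : R')) * (g⁻¹ : Sˣ) := by
    rw [mul_add, add_mul, ← e1]; simp
  rw [e2, e3]
  calc _ = (g : S) * ((x - algebraMap R' S a) * (((g⁻¹ : Sˣ) : S) * g) *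
        (x + algebraMap R' S ((a⁻¹ : R'ˣ) : R'))) * (g⁻¹ : Sˣ) := by noncomm_ring
    _ = 0 := by rw [Units.inv_mul, mul_one, h]; simp

theorem IsHecke.conj' {a : R'ˣ} {x : Sˣ} (h : IsHecke a x) (g : Sˣ) :
    IsHecke a (g⁻¹ * x * g) := by
  simpa using h.conj g⁻¹

theorem IsHecke.inv {a : R'ˣ} {x : Sˣ} (h : IsHecke a x) : IsHecke a⁻¹ x⁻¹ := by
  unfold IsHecke at *
  rw [inv_inv]
  have hA : algebraMap R' S ((a⁻¹ : R'ˣ) : R') * algebraMap R' S a = 1 := by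
    rw [← map_mul, Units.inv_mul, map_one]
  have c1 := Algebra.commutes (R := R') (A := S) a x
  have c2 := Algebra.commutes (R := R') (A := S) ((a⁻¹ : R'ˣ) : R') x
  have c3 := Algebra.commutes (R := R') (A := S) ((a⁻¹ : R'ˣ) : R') (algebraMap R' S a)
  set A := algebraMap R' S a
  set B := algebraMap R' S ((a⁻¹ : R'ˣ) : R')
  have hx : (x : S) * ((((x⁻¹ : Sˣ) : S) - B) * (((x⁻¹ : Sˣ) : S) + A)) * x = 0 := by
    have h1 : (x : S) * (((x⁻¹ : Sˣ) : S) - B) = -(B * (x - A)) := by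
      rw [mul_sub, mul_sub, Units.mul_inv, hA, ← c2]; abel
    have h2 : (((x⁻¹ : Sˣ) : S) + A) * x = (x + B) * A := by
      rw [add_mul, add_mul, Units.inv_mul, hA, c1]; abel
    calc _ = ((x : S) * (((x⁻¹ : Sˣ) : S) - B)) * ((((x⁻¹ : Sˣ) : S) + A) * x) := by
          simp only [mul_assoc]
      _ = -(B * ((x - A) * (x + B)) * A) := by rw [h1, h2]; simp only [mul_assoc, neg_mul]
      _ = 0 := by rw [h]; simp
  simpa using hx

/-- An invertible element, as an invertible element of the opposite ring. -/
def opUnit (x : Sˣ) : (Sᵐᵒᵖ)ˣ where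
  val := MulOpposite.op (x : S)
  inv := MulOpposite.op ((x⁻¹ : Sˣ) : S)
  val_inv := by rw [← MulOpposite.op_mul, Units.inv_mul, MulOpposite.op_one]
  inv_val := by rw [← MulOpposite.op_mul, Units.mul_inv, MulOpposite.op_one]

theorem opUnit_mul (x y : Sˣ) : opUnit (x * y) = opUnit y * opUnit x := by
  ext; simp [opUnit]

theorem opUnit_inv (x : Sˣ) : opUnit x⁻¹ = (opUnit x)⁻¹ := by
  ext; rfl

theorem opUnit_one : opUnit (1 : Sˣ) = 1 := by
  ext; simp [opUnit]

theorem opUnit_scalar (a : R'ˣ) : opUnit (scalar S a) = scalar Sᵐᵒᵖ a := by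
  ext; simp [opUnit, scalar]

theorem IsHecke.op {a : R'ˣ} {x : Sˣ} (h : IsHecke a x) : IsHecke a (opUnit x) := by
  unfold IsHecke at *
  have c1 := Algebra.commutes (R := R') (A := S) a x
  have c2 := Algebra.commutes (R := R') (A := S) ((a⁻¹ : R'ˣ) : R') x
  have c3 := Algebra.commutes (R := R') (A := S) ((a⁻¹ : R'ˣ) : R') (algebraMap R' S a)
  apply MulOpposite.unop_injective
  simp only [opUnit, MulOpposite.algebraMap_apply, MulOpposite.unop_mul, MulOpposite.unop_sub,
    MulOpposite.unop_add, MulOpposite.unop_op, MulOpposite.unop_zero]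
  rw [← h, add_mul, mul_sub, mul_sub, mul_add, sub_mul, sub_mul, c1, c2, c3]

/-- The ring homomorphism from the group ring `R[F(G)]` of a free group to an `R'`-algebra `S`
which is `α : R → R'` on scalars and `f` on the free generators. -/
def freeLift {G : Type} (α : R →+* R') (f : G → Sˣ) : MonoidAlgebra R (FreeGroup G) →+* S :=
  MonoidAlgebra.liftNCRingHom ((algebraMap R' S).comp α)
    ((Units.coeHom S).comp (FreeGroup.lift f)) (fun _ _ => Algebra.commutes _ _)

theorem freeLift_of {G : Type} (α : R →+* R') (f : G → Sˣ) (w : FreeGroup G) :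
    freeLift α f (MonoidAlgebra.of R _ w) = ((FreeGroup.lift f w : Sˣ) : S) := by
  rw [freeLift, MonoidAlgebra.of_apply]
  exact (MonoidAlgebra.liftNCRingHom_single _ _ _ _ _).trans (by simp)

theorem freeLift_algebraMap {G : Type} (α : R →+* R') (f : G → Sˣ) (c : R) :
    freeLift α f (algebraMap R _ c) = algebraMap R' S (α c) := by
  have e : algebraMap R (MonoidAlgebra R (FreeGroup G)) c = MonoidAlgebra.single 1 c := by simp
  rw [e, freeLift]
  exact (MonoidAlgebra.liftNCRingHom_single _ _ _ _ _).trans (by simp)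

theorem free_hom_ext {G : Type} {f g : MonoidAlgebra R (FreeGroup G) →+* S}
    (h1 : ∀ c, f (algebraMap R _ c) = g (algebraMap R _ c))
    (h2 : ∀ x, f (MonoidAlgebra.of R _ (FreeGroup.of x)) =
      g (MonoidAlgebra.of R _ (FreeGroup.of x))) : f = g := by
  refine MonoidAlgebra.ringHom_ext' (RingHom.ext fun c => ?_) ?_
  · simpa using h1 c
  · have h3 : ((f : _ →* S).comp (MonoidAlgebra.of R (FreeGroup G))).toHomUnits =
        ((g : _ →* S).comp (MonoidAlgebra.of R (FreeGroup G))).toHomUnits := by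
      refine FreeGroup.ext_hom _ _ fun x => ?_
      ext
      simpa using h2 x
    refine MonoidHom.ext fun x => ?_
    simpa using congrArg (fun k => ((k x : Sˣ) : S)) h3

/-- The `R`-algebra with invertible generators indexed by `G` and with the relations `r`. -/
def Pres {G : Type} (r : MonoidAlgebra R (FreeGroup G) → MonoidAlgebra R (FreeGroup G) → Prop) :
    Type _ := RingQuot r

namespace Pres

variable {G : Type} {r : MonoidAlgebra R (FreeGroup G) → MonoidAlgebra R (FreeGroup G) → Prop}

instance : Ring (Pres r) := inferInstanceAs (Ring (RingQuot r))

instance : Algebra R (Pres r) := inferInstanceAs (Algebra R (RingQuot r))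

/-- The quotient map from the free group ring. -/
def mk : MonoidAlgebra R (FreeGroup G) →+* Pres r := RingQuot.mkRingHom r

/-- The image of a free generator. -/
def gen (x : G) : (Pres r)ˣ :=
  Units.map ((mk : _ →+* Pres r) : _ →* Pres r)
    (Units.map (MonoidAlgebra.of R _) (toUnits (FreeGroup.of x)))

theorem mk_of (x : G) :
    (mk (MonoidAlgebra.of R _ (FreeGroup.of x)) : Pres r) = (gen x : (Pres r)ˣ) := rfl

theorem mk_rel {x y : MonoidAlgebra R (FreeGroup G)} (h : r x y) : (mk x : Pres r) = mk y :=
  RingQuot.mkRingHom_rel h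

theorem mk_algebraMap (a : R) :
    (mk (algebraMap R _ a) : Pres r) = algebraMap R (Pres r) a :=
  (congrArg (fun f : _ →+* RingQuot r => f (algebraMap R _ a)) (RingQuot.mkAlgHom_coe R r)).symm.trans
    ((RingQuot.mkAlgHom R r).commutes a)

/-- The ring homomorphism to an `R'`-algebra `S` which is `α` on the scalars and is given by `f`
on the generators, provided that the relations hold in `S`. -/
def lift (α : R →+* R') (f : G → Sˣ) (h : ∀ ⦃x y⦄, r x y → freeLift α f x = freeLift α f y) :
    Pres r →+* S :=
  RingQuot.lift ⟨freeLift α f, h⟩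

theorem lift_mk (α : R →+* R') (f : G → Sˣ) (h) (x : MonoidAlgebra R (FreeGroup G)) :
    lift (r := r) α f h (mk x) = freeLift α f x :=
  RingQuot.lift_mkRingHom_apply _ _ _

theorem lift_algebraMap (α : R →+* R') (f : G → Sˣ) (h) (a : R) :
    lift (r := r) α f h (algebraMap R _ a) = algebraMap R' S (α a) := by
  rw [← mk_algebraMap, lift_mk, freeLift_algebraMap]

theorem lift_gen (α : R →+* R') (f : G → Sˣ) (h) (x : G) :
    Units.map (lift (r := r) α f h : Pres r →* S) (gen x) = f x := by
  ext
  rw [Units.coe_map, ← mk_of, MonoidHom.coe_coe, lift_mk, freeLift_of, FreeGroup.lift_apply_of]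

theorem hom_ext {S : Type*} [Ring S] {φ ψ : Pres r →+* S}
    (h1 : ∀ a, φ (algebraMap R _ a) = ψ (algebraMap R _ a))
    (h2 : ∀ x, Units.map (φ : Pres r →* S) (gen x) = Units.map (ψ : Pres r →* S) (gen x)) :
    φ = ψ := by
  refine RingQuot.ringQuot_ext (r := r) φ ψ (free_hom_ext (fun a => ?_) fun x => ?_)
  · have := h1 a
    rw [← mk_algebraMap] at this
    exact this
  · exact congrArg Units.val (h2 x)

theorem param_hom_ext {ι : Type}
    {r : MonoidAlgebra (Params ι) (FreeGroup G) → MonoidAlgebra (Params ι) (FreeGroup G) → Prop}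
    {S : Type*} [Ring S] {φ ψ : Pres r →+* S}
    (h1 : ∀ i, Units.map (φ : Pres r →* S) (scalar (Pres r) (Params.var i : (Params ι)ˣ)) =
      Units.map (ψ : Pres r →* S) (scalar (Pres r) (Params.var i : (Params ι)ˣ)))
    (h2 : ∀ x, Units.map (φ : Pres r →* S) (gen x) = Units.map (ψ : Pres r →* S) (gen x)) :
    φ = ψ := by
  refine hom_ext (fun a => ?_) h2
  have : φ.comp (algebraMap (Params ι) (Pres r)) = ψ.comp (algebraMap (Params ι) (Pres r)) :=
    Params.hom_ext fun i => congrArg Units.val (h1 i)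
  exact congrArg (fun f : Params ι →+* S => f a) this

theorem map_comp {S T : Type*} [Ring S] [Ring T] (φ : S →+* T) (ψ : Pres r →+* S) (x : (Pres r)ˣ) :
    Units.map ((φ.comp ψ : Pres r →+* T) : Pres r →* T) x =
      Units.map (φ : S →* T) (Units.map (ψ : Pres r →* S) x) := rfl

theorem map_id (x : (Pres r)ˣ) :
    Units.map ((RingHom.id (Pres r) : Pres r →+* Pres r) : Pres r →* Pres r) x = x := rfl

end Pres

end Presentations

/-! ### The projective `GL_2(ℤ)` -/

/-- Names of the generators of the projective `GL_2(ℤ)`. -/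
inductive GLGen
  | tauPlus | tauMinus | eta

/-- The relations `τ_+ τ_-⁻¹ τ_+ = τ_-⁻¹ τ_+ τ_-⁻¹`, `η² = 1`, `η τ_± η = τ_±⁻¹`. -/
def glRels : Set (FreeGroup GLGen) :=
  let a := FreeGroup.of GLGen.tauPlus
  let b := FreeGroup.of GLGen.tauMinus
  let e := FreeGroup.of GLGen.eta
  {(a * b⁻¹ * a) * (b⁻¹ * a * b⁻¹)⁻¹, e ^ 2, (e * a * e) * a, (e * b * e) * b}

/-- The projective group `GL_2^∧(ℤ)`, generated by `τ_+, τ_-, η` with the relations above. -/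
abbrev GLHat : Type := PresentedGroup glRels

namespace GLHat

/-- The generator `τ_+`. -/
def tauPlus : GLHat := PresentedGroup.of GLGen.tauPlus
/-- The generator `τ_-`. -/
def tauMinus : GLHat := PresentedGroup.of GLGen.tauMinus
/-- The generator `η`. -/
def eta : GLHat := PresentedGroup.of GLGen.eta

/-- The homomorphism from `GL_2^∧(ℤ)` given by the images of the generators. -/
def lift {G : Type*} [Group G] (a b e : G) (h1 : a * b⁻¹ * a = b⁻¹ * a * b⁻¹) (h2 : e * e = 1)
    (h3 : e * a * e = a⁻¹) (h4 : e * b * e = b⁻¹) : GLHat →* G :=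
  PresentedGroup.toGroup (f := fun | .tauPlus => a | .tauMinus => b | .eta => e) <| by
    rintro r (rfl | rfl | rfl | rfl)
    · rw [map_mul, map_inv, mul_inv_eq_one]; simpa using h1
    · simpa [sq] using h2
    · simp [h3]
    · simp [h4]

/-- The subgroup `Γ_0^∧(2)` generated by `τ_+², τ_-, η`. -/
def Gamma0 : Subgroup GLHat := Subgroup.closure {tauPlus ^ 2, tauMinus, eta}

/-- `τ_+²` as an element of `Γ_0^∧(2)`. -/
def Gamma0.tauPlusSq : Gamma0 := ⟨tauPlus ^ 2, Subgroup.subset_closure (by simp)⟩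
/-- `τ_-` as an element of `Γ_0^∧(2)`. -/
def Gamma0.tauMinus : Gamma0 := ⟨GLHat.tauMinus, Subgroup.subset_closure (by simp)⟩
/-- `η` as an element of `Γ_0^∧(2)`. -/
def Gamma0.eta : Gamma0 := ⟨GLHat.eta, Subgroup.subset_closure (by simp)⟩

end GLHat

/-! ### The double affine Hecke algebra of type `C^∨C_1` -/

namespace CC

/-- Names of the parameters `q^{1/4}, u_0^{1/2}, u_1^{1/2}, v_0^{1/2}, v_1^{1/2}`. -/
inductive Par
  | q4 | su0 | su1 | sv0 | sv1

/-- `ℤ_{q,u,v} = ℤ[q^{±1/4}, u_i^{±1/2}, v_i^{±1/2}]`. -/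
abbrev Z : Type := Params Par

/-- Names of the generators. -/
inductive Gen
  | U0 | U1 | V0 | V1

/-- The parameter in the quadratic relation of a generator. -/
def hecke : Gen → Par
  | .U0 => .su0
  | .U1 => .su1
  | .V0 => .sv0
  | .V1 => .sv1

/-- The group ring of the free group on the generators. -/
abbrev Free : Type := MonoidAlgebra Z (FreeGroup Gen)

/-- A generator in the free group ring. -/
abbrev g (x : Gen) : Free := MonoidAlgebra.of Z _ (FreeGroup.of x)

/-- A scalar in the free group ring. -/
abbrev c (a : Zˣ) : Free := algebraMap Z Free a

/-- The defining relations `(U_i - u_i^{1/2})(U_i + u_i^{-1/2}) = 0`,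
`(V_i - v_i^{1/2})(V_i + v_i^{-1/2}) = 0` and `q^{1/4} V_1 V_0 U_0 U_1 = 1`. -/
inductive Rel : Free → Free → Prop
  | quad (x : Gen) :
      Rel ((g x - c (Params.var (hecke x))) * (g x + c (Params.var (hecke x))⁻¹)) 0
  | prod : Rel (c (Params.var Par.q4) * g .V1 * g .V0 * g .U0 * g .U1) 1

/-- The double affine Hecke algebra `H_{q,u,v}` of type `C^∨C_1`. -/
abbrev H : Type := Pres Rel

/-- The generator `U_0`. -/
abbrev U0 : Hˣ := Pres.gen Gen.U0
/-- The generator `U_1`. -/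
abbrev U1 : Hˣ := Pres.gen Gen.U1
/-- The generator `V_0`. -/
abbrev V0 : Hˣ := Pres.gen Gen.V0
/-- The generator `V_1`. -/
abbrev V1 : Hˣ := Pres.gen Gen.V1

/-- `𝕏 = V_1⁻¹ U_1⁻¹`. -/
def X : Hˣ := V1⁻¹ * U1⁻¹
/-- `𝕐 = U_0 U_1`. -/
def Y : Hˣ := U0 * U1

theorem gen_isHecke (x : Gen) : IsHecke (S := H) (Params.var (hecke x)) (Pres.gen x) := by
  have := Pres.mk_rel (Rel.quad x)
  simp only [map_mul, map_sub, map_add, map_zero, Pres.mk_algebraMap] at this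
  exact this

theorem gen_prod : scalar H (Params.var Par.q4) * V1 * V0 * U0 * U1 = 1 := by
  have := Pres.mk_rel Rel.prod
  simp only [map_mul, map_one, Pres.mk_algebraMap] at this
  exact Units.ext this

section Lift

variable {R' S : Type*} [CommRing R'] [Ring S] [Algebra R' S]

/-- The ring homomorphism from `H_{q,u,v}` to an `R'`-algebra `S` which is the substitution
`x ↦ α x` on the parameters and is given by `f` on the generators. -/
def lift (α : Par → R'ˣ) (f : Gen → Sˣ) (hquad : ∀ x, IsHecke (α (hecke x)) (f x))
    (hprod : scalar S (α .q4) * f .V1 * f .V0 * f .U0 * f .U1 = 1) : H →+* S :=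
  Pres.lift (Params.subst α) f <| by
    have hs : ∀ x, Params.subst α (Params.var x : Zˣ) = α x := fun x =>
      congrArg Units.val (Params.map_subst_var α x)
    have hs' : ∀ x, Params.subst α ((Params.var x)⁻¹ : Zˣ) = ((α x)⁻¹ : R'ˣ) := fun x =>
      congrArg (fun u : R'ˣ => ((u⁻¹ : R'ˣ) : R')) (Params.map_subst_var α x)
    rintro _ _ (x | _)
    · have := hquad x
      simp only [map_mul, map_sub, map_add, map_zero, freeLift_algebraMap, freeLift_of,
        FreeGroup.lift_apply_of, hs, hs']
      exact this
    · have := congrArg Units.val hprod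
      simp only [map_mul, map_one, freeLift_algebraMap, freeLift_of,
        FreeGroup.lift_apply_of, hs]
      exact this

theorem lift_algebraMap (α : Par → R'ˣ) (f : Gen → Sˣ) (h1 h2) (a : Z) :
    lift α f h1 h2 (algebraMap Z H a) = algebraMap R' S (Params.subst α a) :=
  Pres.lift_algebraMap _ _ _ _

theorem lift_scalar (α : Par → R'ˣ) (f : Gen → Sˣ) (h1 h2) (i : Par) :
    Units.map (lift α f h1 h2 : H →* S) (scalar H (Params.var i)) = scalar S (α i) := by
  ext
  have : Params.subst α (Params.var i : Zˣ) = α i :=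
    congrArg Units.val (Params.map_subst_var α i)
  rw [Units.coe_map, MonoidHom.coe_coe]
  exact (lift_algebraMap α f h1 h2 _).trans (by rw [this]; rfl)

theorem lift_gen (α : Par → R'ˣ) (f : Gen → Sˣ) (h1 h2) (x : Gen) :
    Units.map (lift α f h1 h2 : H →* S) (Pres.gen x) = f x :=
  Pres.lift_gen _ _ _ _

end Lift

/-- The action of `τ_+` on the parameters: `u_0 ↔ v_0`. -/
def parTauPlus : Par → Zˣ
  | .q4 => Params.var .q4
  | .su0 => Params.var .sv0
  | .su1 => Params.var .su1
  | .sv0 => Params.var .su0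
  | .sv1 => Params.var .sv1

/-- The action of `τ_-` on the parameters: `v_0 ↔ v_1`. -/
def parTauMinus : Par → Zˣ
  | .q4 => Params.var .q4
  | .su0 => Params.var .su0
  | .su1 => Params.var .su1
  | .sv0 => Params.var .sv1
  | .sv1 => Params.var .sv0

/-- The action of `φ` on the parameters: `u_0 ↔ v_1`. -/
def parPhi : Par → Zˣ
  | .q4 => Params.var .q4
  | .su0 => Params.var .sv1
  | .su1 => Params.var .su1
  | .sv0 => Params.var .sv0
  | .sv1 => Params.var .su0

/-- The action of `η` and `⋆` on the parameters: all of them are inverted. -/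
def parInv : Par → Zˣ := fun x => (Params.var x)⁻¹

/-- The automorphism `τ_+`: `U_0 ↦ V_0`, `V_0 ↦ V_0 U_0 V_0⁻¹`, `U_1 ↦ U_1`, `V_1 ↦ V_1`,
`u_0 ↔ v_0`, as an endomorphism. -/
def tauPlusHom : H →+* H :=
  lift parTauPlus
    (fun | .U0 => V0 | .V0 => V0 * U0 * V0⁻¹ | .U1 => U1 | .V1 => V1)
    (by
      rintro (_ | _ | _ | _)
      · exact gen_isHecke .V0
      · exact gen_isHecke .U1
      · exact (gen_isHecke .U0).conj _
      · exact gen_isHecke .V1)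
    (by simpa [mul_assoc, parTauPlus] using gen_prod)

/-- The inverse of `τ_+`. -/
def tauPlusInvHom : H →+* H :=
  lift parTauPlus
    (fun | .U0 => U0⁻¹ * V0 * U0 | .V0 => U0 | .U1 => U1 | .V1 => V1)
    (by
      rintro (_ | _ | _ | _)
      · exact (gen_isHecke .V0).conj' _
      · exact gen_isHecke .U1
      · exact gen_isHecke .U0
      · exact gen_isHecke .V1)
    (by simpa [mul_assoc, parTauPlus] using gen_prod)

/-- The automorphism `τ_-`: `V_1 ↦ V_0`, `V_0 ↦ V_0⁻¹ V_1 V_0`, `U_1 ↦ U_1`, `U_0 ↦ U_0`,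
`v_0 ↔ v_1`, as an endomorphism. -/
def tauMinusHom : H →+* H :=
  lift parTauMinus
    (fun | .U0 => U0 | .V0 => V0⁻¹ * V1 * V0 | .U1 => U1 | .V1 => V0)
    (by
      rintro (_ | _ | _ | _)
      · exact gen_isHecke .U0
      · exact gen_isHecke .U1
      · exact (gen_isHecke .V1).conj' _
      · exact gen_isHecke .V0)
    (by simpa [mul_assoc, parTauMinus] using gen_prod)

/-- The inverse of `τ_-`. -/
def tauMinusInvHom : H →+* H :=
  lift parTauMinus
    (fun | .U0 => U0 | .V0 => V1 | .U1 => U1 | .V1 => V1 * V0 * V1⁻¹)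
    (by
      rintro (_ | _ | _ | _)
      · exact gen_isHecke .U0
      · exact gen_isHecke .U1
      · exact gen_isHecke .V1
      · exact (gen_isHecke .V0).conj _)
    (by simpa [mul_assoc, parTauMinus] using gen_prod)

theorem eta_prod {G : Type*} [Group G] {q u0 u1 v0 v1 : G} (hq : ∀ g, q * g = g * q)
    (h : q * v1 * v0 * u0 * u1 = 1) :
    q⁻¹ * (u1 * v1⁻¹ * u1⁻¹) * (u0⁻¹ * v0⁻¹ * u0) * u0⁻¹ * u1⁻¹ = 1 := by
  have e : u1⁻¹ * u0⁻¹ * v0⁻¹ = q * v1 := by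
    rw [← mul_left_inj (v0 * u0 * u1)]
    simpa [mul_assoc] using h.symm
  calc _ = q⁻¹ * u1 * v1⁻¹ * (u1⁻¹ * u0⁻¹ * v0⁻¹) * u1⁻¹ := by group
    _ = q⁻¹ * (u1 * v1⁻¹ * q) * v1 * u1⁻¹ := by rw [e]; group
    _ = 1 := by rw [← hq]; group

theorem phi_prod {G : Type*} [Group G] {q u0 u1 v0 v1 : G} (hq : ∀ g, q * g = g * q)
    (h : q * v1 * v0 * u0 * u1 = 1) : u1 * (v1 * (v0 * (u0 * q))) = 1 := by
  have e : q * (v1 * v0 * u0) = u1⁻¹ := by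
    rw [← mul_left_inj u1]
    simpa [mul_assoc] using h
  calc _ = u1 * ((v1 * v0 * u0) * q) := by group
    _ = 1 := by rw [← hq, e]; group

/-- The automorphism `η`: `U_1 ↦ U_1⁻¹`, `U_0 ↦ U_0⁻¹`, `V_1 ↦ U_1 V_1⁻¹ U_1⁻¹`,
`V_0 ↦ U_0⁻¹ V_0⁻¹ U_0`, all parameters are inverted, as an endomorphism. -/
def etaHom : H →+* H :=
  lift parInv
    (fun | .U0 => U0⁻¹ | .V0 => U0⁻¹ * V0⁻¹ * U0 | .U1 => U1⁻¹ | .V1 => U1 * V1⁻¹ * U1⁻¹)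
    (by
      rintro (_ | _ | _ | _)
      · exact (gen_isHecke .U0).inv
      · exact (gen_isHecke .U1).inv
      · exact (gen_isHecke .V0).inv.conj' _
      · exact (gen_isHecke .V1).inv.conj _)
    (by
      have := eta_prod (fun x => scalar_comm (S := H) (Params.var Par.q4) x) gen_prod
      simpa only [parInv, scalar_inv] using this)

/-- The anti-involution `φ`: `U_0 ↔ V_1`, `U_1 ↦ U_1`, `V_0 ↦ V_0`, `u_0 ↔ v_1`. -/
def phi : H →+* Hᵐᵒᵖ :=
  lift parPhi
    (fun | .U0 => opUnit V1 | .V0 => opUnit V0 | .U1 => opUnit U1 | .V1 => opUnit U0)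
    (by
      rintro (_ | _ | _ | _)
      · exact (gen_isHecke .V1).op
      · exact (gen_isHecke .U1).op
      · exact (gen_isHecke .V0).op
      · exact (gen_isHecke .U0).op)
    (by
      have h := phi_prod (fun x => scalar_comm (S := H) (Params.var Par.q4) x) gen_prod
      rw [show parPhi .q4 = Params.var Par.q4 from rfl, ← opUnit_scalar, ← opUnit_mul,
        ← opUnit_mul, ← opUnit_mul, ← opUnit_mul, h, opUnit_one])

/-- The inversion anti-involution `⋆`: all generators and all parameters are inverted. -/
def star : H →+* Hᵐᵒᵖ :=
  lift parInv (fun x => opUnit (Pres.gen x)⁻¹)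
    (fun x => (gen_isHecke x).inv.op)
    (by
      have h : U1⁻¹ * (U0⁻¹ * (V0⁻¹ * (V1⁻¹ * (scalar H (Params.var Par.q4))⁻¹))) = 1 := by
        simpa [mul_assoc] using congrArg (fun x => x⁻¹) gen_prod
      rw [parInv, ← opUnit_scalar, scalar_inv, ← opUnit_mul,
        ← opUnit_mul, ← opUnit_mul, ← opUnit_mul, h, opUnit_one])

/-- The automorphism `τ_+`. -/
def tauPlus : H ≃+* H :=
  RingEquiv.ofRingHom tauPlusHom tauPlusInvHom
    (Pres.param_hom_ext
      (by rintro (_ | _ | _ | _ | _) <;>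
        simp [Pres.map_comp, tauPlusHom, tauPlusInvHom, lift_scalar, parTauPlus])
      (by rintro (_ | _ | _ | _) <;>
        simp [Pres.map_comp, tauPlusHom, tauPlusInvHom, lift_gen, mul_assoc]))
    (Pres.param_hom_ext
      (by rintro (_ | _ | _ | _ | _) <;>
        simp [Pres.map_comp, tauPlusHom, tauPlusInvHom, lift_scalar, parTauPlus])
      (by rintro (_ | _ | _ | _) <;>
        simp [Pres.map_comp, tauPlusHom, tauPlusInvHom, lift_gen, mul_assoc]))

/-- The automorphism `τ_-`. -/
def tauMinus : H ≃+* H :=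
  RingEquiv.ofRingHom tauMinusHom tauMinusInvHom
    (Pres.param_hom_ext
      (by rintro (_ | _ | _ | _ | _) <;>
        simp [Pres.map_comp, tauMinusHom, tauMinusInvHom, lift_scalar, parTauMinus])
      (by rintro (_ | _ | _ | _) <;>
        simp [Pres.map_comp, tauMinusHom, tauMinusInvHom, lift_gen, mul_assoc]))
    (Pres.param_hom_ext
      (by rintro (_ | _ | _ | _ | _) <;>
        simp [Pres.map_comp, tauMinusHom, tauMinusInvHom, lift_scalar, parTauMinus])
      (by rintro (_ | _ | _ | _) <;>
        simp [Pres.map_comp, tauMinusHom, tauMinusInvHom, lift_gen, mul_assoc]))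

theorem etaHom_etaHom : etaHom.comp etaHom = RingHom.id H :=
  Pres.param_hom_ext
    (fun i => by simp [Pres.map_comp, etaHom, lift_scalar, parInv, scalar_inv])
    (by rintro (_ | _ | _ | _) <;>
        simp [Pres.map_comp, etaHom, lift_gen, mul_assoc])

/-- The automorphism `η`. -/
def eta : H ≃+* H := RingEquiv.ofRingHom etaHom etaHom etaHom_etaHom etaHom_etaHom

theorem eta_tauMinus_V1 {G : Type*} [Group G] {q u0 u1 v0 v1 : G} (hq : ∀ g, q * g = g * q)
    (h : q * v1 * v0 * u0 * u1 = 1) : u1⁻¹ * (u0⁻¹ * (v0 * (u0 * u1))) = v1 * (v0 * v1⁻¹) := by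
  have e : u0 * u1 = v0⁻¹ * v1⁻¹ * q⁻¹ := by
    rw [← mul_right_inj (q * v1 * v0)]
    simpa [mul_assoc] using h
  calc _ = (u0 * u1)⁻¹ * v0 * (u0 * u1) := by group
    _ = q * (v1 * v0 * v1⁻¹) * q⁻¹ := by rw [e]; group
    _ = _ := by rw [hq]; group

theorem eta_tauMinus_V0 {G : Type*} [Group G] {q u0 u1 v0 v1 : G} (hq : ∀ g, q * g = g * q)
    (h : q * v1 * v0 * u0 * u1 = 1) :
    v0 * (u0 * (u1 * (v1 * (u1⁻¹ * (u0⁻¹ * v0⁻¹))))) = v1 := by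
  have e : v0 * u0 * u1 = v1⁻¹ * q⁻¹ := by
    rw [← mul_right_inj (q * v1)]
    simpa [mul_assoc] using h
  calc _ = (v0 * u0 * u1) * v1 * (v0 * u0 * u1)⁻¹ := by group
    _ = v1⁻¹ * (q⁻¹ * (v1 * q)) * v1 := by rw [e]; group
    _ = _ := by rw [← hq]; group

/-- The action of `GL_2^∧(ℤ)` on `H_{q,u,v}` by ring automorphisms. -/
def act : GLHat →* RingAut H :=
  GLHat.lift tauPlus tauMinus eta
    (RingEquiv.toRingHom_injective <| by
      change tauPlusHom.comp (tauMinusInvHom.comp tauPlusHom) =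
        tauMinusInvHom.comp (tauPlusHom.comp tauMinusInvHom)
      refine Pres.param_hom_ext ?_ ?_
      · rintro (_ | _ | _ | _ | _) <;>
          simp [Pres.map_comp, tauPlusHom, tauMinusInvHom, lift_scalar, parTauPlus, parTauMinus]
      · rintro (_ | _ | _ | _) <;>
          simp [Pres.map_comp, tauPlusHom, tauMinusInvHom, lift_gen, mul_assoc])
    (RingEquiv.toRingHom_injective etaHom_etaHom)
    (RingEquiv.toRingHom_injective <| by
      change etaHom.comp (tauPlusHom.comp etaHom) = tauPlusInvHom
      refine Pres.param_hom_ext ?_ ?_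
      · rintro (_ | _ | _ | _ | _) <;>
          simp [Pres.map_comp, tauPlusHom, tauPlusInvHom, etaHom, lift_scalar, parTauPlus, parInv,
            scalar_inv]
      · rintro (_ | _ | _ | _) <;>
          simp [Pres.map_comp, tauPlusHom, tauPlusInvHom, etaHom, lift_gen, mul_assoc])
    (RingEquiv.toRingHom_injective <| by
      change etaHom.comp (tauMinusHom.comp etaHom) = tauMinusInvHom
      have hq := fun x => scalar_comm (S := H) (Params.var Par.q4) x
      refine Pres.param_hom_ext ?_ ?_
      · rintro (_ | _ | _ | _ | _) <;>
          simp [Pres.map_comp, tauMinusHom, tauMinusInvHom, etaHom, lift_scalar, parTauMinus,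
            parInv, scalar_inv]
      · rintro (_ | _ | _ | _)
        · simp [Pres.map_comp, tauMinusHom, tauMinusInvHom, etaHom, lift_gen]
        · simp [Pres.map_comp, tauMinusHom, tauMinusInvHom, etaHom, lift_gen]
        · simpa [Pres.map_comp, tauMinusHom, tauMinusInvHom, etaHom, lift_gen, mul_assoc] using
            eta_tauMinus_V0 hq gen_prod
        · simpa [Pres.map_comp, tauMinusHom, tauMinusInvHom, etaHom, lift_gen, mul_assoc] using
            eta_tauMinus_V1 hq gen_prod)

end CC

/-! ### The double affine Hecke algebra of type `A_1` -/

namespace A1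

/-- Names of the parameters `q^{1/4}, t^{1/2}`. -/
inductive Par
  | q4 | st

/-- `ℤ[q^{±1/4}, t^{±1/2}]`. -/
abbrev Z : Type := Params Par

/-- Names of the generators. -/
inductive Gen
  | X | Y | T

/-- The group ring of the free group on the generators. -/
abbrev Free : Type := MonoidAlgebra Z (FreeGroup Gen)

/-- A word in the generators, in the free group ring. -/
abbrev w (x : FreeGroup Gen) : Free := MonoidAlgebra.of Z _ x

/-- A scalar in the free group ring. -/
abbrev c (a : Zˣ) : Free := algebraMap Z Free a

open FreeGroup in
/-- The defining relations `(T - t^{1/2})(T + t^{-1/2}) = 0`, `T X T = X⁻¹`, `T⁻¹ Y T⁻¹ = Y⁻¹`,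
`Y⁻¹ X⁻¹ Y X T² q^{1/2} = 1`. -/
inductive Rel : Free → Free → Prop
  | quad : Rel ((w (of .T) - c (Params.var Par.st)) * (w (of .T) + c (Params.var Par.st)⁻¹)) 0
  | txt : Rel (w (of .T * of .X * of .T)) (w (of .X)⁻¹)
  | tyt : Rel (w ((of .T)⁻¹ * of .Y * (of .T)⁻¹)) (w (of .Y)⁻¹)
  | yx : Rel (w ((of .Y)⁻¹ * (of .X)⁻¹ * of .Y * of .X * of .T ^ 2) * c (Params.var Par.q4 ^ 2)) 1

/-- The double affine Hecke algebra `H_{q,t}` of type `A_1`. -/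
abbrev H : Type := Pres Rel

/-- The generator `X`. -/
abbrev X : Hˣ := Pres.gen Gen.X
/-- The generator `Y`. -/
abbrev Y : Hˣ := Pres.gen Gen.Y
/-- The generator `T`. -/
abbrev T : Hˣ := Pres.gen Gen.T
/-- The scalar `q^{1/4}` as an element of the algebra. -/
abbrev Q : Hˣ := scalar H (Params.var Par.q4)

theorem mk_w (x : FreeGroup Gen) :
    (Pres.mk (w x) : H) = ((FreeGroup.lift Pres.gen x : Hˣ) : H) := by
  have : ((Pres.mk : Free →+* H) : Free →* H).comp (MonoidAlgebra.of Z _) =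
      (Units.coeHom H).comp (FreeGroup.lift Pres.gen) := by
    have h3 : (((Pres.mk : Free →+* H) : Free →* H).comp (MonoidAlgebra.of Z _)).toHomUnits =
        FreeGroup.lift Pres.gen :=
      FreeGroup.ext_hom _ _ fun x => Units.ext (by
        rw [FreeGroup.lift_apply_of]; rfl)
    refine MonoidHom.ext fun x => ?_
    simpa using congrArg (fun k => ((k x : Hˣ) : H)) h3
  exact DFunLike.congr_fun this x

theorem T_isHecke : IsHecke (S := H) (Params.var Par.st) T := by
  have := Pres.mk_rel Rel.quad
  simp only [map_mul, map_sub, map_add, map_zero, Pres.mk_algebraMap] at this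
  exact this

theorem txt : T * X * T = X⁻¹ := by
  have := Pres.mk_rel Rel.txt
  rw [mk_w, mk_w] at this
  simpa using Units.ext this

theorem tyt : T⁻¹ * Y * T⁻¹ = Y⁻¹ := by
  have := Pres.mk_rel Rel.tyt
  rw [mk_w, mk_w] at this
  simpa using Units.ext this

theorem yx : Y⁻¹ * X⁻¹ * Y * X * T ^ 2 * Q ^ 2 = 1 := by
  have := Pres.mk_rel Rel.yx
  rw [map_mul, mk_w, Pres.mk_algebraMap] at this
  ext
  simpa [scalar] using this

section Lift

variable {R' S : Type*} [CommRing R'] [Ring S] [Algebra R' S]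

/-- The ring homomorphism from `H_{q,t}` to an `R'`-algebra `S` which is the substitution
`x ↦ α x` on the parameters and is given by `f` on the generators. -/
def lift (α : Par → R'ˣ) (f : Gen → Sˣ) (hquad : IsHecke (α .st) (f .T))
    (htxt : f .T * f .X * f .T = (f .X)⁻¹) (htyt : (f .T)⁻¹ * f .Y * (f .T)⁻¹ = (f .Y)⁻¹)
    (hyx : (f .Y)⁻¹ * (f .X)⁻¹ * f .Y * f .X * f .T ^ 2 * scalar S (α .q4) ^ 2 = 1) : H →+* S :=
  Pres.lift (Params.subst α) f <| by
    have hs : ∀ x, Params.subst α (Params.var x : Zˣ) = α x := fun x =>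
      congrArg Units.val (Params.map_subst_var α x)
    have hs' : ∀ x, Params.subst α ((Params.var x)⁻¹ : Zˣ) = ((α x)⁻¹ : R'ˣ) := fun x =>
      congrArg (fun u : R'ˣ => ((u⁻¹ : R'ˣ) : R')) (Params.map_subst_var α x)
    rintro _ _ (_ | _ | _ | _)
    · simp only [map_mul, map_sub, map_add, map_zero, freeLift_algebraMap, freeLift_of,
        FreeGroup.lift_apply_of, hs, hs']
      exact hquad
    · rw [freeLift_of, freeLift_of]
      simpa using congrArg Units.val htxt
    · rw [freeLift_of, freeLift_of]
      simpa using congrArg Units.val htyt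
    · rw [map_mul, map_one, freeLift_of, freeLift_algebraMap, Units.val_pow_eq_pow_val, map_pow, hs]
      simpa [scalar] using congrArg Units.val hyx

theorem lift_algebraMap (α : Par → R'ˣ) (f : Gen → Sˣ) (h1 h2 h3 h4) (a : Z) :
    lift α f h1 h2 h3 h4 (algebraMap Z H a) = algebraMap R' S (Params.subst α a) :=
  Pres.lift_algebraMap _ _ _ _

theorem lift_scalar (α : Par → R'ˣ) (f : Gen → Sˣ) (h1 h2 h3 h4) (i : Par) :
    Units.map (lift α f h1 h2 h3 h4 : H →* S) (scalar H (Params.var i)) = scalar S (α i) := by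
  ext
  have : Params.subst α (Params.var i : Zˣ) = α i :=
    congrArg Units.val (Params.map_subst_var α i)
  rw [Units.coe_map, MonoidHom.coe_coe]
  exact (lift_algebraMap α f h1 h2 h3 h4 _).trans (by rw [this]; rfl)

theorem lift_gen (α : Par → R'ˣ) (f : Gen → Sˣ) (h1 h2 h3 h4) (x : Gen) :
    Units.map (lift α f h1 h2 h3 h4 : H →* S) (Pres.gen x) = f x :=
  Pres.lift_gen _ _ _ _

end Lift

/-- The action of `η` and `⋆` on the parameters: both are inverted. -/
def parInv : Par → Zˣ := fun x => (Params.var x)⁻¹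

section Words

variable {G : Type*} [Group G] {q x y t : G}

theorem w_central (hq : ∀ g, q * g = g * q) (g : G) : q⁻¹ * g = g * q⁻¹ := by
  rw [inv_mul_eq_iff_eq_mul, ← mul_assoc, hq, mul_inv_cancel_right]

theorem w_central2 (hq : ∀ g, q * g = g * q) (g : G) : q ^ 2 * g = g * q ^ 2 := by
  rw [sq, mul_assoc, hq g, ← mul_assoc, hq g, mul_assoc]

theorem w_xt (h1 : t * x * t = x⁻¹) : x * t = t⁻¹ * x⁻¹ := by rw [← h1]; group

theorem w_yt (h2 : t⁻¹ * y * t⁻¹ = y⁻¹) : y * t⁻¹ = t * y⁻¹ := by rw [← h2]; group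

theorem w_comm (hq : ∀ g, q * g = g * q) (h3 : y⁻¹ * x⁻¹ * y * x * t ^ 2 * q ^ 2 = 1) :
    y⁻¹ * x⁻¹ * q ^ 2 = t⁻¹ * t⁻¹ * x⁻¹ * y⁻¹ := by
  have : y⁻¹ * x⁻¹ = q⁻¹ * q⁻¹ * (t⁻¹ * t⁻¹ * x⁻¹ * y⁻¹) := by
    rw [← mul_left_inj (y * x * t ^ 2 * q ^ 2)]
    simpa [mul_assoc, sq] using h3
  rw [← w_central2 hq, this]
  group

theorem w_comm' (h3 : y⁻¹ * x⁻¹ * y * x * t ^ 2 * q ^ 2 = 1) :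
    x * y = y * x * t ^ 2 * q ^ 2 := by
  rw [← mul_right_inj (y⁻¹ * x⁻¹)]
  simpa [mul_assoc] using h3.symm

theorem w_tauPlus (hq : ∀ g, q * g = g * q) (h1 : t * x * t = x⁻¹) (h2 : t⁻¹ * y * t⁻¹ = y⁻¹)
    (h3 : y⁻¹ * x⁻¹ * y * x * t ^ 2 * q ^ 2 = 1) :
    t⁻¹ * (q⁻¹ * x * y) * t⁻¹ = (q⁻¹ * x * y)⁻¹ := by
  have key : t⁻¹ * x * y * t⁻¹ = y⁻¹ * x⁻¹ * q ^ 2 := by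
    calc _ = t⁻¹ * x * (y * t⁻¹) := by group
      _ = t⁻¹ * (x * t) * y⁻¹ := by rw [w_yt h2]; group
      _ = _ := by rw [w_xt h1, w_comm hq h3]; group
  calc _ = (t⁻¹ * q⁻¹) * x * y * t⁻¹ := by group
    _ = q⁻¹ * (t⁻¹ * x * y * t⁻¹) := by rw [← w_central hq]; group
    _ = _ := by rw [key, w_central hq]; group

theorem w_tauPlusInv (hq : ∀ g, q * g = g * q) (h1 : t * x * t = x⁻¹)
    (h2 : t⁻¹ * y * t⁻¹ = y⁻¹) (h3 : y⁻¹ * x⁻¹ * y * x * t ^ 2 * q ^ 2 = 1) :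
    t⁻¹ * (q * x⁻¹ * y) * t⁻¹ = (q * x⁻¹ * y)⁻¹ := by
  have key : t⁻¹ * x⁻¹ * y * t⁻¹ * q ^ 2 = y⁻¹ * x := by
    calc _ = t⁻¹ * x⁻¹ * (y * t⁻¹) * q ^ 2 := by group
      _ = (t⁻¹ * x⁻¹) * t * (y⁻¹ * q ^ 2) := by rw [w_yt h2]; group
      _ = y⁻¹ * (y * x * t ^ 2 * q ^ 2) * y⁻¹ := by
        rw [← w_xt h1, ← w_central2 hq]; simp [mul_assoc, sq]
      _ = _ := by rw [← w_comm' h3]; group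
  calc _ = t⁻¹ * x⁻¹ * y * t⁻¹ * q ^ 2 * q⁻¹ := by
        rw [mul_assoc q, hq (x⁻¹ * y), mul_assoc, mul_assoc, hq t⁻¹]; group
    _ = _ := by rw [key]; group

theorem w_tauMinus (hq : ∀ g, q * g = g * q) (h1 : t * x * t = x⁻¹) (h2 : t⁻¹ * y * t⁻¹ = y⁻¹)
    (h3 : y⁻¹ * x⁻¹ * y * x * t ^ 2 * q ^ 2 = 1) :
    t * (q * y * x) * t = (q * y * x)⁻¹ := by
  have key : t * y * x * t * q ^ 2 = x⁻¹ * y⁻¹ := by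
    calc _ = t * y * (x * t) * q ^ 2 := by group
      _ = t * (y * t⁻¹) * x⁻¹ * q ^ 2 := by rw [w_xt h1]; group
      _ = t * t * (y⁻¹ * x⁻¹ * q ^ 2) := by rw [w_yt h2]; group
      _ = _ := by rw [w_comm hq h3]; group
  calc _ = t * y * x * t * q ^ 2 * q⁻¹ := by
        rw [mul_assoc q, hq (y * x), mul_assoc, mul_assoc, hq t]; group
    _ = _ := by rw [key]; group

theorem w_tauMinusInv (hq : ∀ g, q * g = g * q) (h1 : t * x * t = x⁻¹)
    (h2 : t⁻¹ * y * t⁻¹ = y⁻¹) (h3 : y⁻¹ * x⁻¹ * y * x * t ^ 2 * q ^ 2 = 1) :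
    t * (q⁻¹ * y⁻¹ * x) * t = (q⁻¹ * y⁻¹ * x)⁻¹ := by
  have key : t * y⁻¹ * x * t = x⁻¹ * y * q ^ 2 := by
    calc _ = (t * y⁻¹) * (x * t) := by group
      _ = x⁻¹ * (x * y) * t⁻¹ * t⁻¹ * x⁻¹ := by rw [w_xt h1, ← w_yt h2]; group
      _ = x⁻¹ * y * (x * t ^ 2 * (q ^ 2 * (t⁻¹ * t⁻¹ * x⁻¹))) := by rw [w_comm' h3]; group
      _ = _ := by rw [w_central2 hq]; group
  calc _ = (t * q⁻¹) * y⁻¹ * x * t := by group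
    _ = q⁻¹ * (t * y⁻¹ * x * t) := by rw [← w_central hq]; group
    _ = _ := by rw [key, w_central hq]; group

theorem w_cancel (hq : ∀ g, q * g = g * q) : (q⁻¹ * x * y)⁻¹ * x⁻¹ * (q⁻¹ * x * y) * x =
    y⁻¹ * x⁻¹ * y * x := by
  calc _ = y⁻¹ * x⁻¹ * (q * x⁻¹) * q⁻¹ * x * y * x := by group
    _ = _ := by rw [hq]; group

theorem w_cancel1 (hq : ∀ g, q * g = g * q) : (q * x⁻¹ * y)⁻¹ * x⁻¹ * (q * x⁻¹ * y) * x =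
    y⁻¹ * x⁻¹ * y * x := by
  calc _ = y⁻¹ * x * (q⁻¹ * x⁻¹) * q * x⁻¹ * y * x := by group
    _ = _ := by rw [w_central hq]; group

theorem w_cancel2 (hq : ∀ g, q * g = g * q) : y⁻¹ * (q * y * x)⁻¹ * y * (q * y * x) =
    y⁻¹ * x⁻¹ * y * x := by
  calc _ = y⁻¹ * x⁻¹ * y⁻¹ * (q⁻¹ * y) * q * y * x := by group
    _ = _ := by rw [w_central hq]; group

theorem w_cancel3 (hq : ∀ g, q * g = g * q) : y⁻¹ * (q⁻¹ * y⁻¹ * x)⁻¹ * y * (q⁻¹ * y⁻¹ * x) =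
    y⁻¹ * x⁻¹ * y * x := by
  calc _ = y⁻¹ * x⁻¹ * y * (q * y) * q⁻¹ * y⁻¹ * x := by group
    _ = _ := by rw [hq]; group

theorem w_eta1 (h1 : t * x * t = x⁻¹) : t⁻¹ * x⁻¹ * t⁻¹ = x⁻¹⁻¹ := by rw [inv_inv, ← h1]; group

theorem w_eta2 (h2 : t⁻¹ * y * t⁻¹ = y⁻¹) :
    t⁻¹⁻¹ * (t * y⁻¹ * t⁻¹) * t⁻¹⁻¹ = (t * y⁻¹ * t⁻¹)⁻¹ := by
  calc _ = t * (t * y⁻¹) := by group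
    _ = t * (y * t⁻¹) := by rw [w_yt h2]
    _ = _ := by group

theorem w_eta3 (hq : ∀ g, q * g = g * q) (h2 : t⁻¹ * y * t⁻¹ = y⁻¹)
    (h3 : y⁻¹ * x⁻¹ * y * x * t ^ 2 * q ^ 2 = 1) :
    (t * y⁻¹ * t⁻¹)⁻¹ * x⁻¹⁻¹ * (t * y⁻¹ * t⁻¹) * x⁻¹ * t⁻¹ ^ 2 * q⁻¹ ^ 2 = 1 := by
  calc _ = t * (y * t⁻¹) * x * (t * y⁻¹) * t⁻¹ * x⁻¹ * t⁻¹ ^ 2 * q⁻¹ ^ 2 := by group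
    _ = t * t * y⁻¹ * (x * y) * t⁻¹ * t⁻¹ * x⁻¹ * t⁻¹ ^ 2 * q⁻¹ ^ 2 := by
      rw [← w_yt h2]; nth_rw 1 [w_yt h2]; group
    _ = t * t * x * t ^ 2 * (q ^ 2 * (t⁻¹ * t⁻¹ * x⁻¹ * t⁻¹ ^ 2)) * q⁻¹ ^ 2 := by
      rw [w_comm' h3]; group
    _ = 1 := by rw [w_central2 hq]; group

theorem w_phi3 (h3 : y⁻¹ * x⁻¹ * y * x * t ^ 2 * q ^ 2 = 1) (hq : ∀ g, q * g = g * q) :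
    q ^ 2 * (t ^ 2 * (y⁻¹ * (x⁻¹ * (y * x)))) = 1 := by
  calc _ = (q ^ 2 * t ^ 2) * (y⁻¹ * x⁻¹ * y * x) := by group
    _ = (y⁻¹ * x⁻¹ * y * x)⁻¹ * (y⁻¹ * x⁻¹ * y * x * t ^ 2 * q ^ 2) * (y⁻¹ * x⁻¹ * y * x) := by
      rw [w_central2 hq]; group
    _ = _ := by rw [h3]; group

theorem w_star3 (h3 : y⁻¹ * x⁻¹ * y * x * t ^ 2 * q ^ 2 = 1) :
    q⁻¹ ^ 2 * (t⁻¹ ^ 2 * (x⁻¹ * (y⁻¹ * (x * y)))) = 1 := by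
  calc _ = (y⁻¹ * x⁻¹ * y * x * (t ^ 2 * q ^ 2))⁻¹ := by group
    _ = 1 := by rw [← mul_assoc, h3, inv_one]

theorem w_etaTauPlus (hq : ∀ g, q * g = g * q) (h1 : t * x * t = x⁻¹)
    (h2 : t⁻¹ * y * t⁻¹ = y⁻¹) (h3 : y⁻¹ * x⁻¹ * y * x * t ^ 2 * q ^ 2 = 1) :
    t⁻¹ * (t * y * t⁻¹ * x * q⁻¹) * t = q * x⁻¹ * y := by
  have e : t * y⁻¹ * x * t = x⁻¹ * y * q ^ 2 := by
    have := congrArg (fun g => q * g⁻¹⁻¹) (w_tauMinusInv hq h1 h2 h3)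
    simp only [inv_inv] at this
    calc _ = (q * t) * (q⁻¹ * y⁻¹ * x) * t := by
          rw [hq]; group
      _ = (q * (x⁻¹ * y)) * q := by
          rw [mul_assoc q t, mul_assoc q, this]; group
      _ = _ := by rw [hq, sq, mul_assoc]
  calc _ = (y * t⁻¹) * x * (q⁻¹ * t) := by group
    _ = (t * y⁻¹ * x * t) * q⁻¹ := by rw [w_yt h2, w_central hq]; group
    _ = (x⁻¹ * y) * q := by rw [e]; group
    _ = _ := by rw [← hq]; group

theorem w_etaTauMinus (hq : ∀ g, q * g = g * q)
    (h2 : t⁻¹ * y * t⁻¹ = y⁻¹) (h3 : y⁻¹ * x⁻¹ * y * x * t ^ 2 * q ^ 2 = 1) :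
    x * (t * y * t⁻¹) * q = q⁻¹ * y⁻¹ * x := by
  have e : x * t ^ 2 * q ^ 2 * y⁻¹ = y⁻¹ * x := by
    calc _ = y⁻¹ * (y * x * t ^ 2 * q ^ 2) * y⁻¹ := by group
      _ = _ := by rw [← w_comm' h3]; group
  calc _ = x * t * (y * t⁻¹) * q := by group
    _ = x * t ^ 2 * (y⁻¹ * q ^ 2) * q⁻¹ := by rw [w_yt h2]; simp [sq, mul_assoc]
    _ = (y⁻¹ * x) * q⁻¹ := by rw [← w_central2 hq, ← mul_assoc, e]
    _ = _ := by rw [← w_central hq]; group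

end Words

theorem Q_comm (x : Hˣ) : Q * x = x * Q := scalar_comm _ x

/-- The automorphism `τ_+`: `X ↦ X`, `T ↦ T`, `Y ↦ q^{-1/4} X Y`, as an endomorphism. -/
def tauPlusHom : H →+* H :=
  lift Params.var (fun | .X => X | .Y => Q⁻¹ * X * Y | .T => T)
    T_isHecke txt (w_tauPlus Q_comm txt tyt yx) (by rw [w_cancel Q_comm]; exact yx)

/-- The inverse of `τ_+`. -/
def tauPlusInvHom : H →+* H :=
  lift Params.var (fun | .X => X | .Y => Q * X⁻¹ * Y | .T => T)
    T_isHecke txt (w_tauPlusInv Q_comm txt tyt yx) (by rw [w_cancel1 Q_comm]; exact yx)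

/-- The automorphism `τ_-`: `Y ↦ Y`, `T ↦ T`, `X ↦ q^{1/4} Y X`, as an endomorphism. -/
def tauMinusHom : H →+* H :=
  lift Params.var (fun | .X => Q * Y * X | .Y => Y | .T => T)
    T_isHecke (w_tauMinus Q_comm txt tyt yx) tyt (by rw [w_cancel2 Q_comm]; exact yx)

/-- The inverse of `τ_-`. -/
def tauMinusInvHom : H →+* H :=
  lift Params.var (fun | .X => Q⁻¹ * Y⁻¹ * X | .Y => Y | .T => T)
    T_isHecke (w_tauMinusInv Q_comm txt tyt yx) tyt (by rw [w_cancel3 Q_comm]; exact yx)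

/-- The automorphism `η`: `X ↦ X⁻¹`, `Y ↦ T Y⁻¹ T⁻¹`, `T ↦ T⁻¹`, `q, t ↦ q⁻¹, t⁻¹`, as an
endomorphism. -/
def etaHom : H →+* H :=
  lift parInv (fun | .X => X⁻¹ | .Y => T * Y⁻¹ * T⁻¹ | .T => T⁻¹)
    T_isHecke.inv (w_eta1 txt) (w_eta2 tyt)
    (by rw [parInv, scalar_inv]; exact w_eta3 Q_comm tyt yx)

/-- The anti-involution `φ`: `X ↦ Y⁻¹`, `Y ↦ X⁻¹`, `T ↦ T`, `q, t` are fixed. -/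
def phi : H →+* Hᵐᵒᵖ :=
  lift Params.var (fun | .X => opUnit Y⁻¹ | .Y => opUnit X⁻¹ | .T => opUnit T)
    T_isHecke.op
    (by
      have h : T * (Y⁻¹ * T) = Y := by rw [← tyt]; group
      simp only [← opUnit_mul, ← opUnit_inv, h, inv_inv])
    (by
      have h : T⁻¹ * (X⁻¹ * T⁻¹) = X := by rw [← txt]; group
      simp only [← opUnit_mul, ← opUnit_inv, h, inv_inv])
    (by
      have h := w_phi3 yx Q_comm
      simp only [sq, ← opUnit_scalar, ← opUnit_mul, ← opUnit_inv, inv_inv, ← opUnit_one]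
      simp only [sq] at h
      rw [h])

/-- The inversion anti-involution `⋆`: `X ↦ X⁻¹`, `Y ↦ Y⁻¹`, `T ↦ T⁻¹`, `q, t ↦ q⁻¹, t⁻¹`. -/
def star : H →+* Hᵐᵒᵖ :=
  lift parInv (fun x => opUnit (Pres.gen x)⁻¹)
    T_isHecke.inv.op
    (by
      have h : T⁻¹ * (X⁻¹ * T⁻¹) = X := by rw [← txt]; group
      simp only [← opUnit_mul, ← opUnit_inv, h, inv_inv])
    (by
      have h : T * (Y⁻¹ * T) = Y := by rw [← tyt]; group
      simp only [← opUnit_mul, ← opUnit_inv, h, inv_inv])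
    (by
      have h := w_star3 yx
      simp only [parInv, scalar_inv, sq, ← opUnit_scalar, ← opUnit_mul, ← opUnit_inv, inv_inv,
        ← opUnit_one]
      simp only [sq] at h
      rw [h])

theorem Q_left (g z : Hˣ) : g * (Q * z) = Q * (g * z) := by
  rw [← mul_assoc, ← Q_comm, mul_assoc]

theorem Q_left' (g z : Hˣ) : g * (Q⁻¹ * z) = Q⁻¹ * (g * z) := by
  rw [← mul_assoc, ← w_central Q_comm, mul_assoc]

theorem tauPlus_scalar (i : Par) :
    Units.map (tauPlusHom : H →* H) (scalar H (Params.var i)) = scalar H (Params.var i) :=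
  lift_scalar _ _ _ _ _ _ _

theorem tauPlus_X : Units.map (tauPlusHom : H →* H) X = X :=
  lift_gen _ _ _ _ _ _ Gen.X

theorem tauPlus_Y : Units.map (tauPlusHom : H →* H) Y = Q⁻¹ * X * Y :=
  lift_gen _ _ _ _ _ _ Gen.Y

theorem tauPlus_T : Units.map (tauPlusHom : H →* H) T = T :=
  lift_gen _ _ _ _ _ _ Gen.T

theorem tauPlusInv_scalar (i : Par) :
    Units.map (tauPlusInvHom : H →* H) (scalar H (Params.var i)) = scalar H (Params.var i) :=
  lift_scalar _ _ _ _ _ _ _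

theorem tauPlusInv_X : Units.map (tauPlusInvHom : H →* H) X = X :=
  lift_gen _ _ _ _ _ _ Gen.X

theorem tauPlusInv_Y : Units.map (tauPlusInvHom : H →* H) Y = Q * X⁻¹ * Y :=
  lift_gen _ _ _ _ _ _ Gen.Y

theorem tauPlusInv_T : Units.map (tauPlusInvHom : H →* H) T = T :=
  lift_gen _ _ _ _ _ _ Gen.T

theorem tauMinus_scalar (i : Par) :
    Units.map (tauMinusHom : H →* H) (scalar H (Params.var i)) = scalar H (Params.var i) :=
  lift_scalar _ _ _ _ _ _ _

theorem tauMinus_X : Units.map (tauMinusHom : H →* H) X = Q * Y * X :=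
  lift_gen _ _ _ _ _ _ Gen.X

theorem tauMinus_Y : Units.map (tauMinusHom : H →* H) Y = Y :=
  lift_gen _ _ _ _ _ _ Gen.Y

theorem tauMinus_T : Units.map (tauMinusHom : H →* H) T = T :=
  lift_gen _ _ _ _ _ _ Gen.T

theorem tauMinusInv_scalar (i : Par) :
    Units.map (tauMinusInvHom : H →* H) (scalar H (Params.var i)) = scalar H (Params.var i) :=
  lift_scalar _ _ _ _ _ _ _

theorem tauMinusInv_X : Units.map (tauMinusInvHom : H →* H) X = Q⁻¹ * Y⁻¹ * X :=
  lift_gen _ _ _ _ _ _ Gen.X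

theorem tauMinusInv_Y : Units.map (tauMinusInvHom : H →* H) Y = Y :=
  lift_gen _ _ _ _ _ _ Gen.Y

theorem tauMinusInv_T : Units.map (tauMinusInvHom : H →* H) T = T :=
  lift_gen _ _ _ _ _ _ Gen.T

theorem eta_scalar (i : Par) :
    Units.map (etaHom : H →* H) (scalar H (Params.var i)) = scalar H (parInv i) :=
  lift_scalar _ _ _ _ _ _ _

theorem eta_X : Units.map (etaHom : H →* H) X = X⁻¹ :=
  lift_gen _ _ _ _ _ _ Gen.X

theorem eta_Y : Units.map (etaHom : H →* H) Y = T * Y⁻¹ * T⁻¹ :=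
  lift_gen _ _ _ _ _ _ Gen.Y

theorem eta_T : Units.map (etaHom : H →* H) T = T⁻¹ :=
  lift_gen _ _ _ _ _ _ Gen.T

/-- The automorphism `τ_+`. -/
def tauPlus : H ≃+* H :=
  RingEquiv.ofRingHom tauPlusHom tauPlusInvHom
    (Pres.param_hom_ext (fun i => by simp only [Pres.map_comp, tauPlus_scalar, tauPlusInv_scalar]; rfl)
      (by
        rintro (_ | _ | _) <;>
        simp only [Pres.map_comp, map_mul, map_inv, tauPlus_scalar, tauPlus_X, tauPlus_Y, tauPlus_T,
          tauPlusInv_scalar, tauPlusInv_X, tauPlusInv_Y, tauPlusInv_T] <;>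
        simp [mul_assoc, Q_left, Q_left', Pres.map_id]))
    (Pres.param_hom_ext (fun i => by simp only [Pres.map_comp, tauPlus_scalar, tauPlusInv_scalar]; rfl)
      (by
        rintro (_ | _ | _) <;>
        simp only [Pres.map_comp, map_mul, map_inv, tauPlus_scalar, tauPlus_X, tauPlus_Y, tauPlus_T,
          tauPlusInv_scalar, tauPlusInv_X, tauPlusInv_Y, tauPlusInv_T] <;>
        simp [mul_assoc, Q_left, Q_left', Pres.map_id]))

/-- The automorphism `τ_-`. -/
def tauMinus : H ≃+* H :=
  RingEquiv.ofRingHom tauMinusHom tauMinusInvHom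
    (Pres.param_hom_ext (fun i => by simp only [Pres.map_comp, tauMinus_scalar, tauMinusInv_scalar]; rfl)
      (by
        rintro (_ | _ | _) <;>
        simp only [Pres.map_comp, map_mul, map_inv, tauMinus_scalar, tauMinus_X, tauMinus_Y, tauMinus_T,
          tauMinusInv_scalar, tauMinusInv_X, tauMinusInv_Y, tauMinusInv_T] <;>
        simp [mul_assoc, Q_left, Q_left', Pres.map_id]))
    (Pres.param_hom_ext (fun i => by simp only [Pres.map_comp, tauMinus_scalar, tauMinusInv_scalar]; rfl)
      (by
        rintro (_ | _ | _) <;>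
        simp only [Pres.map_comp, map_mul, map_inv, tauMinus_scalar, tauMinus_X, tauMinus_Y, tauMinus_T,
          tauMinusInv_scalar, tauMinusInv_X, tauMinusInv_Y, tauMinusInv_T] <;>
        simp [mul_assoc, Q_left, Q_left', Pres.map_id]))

theorem etaHom_etaHom : etaHom.comp etaHom = RingHom.id H :=
  Pres.param_hom_ext
    (fun i => by simp only [Pres.map_comp, eta_scalar, parInv, scalar_inv, map_inv, inv_inv]; rfl)
    (by
      rintro (_ | _ | _) <;>
      simp only [Pres.map_comp, map_mul, map_inv, eta_X, eta_Y, eta_T] <;>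
      simp [mul_assoc])

/-- The automorphism `η`. -/
def eta : H ≃+* H := RingEquiv.ofRingHom etaHom etaHom etaHom_etaHom etaHom_etaHom

/-- The action of `GL_2^∧(ℤ)` on `H_{q,t}` by ring automorphisms. -/
def act : GLHat →* RingAut H :=
  GLHat.lift tauPlus tauMinus eta
    (RingEquiv.toRingHom_injective <| by
      change tauPlusHom.comp (tauMinusInvHom.comp tauPlusHom) =
        tauMinusInvHom.comp (tauPlusHom.comp tauMinusInvHom)
      refine Pres.param_hom_ext
        (fun i => by simp only [Pres.map_comp, tauPlus_scalar, tauMinusInv_scalar]) ?_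
      rintro (_ | _ | _) <;>
      simp only [Pres.map_comp, map_mul, map_inv, tauPlus_scalar, tauPlus_X, tauPlus_Y, tauPlus_T,
        tauMinusInv_scalar, tauMinusInv_X, tauMinusInv_Y, tauMinusInv_T] <;>
      simp [mul_assoc, ← Q_comm Y⁻¹, ← w_central Q_comm Y⁻¹, Q_left X, Q_left X⁻¹, Q_left Y, Q_left Y⁻¹, Q_left' X, Q_left' X⁻¹,
        Q_left' Y, Q_left' Y⁻¹])
    (RingEquiv.toRingHom_injective etaHom_etaHom)
    (RingEquiv.toRingHom_injective <| by
      change etaHom.comp (tauPlusHom.comp etaHom) = tauPlusInvHom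
      refine Pres.param_hom_ext (fun i => by
        simp only [Pres.map_comp, tauPlus_scalar, tauPlusInv_scalar, eta_scalar, parInv,
          scalar_inv, map_inv, inv_inv]) ?_
      rintro (_ | _ | _) <;>
      simp only [Pres.map_comp, map_mul, map_inv, mul_inv_rev, inv_inv, eta_scalar, eta_X, eta_Y,
        eta_T, tauPlus_scalar, tauPlus_X, tauPlus_Y, tauPlus_T, tauPlusInv_X, tauPlusInv_Y, tauPlusInv_T]
      simpa only [mul_assoc, parInv, scalar_inv] using w_etaTauPlus Q_comm txt tyt yx)
    (RingEquiv.toRingHom_injective <| by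
      change etaHom.comp (tauMinusHom.comp etaHom) = tauMinusInvHom
      refine Pres.param_hom_ext (fun i => by
        simp only [Pres.map_comp, tauMinus_scalar, tauMinusInv_scalar, eta_scalar, parInv,
          scalar_inv, map_inv, inv_inv]) ?_
      rintro (_ | _ | _) <;>
      simp only [Pres.map_comp, map_mul, map_inv, mul_inv_rev, inv_inv, eta_scalar, eta_X, eta_Y,
        eta_T, tauMinus_scalar, tauMinus_X, tauMinus_Y, tauMinus_T, tauMinusInv_X, tauMinusInv_Y, tauMinusInv_T]
      · simpa only [mul_assoc, parInv, scalar_inv, inv_inv] using w_etaTauMinus Q_comm tyt yx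
      · simp [mul_assoc])

end A1
/-! ### Demazure–Lusztig operators and polynomial representations -/

section Operators

open LaurentPolynomial

variable {k : Type*} [CommRing k]

/-- The variable `x` as an invertible Laurent polynomial. -/
def xUnit (k : Type*) [CommRing k] : (LaurentPolynomial k)ˣ where
  val := T 1
  inv := T (-1)
  val_inv := by rw [← T_add]; simp
  inv_val := by rw [← T_add]; simp

/-- The substitution `x ↦ a x⁻¹`, i.e. `x^m ↦ a^m x^{-m}`. -/
def reflect (a : kˣ) : LaurentPolynomial k →ₐ[k] LaurentPolynomial k :=
  AddMonoidAlgebra.lift k (LaurentPolynomial k) ℤ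
    ((Units.coeHom _).comp (zpowersHom (LaurentPolynomial k)ˣ
      (Units.map (C : k →+* LaurentPolynomial k) a * (xUnit k)⁻¹)))

theorem xUnit_zpow (m : ℤ) :
    ((xUnit k ^ m : (LaurentPolynomial k)ˣ) : LaurentPolynomial k) = T m := by
  have h : ∀ n : ℕ, ((xUnit k ^ n : (LaurentPolynomial k)ˣ) : LaurentPolynomial k) = T n :=
    fun n => by
      rw [Units.val_pow_eq_pow_val]
      exact (T_pow 1 n).trans (by rw [mul_one])
  have h' : ∀ n : ℕ, (((xUnit k)⁻¹ ^ n : (LaurentPolynomial k)ˣ) : LaurentPolynomial k) =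
      T (-n) := fun n => by
      rw [Units.val_pow_eq_pow_val]
      exact (T_pow (-1) n).trans (by rw [mul_neg, mul_one])
  obtain ⟨n, rfl | rfl⟩ := m.eq_nat_or_neg
  · rw [zpow_natCast, h]
  · rw [zpow_neg, ← inv_zpow, zpow_natCast, h']

theorem reflect_T (a : kˣ) (m : ℤ) :
    reflect a (T m) = C ((a ^ m : kˣ) : k) * T (-m) := by
  have : (T m : LaurentPolynomial k) = AddMonoidAlgebra.single m 1 := rfl
  rw [this, reflect, AddMonoidAlgebra.lift_single, one_smul, MonoidHom.comp_apply,
    zpowersHom_apply, toAdd_ofAdd, mul_zpow, inv_zpow, ← zpow_neg, ← map_zpow]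
  change ((_ * _ : (LaurentPolynomial k)ˣ) : LaurentPolynomial k) = _
  rw [Units.val_mul, xUnit_zpow]
  rfl

/-- The operator `f ↦ (f(x) - f(x⁻¹)) / (1 - x²)`, given by the quotient on the basis. -/
def divDiff : LaurentPolynomial k →ₗ[k] LaurentPolynomial k :=
  (Finsupp.linearCombination k fun m : ℤ =>
    if 0 ≤ m then -∑ j ∈ Finset.range m.toNat, T (2 * j - m)
    else ∑ j ∈ Finset.range (-m).toNat, T (2 * j + m)) ∘ₗ
  (AddMonoidAlgebra.coeffLinearEquiv k).toLinearMap

theorem divDiff_T (m : ℤ) : divDiff (T m : LaurentPolynomial k) =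
    if 0 ≤ m then -∑ j ∈ Finset.range m.toNat, T (2 * j - m)
    else ∑ j ∈ Finset.range (-m).toNat, T (2 * j + m) := by
  have : AddMonoidAlgebra.coeffLinearEquiv k (T m : LaurentPolynomial k) = Finsupp.single m 1 := rfl
  rw [divDiff, LinearMap.comp_apply, LinearEquiv.coe_coe, this,
    Finsupp.linearCombination_single, one_smul]

theorem sum_T (m : ℤ) (n : ℕ) : (1 - T 2) * ∑ j ∈ Finset.range n, (T (2 * j + m) :
    LaurentPolynomial k) = T m - T (2 * n + m) := by
  have h : ∀ j : ℕ, (1 - T 2) * (T (2 * j + m) : LaurentPolynomial k) =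
      T (2 * (j : ℤ) + m) - T (2 * ((j + 1 : ℕ) : ℤ) + m) := fun j => by
    rw [sub_mul, one_mul, ← T_add]
    congr 2
    push_cast; ring
  rw [Finset.mul_sum, Finset.sum_congr rfl fun j _ => h j,
    Finset.sum_range_sub' (fun j : ℕ => (T (2 * (j : ℤ) + m) : LaurentPolynomial k))]
  simp

theorem divDiff_spec (f : LaurentPolynomial k) :
    (1 - T 2) * divDiff f = f - reflect 1 f := by
  induction f using LaurentPolynomial.induction_on' with
  | add p q hp hq => rw [map_add, map_add, mul_add, hp, hq]; abel
  | C_mul_T m a =>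
    have h : (1 - T 2) * divDiff (T m : LaurentPolynomial k) = T m - reflect 1 (T m) := by
      rw [divDiff_T, reflect_T, one_zpow, Units.val_one, map_one, one_mul]
      split_ifs with h
      · have := sum_T (k := k) (-m) m.toNat
        rw [Int.toNat_of_nonneg h] at this
        simp only [← sub_eq_add_neg] at this
        rw [mul_neg, this, neg_sub]
        congr 2; ring
      · have := sum_T (k := k) m (-m).toNat
        rw [Int.toNat_of_nonneg (by omega)] at this
        rw [this]
        congr 2; ring
    rw [← smul_eq_C_mul, map_smul, map_smul, mul_smul_comm, h, smul_sub]

/-- The operator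
`a s + ((a - a⁻¹) + (b - b⁻¹) x) (1 - x²)⁻¹ (1 - s)`, where `s(x^m) = x^{-m}`. -/
def demazure (a b : kˣ) : LaurentPolynomial k →ₗ[k] LaurentPolynomial k :=
  (a : k) • (reflect 1).toLinearMap +
    LinearMap.mulLeft k (C ((a : k) - (a⁻¹ : kˣ)) + C ((b : k) - (b⁻¹ : kˣ)) * T 1) ∘ₗ divDiff

/-- `(1 - x²) D = (1 - x²) a s + ((a - a⁻¹) + (b - b⁻¹) x) (1 - s)`. -/
theorem demazure_spec (a b : kˣ) (f : LaurentPolynomial k) :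
    (1 - T 2) * demazure a b f = (1 - T 2) * (C (a : k) * reflect 1 f) +
      (C ((a : k) - (a⁻¹ : kˣ)) + C ((b : k) - (b⁻¹ : kˣ)) * T 1) * (f - reflect 1 f) := by
  rw [← divDiff_spec, demazure, LinearMap.add_apply, LinearMap.smul_apply, smul_eq_C_mul,
    LinearMap.comp_apply, LinearMap.mulLeft_apply]
  change _ * (C (a : k) * reflect 1 f + _) = _
  ring

theorem reflect_reflect (a : kˣ) (f : LaurentPolynomial k) : reflect a (reflect a f) = f := by
  induction f using LaurentPolynomial.induction_on' with
  | add p q hp hq => rw [map_add, map_add, hp, hq]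
  | C_mul_T m c =>
    rw [← smul_eq_C_mul, map_smul, map_smul, reflect_T, ← smul_eq_C_mul, map_smul, reflect_T,
      ← smul_eq_C_mul, neg_neg]
    rw [smul_smul, smul_smul, mul_assoc, ← Units.val_mul, ← zpow_add]
    simp

/-- Multiplication by a Laurent polynomial, commuting with a substitution. -/
theorem reflect_mul_T (a : kˣ) (f : LaurentPolynomial k) :
    reflect a (T 1 * f) = C (a : k) * T (-1) * reflect a f := by
  rw [map_mul, reflect_T, zpow_one]

theorem C_units (a : kˣ) : (C (a : k) * C ((a⁻¹ : kˣ) : k) : LaurentPolynomial k) = 1 := by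
  rw [← map_mul, Units.mul_inv, map_one]

/-- Multiplication by `x` as an invertible operator. -/
def mulX (k : Type*) [CommRing k] : (Module.End k (LaurentPolynomial k))ˣ where
  val := LinearMap.mulLeft k (T 1)
  inv := LinearMap.mulLeft k (T (-1))
  val_inv := LinearMap.ext fun f => by
    change T 1 * (T (-1) * f) = f
    rw [← mul_assoc, ← T_add]; simp
  inv_val := LinearMap.ext fun f => by
    change T (-1) * (T 1 * f) = f
    rw [← mul_assoc, ← T_add]; simp

/-- The substitution `x ↦ a x⁻¹` as an invertible operator. -/
def reflectUnit (a : kˣ) : (Module.End k (LaurentPolynomial k))ˣ where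
  val := (reflect a).toLinearMap
  inv := (reflect a).toLinearMap
  val_inv := LinearMap.ext fun f => reflect_reflect a f
  inv_val := LinearMap.ext fun f => reflect_reflect a f

theorem reflectUnit_inv (a : kˣ) : (reflectUnit a)⁻¹ = reflectUnit a := rfl

theorem scalar_end_apply (a : kˣ) (f : LaurentPolynomial k) :
    (scalar (Module.End k (LaurentPolynomial k)) a : Module.End k (LaurentPolynomial k)) f =
      C (a : k) * f :=
  smul_eq_C_mul (a : k) f

theorem reflectUnit_mulX (a : kˣ) : reflectUnit a * mulX k =
    scalar (Module.End k (LaurentPolynomial k)) a * (mulX k)⁻¹ * reflectUnit a := by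
  refine Units.ext (LinearMap.ext fun f => ?_)
  rw [Units.val_mul, Units.val_mul, Units.val_mul, Module.End.mul_apply, Module.End.mul_apply,
    Module.End.mul_apply, scalar_end_apply]
  exact (reflect_mul_T a f).trans (mul_assoc _ _ _)

theorem isHecke_of_sq {S : Type*} [Ring S] [Algebra k S] {a : kˣ} {x : Sˣ}
    (h : (x : S) * x = ((a : k) - (a⁻¹ : kˣ)) • (x : S) + 1) : IsHecke a x := by
  unfold IsHecke
  have h1 : algebraMap k S a * algebraMap k S ((a⁻¹ : kˣ) : k) = 1 := by
    rw [← map_mul, Units.mul_inv, map_one]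
  rw [sub_mul, mul_add, mul_add, h, h1, ← Algebra.commutes, sub_smul, Algebra.smul_def,
    Algebra.smul_def]
  abel

theorem reflect_conj (a : kˣ) (f : LaurentPolynomial k) :
    reflect a (reflect 1 (reflect a f)) = reflect (a ^ 2) f := by
  induction f using LaurentPolynomial.induction_on' with
  | add p q hp hq => simp only [map_add, hp, hq]
  | C_mul_T m c =>
    rw [← smul_eq_C_mul]
    simp only [map_smul, reflect_T, ← smul_eq_C_mul, neg_neg, one_zpow, Units.val_one, one_smul,
      smul_smul, sq, mul_zpow, Units.val_mul, mul_assoc]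

section Words

variable {G : Type*} [Group G] {r x t u v Q : G}

theorem w_reflect (hQ : ∀ g, Q * g = g * Q) (e : r * x = Q * x⁻¹ * r) :
    r * x⁻¹ = Q⁻¹ * x * r := by
  rw [mul_inv_eq_iff_eq_mul]
  calc r = Q⁻¹ * (Q * x) * x⁻¹ * r := by group
    _ = Q⁻¹ * x * (Q * x⁻¹ * r) := by rw [hQ]; group
    _ = _ := by rw [← e]; group

theorem w_prod (hQ : ∀ g, Q * g = g * Q) :
    Q * (v⁻¹ * x⁻¹) * (Q⁻¹ * x * u⁻¹) * u * v = 1 := by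
  calc _ = Q * (v⁻¹ * x⁻¹) * Q⁻¹ * x * v := by group
    _ = 1 := by rw [hQ]; group

theorem w_yx (hQ : ∀ g, Q * g = g * Q) (e : r * x = Q ^ 2 * x⁻¹ * r) (h : t * x * t = x⁻¹) :
    (r * t)⁻¹ * x⁻¹ * (r * t) * x * t ^ 2 * Q ^ 2 = 1 := by
  have hQ2 : ∀ g, Q ^ 2 * g = g * Q ^ 2 := fun g => by
    rw [sq, mul_assoc, hQ g, ← mul_assoc, hQ g, mul_assoc]
  calc _ = t⁻¹ * r⁻¹ * x⁻¹ * r * (t * x * t) * t * Q ^ 2 := by rw [sq t]; group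
    _ = t⁻¹ * r⁻¹ * x⁻¹ * (r * x⁻¹) * (t * Q ^ 2) := by rw [h]; group
    _ = t⁻¹ * r⁻¹ * x⁻¹ * ((Q ^ 2)⁻¹ * x * r) * (Q ^ 2 * t) := by rw [w_reflect hQ2 e, hQ2 t]
    _ = t⁻¹ * r⁻¹ * x⁻¹ * (Q ^ 2)⁻¹ * (x * r * Q ^ 2) * t := by group
    _ = 1 := by rw [← hQ2]; group

end Words

section Domain

variable [IsDomain k]

theorem cancel_one_sub {f g : LaurentPolynomial k} (h : (1 - T 2) * f = (1 - T 2) * g) :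
    f = g := by
  refine mul_left_cancel₀ (sub_ne_zero.mpr fun h0 => ?_) h
  have h1 : (Finsupp.single 0 1 : ℤ →₀ k) = Finsupp.single 2 1 :=
    congrArg (fun p : LaurentPolynomial k => p.coeff) h0
  have h2 := DFunLike.congr_fun h1 0
  simp at h2

theorem reflect_divDiff (f : LaurentPolynomial k) :
    reflect 1 (divDiff f) = T 2 * divDiff f := by
  apply cancel_one_sub
  have h := congrArg (reflect 1) (divDiff_spec f)
  have e : (T 2 * T (-2) : LaurentPolynomial k) = 1 := by rw [← T_add]; simp
  rw [map_mul, map_sub, map_sub, map_one, reflect_T, reflect_reflect] at h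
  simp only [one_zpow, Units.val_one, map_one, one_mul] at h
  linear_combination (-T 2) * h - T 2 * divDiff_spec f - reflect 1 (divDiff f) * e

theorem demazure_eq (a b : kˣ) (f : LaurentPolynomial k) :
    demazure a b f = C (a : k) * (f - (1 - T 2) * divDiff f) +
      (C (a : k) - C ((a⁻¹ : kˣ) : k) + (C (b : k) - C ((b⁻¹ : kˣ) : k)) * T 1) * divDiff f := by
  apply cancel_one_sub
  rw [demazure_spec, divDiff_spec, map_sub, map_sub]
  linear_combination (-(C (a : k) - C ((a⁻¹ : kˣ) : k) + (C (b : k) - C ((b⁻¹ : kˣ) : k)) * T 1)) * divDiff_spec f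

theorem divDiff_demazure (a b : kˣ) (f : LaurentPolynomial k) :
    divDiff (demazure a b f) = - C ((a⁻¹ : kˣ) : k) * divDiff f := by
  apply cancel_one_sub
  rw [divDiff_spec]
  have hc : ∀ c : k, reflect 1 (C c) = (C c : LaurentPolynomial k) := fun c => by
    have := reflect_T (1 : kˣ) (0 : ℤ)
    rw [← mul_one (C c), ← smul_eq_C_mul, map_smul, map_one]
  have e : (T 2 : LaurentPolynomial k) = T 1 * T 1 := by rw [← T_add]; rfl
  have e' : (T 1 * T (-1) : LaurentPolynomial k) = 1 := by rw [← T_add]; simp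
  have h2 : reflect (1 : kˣ) (T 2) = (T (-1) * T (-1) : LaurentPolynomial k) := by
    rw [e, map_mul, reflect_T]; simp
  have h1 : reflect (1 : kˣ) (T 1) = (T (-1) : LaurentPolynomial k) := by
    rw [reflect_T]; simp
  have hf : reflect 1 f = f - (1 - T 2) * divDiff f := by rw [divDiff_spec]; ring
  rw [demazure_eq]
  simp only [map_add, map_mul, map_sub, hc, h1, h2, reflect_divDiff, hf, map_one]
  rw [e]
  generalize (T 1 : LaurentPolynomial k) = x at *
  generalize (T (-1) : LaurentPolynomial k) = y at *
  linear_combination (-C (a : k) * divDiff f * (x * y + 1) -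
    (C (b : k) - C ((b⁻¹ : kˣ) : k)) * divDiff f * x) * e'

theorem demazure_demazure (a b : kˣ) (f : LaurentPolynomial k) :
    demazure a b (demazure a b f) = (C (a : k) - C ((a⁻¹ : kˣ) : k)) * demazure a b f + f := by
  rw [demazure_eq a b (demazure a b f), divDiff_demazure, demazure_eq]
  have e : (T 2 : LaurentPolynomial k) = T 1 * T 1 := by rw [← T_add]; rfl
  rw [e]
  have h := C_units a
  generalize (T 1 : LaurentPolynomial k) = x at *
  generalize (C (a : k) : LaurentPolynomial k) = A at *
  generalize (C ((a⁻¹ : kˣ) : k) : LaurentPolynomial k) = A' at *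
  generalize (C (b : k) : LaurentPolynomial k) = B at *
  generalize (C ((b⁻¹ : kˣ) : k) : LaurentPolynomial k) = B' at *
  linear_combination f * h

theorem divDiff_mul_T (f : LaurentPolynomial k) :
    divDiff (T 1 * f) = T (-1) * divDiff f - T (-1) * f := by
  apply cancel_one_sub
  have e : (T 2 : LaurentPolynomial k) = T 1 * T 1 := by rw [← T_add]; rfl
  have e' : (T 1 * T (-1) : LaurentPolynomial k) = 1 := by rw [← T_add]; simp
  have h := divDiff_spec f
  rw [divDiff_spec, reflect_mul_T, Units.val_one, map_one]
  rw [e] at *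
  linear_combination (-T (-1)) * h + (-T 1 * f) * e'

theorem mul_demazure (a b : kˣ) (f : LaurentPolynomial k) :
    T 1 * demazure a b (T 1 * demazure a b f) =
      (C ((b⁻¹ : kˣ) : k) - C (b : k)) * (T 1 * demazure a b f) + f := by
  have e : (T 2 : LaurentPolynomial k) = T 1 * T 1 := by rw [← T_add]; rfl
  have e' : (T 1 * T (-1) : LaurentPolynomial k) = 1 := by rw [← T_add]; simp
  have h := demazure_demazure a b f
  have h1 := demazure_eq a b (demazure a b f)
  rw [demazure_eq a b (T 1 * _), divDiff_mul_T]
  rw [e] at *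
  generalize divDiff (demazure a b f) = d at *
  generalize demazure a b (demazure a b f) = PP at *
  generalize demazure a b f = P at *
  generalize (C (a : k) : LaurentPolynomial k) = A at *
  generalize (C ((a⁻¹ : kˣ) : k) : LaurentPolynomial k) = A' at *
  generalize (C (b : k) : LaurentPolynomial k) = B at *
  generalize (C ((b⁻¹ : kˣ) : k) : LaurentPolynomial k) = B' at *
  generalize (T 1 : LaurentPolynomial k) = x at *
  generalize (T (-1) : LaurentPolynomial k) = y at *
  linear_combination ((-A * (1 - x*x) + (A - A' + (B - B')*x)) * (d - P)) * e' - h1 + h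

theorem demazure_sq (a b : kˣ) : (demazure a b * demazure a b : Module.End k (LaurentPolynomial k)) =
    ((a : k) - (a⁻¹ : kˣ)) • demazure a b + 1 := by
  refine LinearMap.ext fun f => ?_
  rw [Module.End.mul_apply, demazure_demazure, LinearMap.add_apply, LinearMap.smul_apply,
    smul_eq_C_mul, map_sub, Module.End.one_apply]

/-- A Demazure-Lusztig operator as an invertible operator; the inverse is given by the Hecke
relation. -/
def demazureUnit (a b : kˣ) : (Module.End k (LaurentPolynomial k))ˣ where
  val := demazure a b
  inv := demazure a b - ((a : k) - (a⁻¹ : kˣ)) • 1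
  val_inv := by
    rw [mul_sub, demazure_sq, mul_smul_comm, mul_one, add_sub_cancel_left]
  inv_val := by
    rw [sub_mul, demazure_sq, smul_mul_assoc, one_mul, add_sub_cancel_left]

theorem demazureUnit_isHecke (a b : kˣ) :
    IsHecke (S := Module.End k (LaurentPolynomial k)) a (demazureUnit a b) :=
  isHecke_of_sq (demazure_sq a b)

theorem mul_demazureUnit_sq (a b : kˣ) :
    ((mulX k * demazureUnit a b : (Module.End k (LaurentPolynomial k))ˣ) :
      Module.End k (LaurentPolynomial k)) * (mulX k * demazureUnit a b :
      (Module.End k (LaurentPolynomial k))ˣ) =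
    (((b⁻¹ : kˣ) : k) - b) • ((mulX k * demazureUnit a b :
      (Module.End k (LaurentPolynomial k))ˣ) : Module.End k (LaurentPolynomial k)) + 1 := by
  refine LinearMap.ext fun f => ?_
  have h := mul_demazure a b f
  rw [← map_sub, ← smul_eq_C_mul] at h
  exact h

theorem mul_demazureUnit_isHecke (a b : kˣ) :
    IsHecke (S := Module.End k (LaurentPolynomial k)) b⁻¹ (mulX k * demazureUnit a b) :=
  isHecke_of_sq (by rw [inv_inv]; exact mul_demazureUnit_sq a b)

end Domain

end Operators

/-! ### The polynomial representation in type `C^∨C_1` -/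

namespace CC

section Rep

open LaurentPolynomial

variable {k : Type*} [CommRing k] [IsDomain k]

/-- The operator `Û_1 = u_1^{1/2} s_1 + ((u_1^{1/2} - u_1^{-1/2}) + (v_1^{1/2} - v_1^{-1/2}) 𝕏)
(1 - 𝕏²)⁻¹ (1 - s_1)`. -/
def opU1 (p : Par → kˣ) : (Module.End k (LaurentPolynomial k))ˣ :=
  demazureUnit (p .su1) (p .sv1)

/-- The operator `Û_0`: the same expression in `u_0, v_0`, conjugated by the substitution
`𝕏 ↦ 𝕏_0 = q^{1/4} 𝕏⁻¹`. -/
def opU0 (p : Par → kˣ) : (Module.End k (LaurentPolynomial k))ˣ :=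
  reflectUnit (p .q4) * demazureUnit (p .su0) (p .sv0) * (reflectUnit (p .q4))⁻¹

/-- The explicit formula for `Û_0`, in which `𝕏_0 = q^{1/4} 𝕏⁻¹` and `s_0(𝕏^m) = q^{m/2} 𝕏^{-m}`:
`(1 - 𝕏_0²) Û_0 = (1 - 𝕏_0²) u_0^{1/2} s_0 +
((u_0^{1/2} - u_0^{-1/2}) + (v_0^{1/2} - v_0^{-1/2}) 𝕏_0) (1 - s_0)`. -/
theorem opU0_spec (p : Par → kˣ) (f : LaurentPolynomial k) :
    (1 - (C (p .q4 : k) * T (-1)) ^ 2) * (opU0 p : Module.End k (LaurentPolynomial k)) f =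
      (1 - (C (p .q4 : k) * T (-1)) ^ 2) * (C (p .su0 : k) * reflect (p .q4 ^ 2) f) +
      (C ((p .su0 : k) - ((p .su0)⁻¹ : kˣ)) +
        C ((p .sv0 : k) - ((p .sv0)⁻¹ : kˣ)) * (C (p .q4 : k) * T (-1))) *
        (f - reflect (p .q4 ^ 2) f) := by
  have h := congrArg (reflect (p .q4)) (demazure_spec (p .su0) (p .sv0) (reflect (p .q4) f))
  have e := reflect_conj (p .q4) f
  have hT : (T 2 : LaurentPolynomial k) = T 1 ^ 2 := by rw [T_pow]; rfl
  have hx : reflect (p .q4) (T 1) = C (p .q4 : k) * T (-1) := by rw [reflect_T, zpow_one]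
  have hc : ∀ c : k, reflect (p .q4) (C c) = C c := fun c => by
    rw [← mul_one (C c), ← smul_eq_C_mul, map_smul, map_one]
  simp only [hT, map_add, map_mul, map_sub, map_pow, map_one, hx, hc, e, reflect_reflect] at h
  simp only [map_sub]
  exact h

/-- The operator `V̂_1 = Û_1⁻¹ 𝕏⁻¹`. -/
def opV1 (p : Par → kˣ) : (Module.End k (LaurentPolynomial k))ˣ := (opU1 p)⁻¹ * (mulX k)⁻¹

/-- The operator `V̂_0 = q^{-1/4} 𝕏 Û_0⁻¹`. -/
def opV0 (p : Par → kˣ) : (Module.End k (LaurentPolynomial k))ˣ :=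
  scalar _ (p .q4)⁻¹ * mulX k * (opU0 p)⁻¹

theorem opV1_isHecke (p : Par → kˣ) :
    IsHecke (S := Module.End k (LaurentPolynomial k)) (p .sv1) (opV1 p) := by
  have h := (mul_demazureUnit_isHecke (p .su1) (p .sv1)).inv
  rwa [inv_inv, mul_inv_rev] at h

theorem opV0_isHecke (p : Par → kˣ) :
    IsHecke (S := Module.End k (LaurentPolynomial k)) (p .sv0) (opV0 p) := by
  have h := ((mul_demazureUnit_isHecke (p .su0) (p .sv0)).conj
    (reflectUnit (p .q4) * (mulX k)⁻¹)).inv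
  have e := reflectUnit_mulX (p .q4)
  have hQ := scalar_comm (S := Module.End k (LaurentPolynomial k)) (p .q4)
  rw [inv_inv] at h
  have e2 : opV0 p = (reflectUnit (p .q4) * (mulX k)⁻¹ *
      (mulX k * demazureUnit (p .su0) (p .sv0)) * (reflectUnit (p .q4) * (mulX k)⁻¹)⁻¹)⁻¹ := by
    rw [opV0, opU0, scalar_inv]
    generalize scalar (Module.End k (LaurentPolynomial k)) (p .q4) = Q at *
    generalize reflectUnit (p .q4) = r at *
    generalize mulX k = x at *
    generalize demazureUnit (p .su0) (p .sv0) = d at *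
    have e3 : r * x⁻¹ = Q⁻¹ * x * r := w_reflect hQ e
    calc _ = (Q⁻¹ * x * r) * d⁻¹ * r⁻¹ := by group
      _ = _ := by rw [← e3]; group
  rw [e2]
  exact h

/-- The action of `H_{q,u,v}` on `k[𝕏^{±1}]` by Demazure-Lusztig operators, for given values
`p` of the parameters in `k`. -/
def rep (p : Par → kˣ) : H →+* Module.End k (LaurentPolynomial k) :=
  lift p (fun | .U0 => opU0 p | .U1 => opU1 p | .V0 => opV0 p | .V1 => opV1 p)
    (by
      rintro (_ | _ | _ | _)
      · exact (demazureUnit_isHecke _ _).conj _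
      · exact demazureUnit_isHecke _ _
      · exact opV0_isHecke p
      · exact opV1_isHecke p)
    (by
      simp only [opV0, opV1, scalar_inv]
      exact w_prod (scalar_comm _))

end Rep

end CC

/-! ### The polynomial representation in type `A_1` -/

namespace A1

section Rep

open LaurentPolynomial

variable {k : Type*} [CommRing k] [IsDomain k]

/-- The operator `T̂ = t^{1/2} s + (t^{1/2} - t^{-1/2}) (1 - X²)⁻¹ (1 - s)`. -/
def opT (p : Par → kˣ) : (Module.End k (LaurentPolynomial k))ˣ := demazureUnit (p .st) 1

/-- The operator `π̂(X^m) = q^{m/2} X^{-m}`. -/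
def opPi (p : Par → kˣ) : (Module.End k (LaurentPolynomial k))ˣ := reflectUnit (p .q4 ^ 2)

theorem opT_mulX (p : Par → kˣ) : opT p * mulX k * opT p = (mulX k)⁻¹ := by
  have h := mul_demazureUnit_sq (p .st) 1
  rw [inv_one, sub_self, zero_smul, zero_add] at h
  have h2 : (mulX k * opT p) * (mulX k * opT p) = 1 := Units.ext h
  rw [eq_inv_iff_mul_eq_one, ← mul_right_inj (mulX k), ← mul_left_inj (mulX k)⁻¹]
  simpa [mul_assoc] using h2

/-- The action of `H_{q,t}` on `k[X^{±1}]`, for given values `p` of the parameters in `k`: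
`X` acts by multiplication, `T` by `T̂` and `Y` by `π̂ T̂`. -/
def rep (p : Par → kˣ) : H →+* Module.End k (LaurentPolynomial k) :=
  lift p (fun | .X => mulX k | .Y => opPi p * opT p | .T => opT p)
    (demazureUnit_isHecke _ _) (opT_mulX p)
    (by
      change _ = (opPi p * opT p)⁻¹
      rw [mul_inv_rev, opPi, reflectUnit_inv]
      group)
    (by
      have e := reflectUnit_mulX (p .q4 ^ 2)
      exact w_yx (scalar_comm _) (by simpa [opPi, scalar, sq] using e) (opT_mulX p))

end Rep

end A1

/-! ### Nonsymmetric polynomials -/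

/-- The sign function with `sgn 0 = -1`. -/
def sgn (n : ℤ) : ℤ := if 0 < n then 1 else -1

namespace CC

/-- `ℚ_{q,u,v}`, the field of fractions of `ℤ_{q,u,v}`. -/
abbrev K : Type := FractionRing Z

/-- The parameters as elements of the field of fractions. -/
def par (i : Par) : Kˣ := Units.map (algebraMap Z K : Z →* K) (Params.var i)

/-- `f` is the nonsymmetric Askey-Wilson polynomial `𝓔_n`: it is an eigenvector of `𝕐` with the
eigenvalue `(u_0 u_1)^{-sgn(n)/2} q^{-n/2}`, it has the coefficient `1` of `𝕏^n`, no terms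
`𝕏^m` with `|m| > |n|`, and no term `𝕏^{-n}` for `n > 0`. -/
def IsE (n : ℤ) (f : LaurentPolynomial K) : Prop :=
  rep par (Y : H) f = (((par .su0 * par .su1) ^ (-sgn n) * par .q4 ^ (-2 * n) : Kˣ) : K) • f ∧
  f.coeff n = 1 ∧ (0 < n → f.coeff (-n) = 0) ∧ ∀ m, |n| < |m| → f.coeff m = 0

/-- The value of a Laurent polynomial at `(u_1 v_1)^{-1/2}`. -/
def value (f : LaurentPolynomial K) : K :=
  LaurentPolynomial.eval₂ (RingHom.id K) (par .su1 * par .sv1)⁻¹ f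

/-- The product formula for the value of `𝓔_{m+1}` at `(u_1 v_1)^{-1/2}`. -/
def evalPos (m : ℕ) : K :=
  ((par .su1 * par .sv0 * par .sv1 : Kˣ) : K)⁻¹ ^ (m + 1) *
    (∏ j ∈ Finset.Icc 1 m, (1 + (par .q4 : K) ^ (2 * j) * (par .su1 : K) ^ 2)) /
    (∏ j ∈ Finset.Icc (m + 1) (2 * m + 1),
      (1 - (par .q4 : K) ^ (2 * j) * (par .su0 : K) ^ 2 * (par .su1 : K) ^ 2)) *
    ∏ i ∈ Finset.range (m + 1),
      (((par .sv0 : K) + (par .q4 : K) ^ (2 * i + 1) * par .su0 * par .su1 * par .sv1) *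
        (1 - (par .q4 : K) ^ (2 * i + 1) * par .su0 * par .su1 * par .sv0 * par .sv1))

/-- The product formula for the value of `𝓔_{-m-1}` at `(u_1 v_1)^{-1/2}`. -/
def evalNeg (m : ℕ) : K :=
  ((par .su1 * par .sv0 * par .sv1 : Kˣ) : K)⁻¹ ^ (m + 1) *
    (∏ j ∈ Finset.Icc 1 (m + 1), (1 + (par .q4 : K) ^ (2 * j) * (par .su1 : K) ^ 2)) /
    (∏ j ∈ Finset.Icc (m + 2) (2 * m + 2),
      (1 - (par .q4 : K) ^ (2 * j) * (par .su0 : K) ^ 2 * (par .su1 : K) ^ 2)) *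
    ∏ i ∈ Finset.range (m + 1),
      (((par .sv0 : K) + (par .q4 : K) ^ (2 * i + 1) * par .su0 * par .su1 * par .sv1) *
        (1 - (par .q4 : K) ^ (2 * i + 1) * par .su0 * par .su1 * par .sv0 * par .sv1))

end CC

namespace A1

/-- The field of fractions of `ℤ[q^{±1/4}, t^{±1/2}]`. -/
abbrev K : Type := FractionRing Z

/-- The parameters as elements of the field of fractions. -/
def par (i : Par) : Kˣ := Units.map (algebraMap Z K : Z →* K) (Params.var i)

/-- `g` is the nonsymmetric polynomial `E_n` of type `A_1`: it is an eigenvector of `Y` with the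
eigenvalue `t^{-sgn(n)/2} q^{-n/2}` and has the coefficient `1` of `X^n`. -/
def IsE (n : ℤ) (g : LaurentPolynomial K) : Prop :=
  rep par (Y : H) g = ((par .st ^ (-sgn n) * par .q4 ^ (-2 * n) : Kˣ) : K) • g ∧ g.coeff n = 1

/-- The value of a Laurent polynomial at `t^{-1/2}`. -/
def value (g : LaurentPolynomial K) : K :=
  LaurentPolynomial.eval₂ (RingHom.id K) (par .st)⁻¹ g

/-- The product formula `t^{-|n|/2} ∏_{j=1}^N (1 - q^j t²) / (1 - q^j t)` for the value of `E_n`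
at `t^{-1/2}`, where `N = n - 1` for `n > 0` and `N = |n|` for `n ≤ 0`. -/
def evalFormula (n : ℤ) : K :=
  (par .st : K)⁻¹ ^ n.natAbs *
    ∏ j ∈ Finset.Icc 1 (if 0 < n then n.natAbs - 1 else n.natAbs),
      ((1 - (par .q4 : K) ^ (4 * j) * (par .st : K) ^ 4) /
        (1 - (par .q4 : K) ^ (4 * j) * (par .st : K) ^ 2))

/-- The Laurent polynomial `F(X)` as an element of the algebra. -/
def ofPoly : LaurentPolynomial Z →ₐ[Z] H :=
  AddMonoidAlgebra.lift Z H ℤ ((Units.coeHom H).comp (zpowersHom Hˣ X))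

end A1

/-! ### Specializations -/

/-- A rational function `x` specializes to `y` under the substitution `σ`: it can be written as a
fraction whose denominator does not vanish under `σ`, and `y` is the image of this fraction. -/
def SpecializesTo {A B : Type*} [CommRing A] [CommRing B] [IsDomain A] [IsDomain B] (σ : A →+* B)
    (x : FractionRing A) (y : FractionRing B) : Prop :=
  ∃ a d : A, σ d ≠ 0 ∧ x = algebraMap A (FractionRing A) a / algebraMap A (FractionRing A) d ∧
    y = algebraMap B (FractionRing B) (σ a) / algebraMap B (FractionRing B) (σ d)

/-- Coefficientwise specialization of Laurent polynomials. -/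
def PolySpecializesTo {A B : Type*} [CommRing A] [CommRing B] [IsDomain A] [IsDomain B]
    (σ : A →+* B) (f : LaurentPolynomial (FractionRing A))
    (g : LaurentPolynomial (FractionRing B)) : Prop :=
  ∀ m : ℤ, SpecializesTo σ (f.coeff m) (g.coeff m)

/-- The substitution `u_1^{1/2} ↦ t^{1/2}`, `u_0^{1/2}, v_0^{1/2}, v_1^{1/2} ↦ 1`,
`q^{1/4} ↦ q^{1/4}`. -/
def spec1 : CC.Z →+* A1.Z :=
  Params.subst fun
    | .q4 => Params.var .q4
    | .su0 => 1
    | .su1 => Params.var .st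
    | .sv0 => 1
    | .sv1 => 1

/-- The substitution `u_0^{1/2}, u_1^{1/2} ↦ t^{1/2}`, `v_0^{1/2}, v_1^{1/2} ↦ 1`,
`q^{1/4} ↦ q^{1/2}`. -/
def spec2 : CC.Z →+* A1.Z :=
  Params.subst fun
    | .q4 => Params.var .q4 ^ 2
    | .su0 => Params.var .st
    | .su1 => Params.var .st
    | .sv0 => 1
    | .sv1 => 1

/-- The polynomial representation `𝓥_𝕏 = ℤ_{q,u,v}[𝕏^{±1}]` of `H_{q,u,v}`. -/
def CC.polyRep : CC.H →+* Module.End CC.Z (LaurentPolynomial CC.Z) := CC.rep Params.var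

/-- The polynomial representation `𝓥_X = ℤ[q^{±1/4}, t^{±1/2}][X^{±1}]` of `H_{q,t}`. -/
def A1.polyRep : A1.H →+* Module.End A1.Z (LaurentPolynomial A1.Z) := A1.rep Params.var

/-- The map `F(𝕏) ↦ τ_-⁻¹(F(X))(1)` of the polynomial representations, the parameters being
specialized in the coefficients of `F`. -/
def zetaPoly (F : LaurentPolynomial CC.Z) : LaurentPolynomial A1.Z :=
  A1.polyRep (A1.tauMinus.symm (A1.ofPoly (AddMonoidAlgebra.mapRingHom ℤ spec2 F))) 1

end DAHA

end

noncomputable section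

namespace DAHA

/-! The algebra of type `A_1` becomes transparent in the elements `A = Y T⁻¹`, `B = q^{1/4} Y X T`,
`C = X T`. The relations for `TXT`, `T⁻¹YT⁻¹` and `Y⁻¹X⁻¹YX` say that these are involutions, and `Y
= q^{-1/4} BC`, `X = q^{1/4} BA`, `T = q^{-1/4} ABC`. Hence identities between words in `X, Y, T`
that do not involve the Hecke relation of `T` reduce to cancelling adjacent equal letters. The map
`ξ` sends `U_0, V_0, V_1` to `A, B, C`, while `ζ` sends `V_0, V_1` to `B, CBC` and `U_0` to the
conjugate `Y T Y⁻¹` of `T`. A generator whose parameter is specialized to `1` goes to an involution,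
so its Hecke relation holds, and the remaining relations and the compatibilities with `τ_±, η, φ, ⋆`
are word identities.

The homomorphism `ζ_*` is prescribed on generators of a subgroup for which no presentation is given.
It is therefore induced up to the whole group: monomial `3 × 3` matrices for `τ_+, τ_-, η` with
entries in `GL_2^∧(ℤ)` are written down and the defining relations of `GL_2^∧(ℤ)` are checked for
them. This uses only that the prescribed images satisfy the `B_2` braid relation and are inverted by
the image of `η`. The entry at the trivial coset, restricted to `Γ_0^∧(2)`, is `ζ_*`.

Compatibility with the polynomial representations holds for `𝕏` because `ζ(𝕏) = τ_-⁻¹(X)`. For `U_0,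
U_1` it is checked on `1` and carried to all monomials by a cross relation with `𝕏`
(`IntertwinesAt.of_cross`).

The operator `𝕐` is triangular in the order `0, 1, -1, 2, -2, …` of exponents, over every
coefficient domain (`CC.opY_isTriangular`). Over a ring in which the differences of the diagonal
entries are units the eigenvectors exist. This is applied to the localization of `ℤ_{q,u,v}` at the
elements not killed by the substitution: a single eigenvector there maps to `𝓔_n` in one field of
fractions and to the specialized eigenvector in the other (`CC.exists_eigen_specialization`). Under
`σ_1` the operator `𝕐` becomes `Y`, and under `σ_2` it becomes `Y²`. In both cases the eigenvalues
stay distinct, so the specialized eigenvector is `E_n`.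

The values `E_n(t^{-1/2})` follow from the creation operators `E_{-n} ↦ E_{n+1}` and `E_n ↦ E_{-n}`
because `T` acts as the scalar `t^{1/2}` after evaluation at `t^{-1/2}` (`A1.value_eq`). The general
evaluation product specializes factor by factor, and the result is rearranged by splitting a product
into its odd and even factors (`A1.prod_eq`). -/

theorem mul_self_of_inv {G : Type*} [Group G] {a : G} (h : a⁻¹ = a) : a * a = 1 := by
  rw [← inv_eq_iff_mul_eq_one, h]

theorem mul_self_cancel_of_inv {G : Type*} [Group G] {a : G} (h : a⁻¹ = a) (z : G) :
    a * (a * z) = z := by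
  rw [← mul_assoc, mul_self_of_inv h, one_mul]

/-- For the parameter `1` the Hecke relation is `(x - 1)(x + 1) = 0`, that is `x² = 1`. -/
theorem IsHecke.of_inv_eq {R S : Type*} [CommRing R] [Ring S] [Algebra R S] {x : Sˣ}
    (h : x⁻¹ = x) : IsHecke (1 : Rˣ) x := by
  have h1 : (x : S) * x = 1 := by rw [← Units.val_mul, mul_self_of_inv h, Units.val_one]
  unfold IsHecke
  simp [sub_mul, mul_add, h1]

namespace A1

/-! ### The generators of type `A_1` as words in involutions -/

/-- The involution `Y T⁻¹`. -/
def invA : Hˣ := Y * T⁻¹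
/-- The involution `q^{1/4} Y X T`. -/
def invB : Hˣ := Q * Y * X * T
/-- The involution `X T`. -/
def invC : Hˣ := X * T

-- `A² = 1` and `C² = 1` are the relations `tyt` and `txt` rewritten. Since `B` is `C` with `X`
-- replaced by `τ_-(X) = q^{1/4} Y X`, the equality `B² = 1` is `txt` for `τ_-(X)`, which is where
-- the relation `yx` enters.
@[simp] theorem invA_inv : invA⁻¹ = invA := by
  rw [inv_eq_iff_mul_eq_one]
  calc _ = Y * (T⁻¹ * Y * T⁻¹) := by rw [invA]; group
    _ = 1 := by rw [tyt]; group

@[simp] theorem invB_inv : invB⁻¹ = invB := by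
  rw [inv_eq_iff_mul_eq_one]
  calc _ = (Q * Y * X) * (T * (Q * Y * X) * T) := by rw [invB]; group
    _ = 1 := by rw [w_tauMinus Q_comm txt tyt yx]; group

@[simp] theorem invC_inv : invC⁻¹ = invC := by
  rw [inv_eq_iff_mul_eq_one]
  calc _ = X * (T * X * T) := by rw [invC]; group
    _ = 1 := by rw [txt]; group

@[simp] theorem invA_mul_self : invA * invA = 1 := mul_self_of_inv invA_inv
@[simp] theorem invB_mul_self : invB * invB = 1 := mul_self_of_inv invB_inv
@[simp] theorem invC_mul_self : invC * invC = 1 := mul_self_of_inv invC_inv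
@[simp] theorem invA_cancel (z : Hˣ) : invA * (invA * z) = z := mul_self_cancel_of_inv invA_inv z
@[simp] theorem invB_cancel (z : Hˣ) : invB * (invB * z) = z := mul_self_cancel_of_inv invB_inv z
@[simp] theorem invC_cancel (z : Hˣ) : invC * (invC * z) = z := mul_self_cancel_of_inv invC_inv z

-- Together with the cancellation rules these form a rewriting system: the central `Q` moves to the
-- left and repeated involutions cancel, so that `simp` brings words in `A, B, C, Q` to a reduced
-- form.
@[simp] theorem invA_Q : invA * Q = Q * invA := (Q_comm _).symm
@[simp] theorem invB_Q : invB * Q = Q * invB := (Q_comm _).symm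
@[simp] theorem invC_Q : invC * Q = Q * invC := (Q_comm _).symm
@[simp] theorem invA_Q_inv : invA * Q⁻¹ = Q⁻¹ * invA := (w_central Q_comm _).symm
@[simp] theorem invB_Q_inv : invB * Q⁻¹ = Q⁻¹ * invB := (w_central Q_comm _).symm
@[simp] theorem invC_Q_inv : invC * Q⁻¹ = Q⁻¹ * invC := (w_central Q_comm _).symm
@[simp] theorem invA_Q_mul (z : Hˣ) : invA * (Q * z) = Q * (invA * z) := Q_left _ _
@[simp] theorem invB_Q_mul (z : Hˣ) : invB * (Q * z) = Q * (invB * z) := Q_left _ _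
@[simp] theorem invC_Q_mul (z : Hˣ) : invC * (Q * z) = Q * (invC * z) := Q_left _ _
@[simp] theorem invA_Q_inv_mul (z : Hˣ) : invA * (Q⁻¹ * z) = Q⁻¹ * (invA * z) := Q_left' _ _
@[simp] theorem invB_Q_inv_mul (z : Hˣ) : invB * (Q⁻¹ * z) = Q⁻¹ * (invB * z) := Q_left' _ _
@[simp] theorem invC_Q_inv_mul (z : Hˣ) : invC * (Q⁻¹ * z) = Q⁻¹ * (invC * z) := Q_left' _ _

theorem Y_eq : Y = Q⁻¹ * (invB * invC) := by
  calc Y = Q⁻¹ * (invB * invC⁻¹) := by rw [invB, invC]; group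
    _ = _ := by rw [invC_inv]

theorem T_eq : T = Q⁻¹ * (invA * (invB * invC)) := by
  calc T = invA⁻¹ * Y := by rw [invA]; group
    _ = _ := by rw [invA_inv, Y_eq, invA_Q_inv_mul]

theorem X_eq : X = Q * (invB * invA) := by
  calc X = invC * T⁻¹ := by rw [invC]; group
    _ = _ := by rw [T_eq]; simp [mul_assoc]

/-- As `Y T⁻¹ = T Y⁻¹`, the element equals `Y T Y⁻¹` and inherits the Hecke relation of `T`. -/
theorem isHecke_Y_sq_T_inv : IsHecke (S := H) (Params.var Par.st) (Y ^ 2 * T⁻¹) := by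
  have h : Y ^ 2 * T⁻¹ = Y * T * Y⁻¹ := by
    rw [sq, mul_assoc, w_yt tyt, mul_assoc]
  rw [h]
  exact T_isHecke.conj _

/-! ### Values of the automorphisms -/

theorem phi_scalar (i : Par) :
    Units.map (phi : H →* Hᵐᵒᵖ) (scalar H (Params.var i)) = opUnit (scalar H (Params.var i)) :=
  (lift_scalar _ _ _ _ _ _ _).trans (opUnit_scalar _).symm

theorem phi_X : Units.map (phi : H →* Hᵐᵒᵖ) X = opUnit Y⁻¹ :=
  lift_gen _ _ _ _ _ _ Gen.X

theorem phi_Y : Units.map (phi : H →* Hᵐᵒᵖ) Y = opUnit X⁻¹ :=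
  lift_gen _ _ _ _ _ _ Gen.Y

theorem phi_T : Units.map (phi : H →* Hᵐᵒᵖ) T = opUnit T :=
  lift_gen _ _ _ _ _ _ Gen.T

theorem star_scalar (i : Par) :
    Units.map (star : H →* Hᵐᵒᵖ) (scalar H (Params.var i)) = opUnit (scalar H (Params.var i))⁻¹ :=
  (lift_scalar _ _ _ _ _ _ _).trans (by rw [opUnit_inv, opUnit_scalar, parInv, scalar_inv])

theorem star_gen (x : Gen) : Units.map (star : H →* Hᵐᵒᵖ) (Pres.gen x) = opUnit (Pres.gen x)⁻¹ :=
  lift_gen _ _ _ _ _ _ x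

end A1

theorem CC.star_scalar (i : CC.Par) : Units.map (CC.star : CC.H →* CC.Hᵐᵒᵖ)
    (scalar CC.H (Params.var i)) = opUnit (scalar CC.H (Params.var i))⁻¹ :=
  (CC.lift_scalar _ _ _ _ _).trans (by rw [opUnit_inv, opUnit_scalar, CC.parInv, scalar_inv])

theorem CC.star_gen (x : CC.Gen) :
    Units.map (CC.star : CC.H →* CC.Hᵐᵒᵖ) (Pres.gen x) = opUnit (Pres.gen x)⁻¹ :=
  CC.lift_gen _ _ _ _ x

/-! ### The homomorphisms `ξ` and `ζ` -/

/-- The values of the parameters under the first specialization. -/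
def par1 : CC.Par → A1.Zˣ
  | .q4 => Params.var .q4
  | .su0 => 1
  | .su1 => Params.var .st
  | .sv0 => 1
  | .sv1 => 1

/-- The values of the parameters under the second specialization. -/
def par2 : CC.Par → A1.Zˣ
  | .q4 => Params.var .q4 ^ 2
  | .su0 => Params.var .st
  | .su1 => Params.var .st
  | .sv0 => 1
  | .sv1 => 1

theorem spec1_eq : spec1 = Params.subst par1 := by
  unfold spec1; congr 1

theorem spec2_eq : spec2 = Params.subst par2 := by
  unfold spec2; congr 1

/-- The homomorphism `ξ`. -/
def xi : CC.H →+* A1.H :=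
  CC.lift par1
    (fun
    | .U0 => A1.Y * A1.T⁻¹
    | .U1 => A1.T
    | .V0 => A1.Q * A1.Y * A1.T⁻¹ * A1.X⁻¹
    | .V1 => A1.X * A1.T)
    (by
      -- In terms of the involutions the images of `U_0, V_0, V_1` are `A, B, C`.
      rintro (_ | _ | _ | _)
      · exact IsHecke.of_inv_eq (by simp [A1.X_eq, A1.Y_eq, A1.T_eq, mul_assoc])
      · exact A1.T_isHecke
      · exact IsHecke.of_inv_eq (by simp [A1.X_eq, A1.Y_eq, A1.T_eq, mul_assoc])
      · exact IsHecke.of_inv_eq (by simp [A1.X_eq, A1.Y_eq, A1.T_eq, mul_assoc]))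
    (by simp [par1, A1.X_eq, A1.Y_eq, A1.T_eq, mul_assoc])

/-- The homomorphism `ζ`. -/
def zeta : CC.H →+* A1.H :=
  CC.lift par2
    (fun
    | .U0 => A1.Y ^ 2 * A1.T⁻¹
    | .U1 => A1.T
    | .V0 => A1.Q * A1.Y * A1.T⁻¹ * A1.X⁻¹
    | .V1 => A1.Q * A1.X * A1.T * A1.Y)
    (by
      -- Here `V_0` and `V_1` go to the involutions `B` and `C B C`, whose parameters are `1`.
      rintro (_ | _ | _ | _)
      · exact A1.isHecke_Y_sq_T_inv
      · exact A1.T_isHecke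
      · exact IsHecke.of_inv_eq (by simp [A1.X_eq, A1.Y_eq, A1.T_eq, mul_assoc])
      · exact IsHecke.of_inv_eq (by simp [A1.X_eq, A1.Y_eq, A1.T_eq, mul_assoc]))
    (by
      -- The square comes from `q^{1/4} ↦ q^{1/2}`; it cancels the two factors `Q⁻¹` contained in
      -- the image `Y²` of `U_0 U_1`.
      have h : scalar A1.H (par2 .q4) = A1.Q * A1.Q := by
        simp [par2, scalar, sq]
      simp [h, sq, A1.X_eq, A1.Y_eq, A1.T_eq, mul_assoc])

theorem xi_algebraMap (a : CC.Z) :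
    xi (algebraMap CC.Z CC.H a) = algebraMap A1.Z A1.H (spec1 a) := by
  rw [spec1_eq]; exact CC.lift_algebraMap _ _ _ _ a

theorem zeta_algebraMap (a : CC.Z) :
    zeta (algebraMap CC.Z CC.H a) = algebraMap A1.Z A1.H (spec2 a) := by
  rw [spec2_eq]; exact CC.lift_algebraMap _ _ _ _ a

theorem xi_scalar (i : CC.Par) :
    Units.map (xi : CC.H →* A1.H) (scalar CC.H (Params.var i)) = scalar A1.H (par1 i) :=
  CC.lift_scalar _ _ _ _ i
theorem xi_U0 : Units.map (xi : CC.H →* A1.H) CC.U0 = A1.Y * A1.T⁻¹ := CC.lift_gen _ _ _ _ CC.Gen.U0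
theorem xi_U1 : Units.map (xi : CC.H →* A1.H) CC.U1 = A1.T := CC.lift_gen _ _ _ _ CC.Gen.U1
theorem xi_V0 : Units.map (xi : CC.H →* A1.H) CC.V0 = A1.Q * A1.Y * A1.T⁻¹ * A1.X⁻¹ :=
  CC.lift_gen _ _ _ _ CC.Gen.V0
theorem xi_V1 : Units.map (xi : CC.H →* A1.H) CC.V1 = A1.X * A1.T := CC.lift_gen _ _ _ _ CC.Gen.V1

theorem zeta_scalar (i : CC.Par) :
    Units.map (zeta : CC.H →* A1.H) (scalar CC.H (Params.var i)) = scalar A1.H (par2 i) :=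
  CC.lift_scalar _ _ _ _ i
theorem zeta_U0 : Units.map (zeta : CC.H →* A1.H) CC.U0 = A1.Y ^ 2 * A1.T⁻¹ :=
  CC.lift_gen _ _ _ _ CC.Gen.U0
theorem zeta_U1 : Units.map (zeta : CC.H →* A1.H) CC.U1 = A1.T := CC.lift_gen _ _ _ _ CC.Gen.U1
theorem zeta_V0 : Units.map (zeta : CC.H →* A1.H) CC.V0 = A1.Q * A1.Y * A1.T⁻¹ * A1.X⁻¹ :=
  CC.lift_gen _ _ _ _ CC.Gen.V0
theorem zeta_V1 : Units.map (zeta : CC.H →* A1.H) CC.V1 = A1.Q * A1.X * A1.T * A1.Y :=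
  CC.lift_gen _ _ _ _ CC.Gen.V1

theorem xi_X : Units.map (xi : CC.H →* A1.H) CC.X = A1.X := by
  simp [CC.X, xi_U1, xi_V1, A1.X_eq, A1.Y_eq, A1.T_eq, mul_assoc]

theorem xi_Y : Units.map (xi : CC.H →* A1.H) CC.Y = A1.Y := by
  simp [CC.Y, xi_U0, xi_U1]

theorem zeta_X : Units.map (zeta : CC.H →* A1.H) CC.X = A1.Q⁻¹ * A1.Y⁻¹ * A1.X := by
  simp [CC.X, zeta_U1, zeta_V1, A1.X_eq, A1.Y_eq, A1.T_eq, mul_assoc]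

theorem zeta_Y : Units.map (zeta : CC.H →* A1.H) CC.Y = A1.Y ^ 2 := by
  simp [CC.Y, zeta_U0, zeta_U1]

theorem map_op_opUnit {S S' : Type*} [Ring S] [Ring S'] (f : S →+* S') (x : Sˣ) :
    Units.map ((RingHom.op f : Sᵐᵒᵖ →+* S'ᵐᵒᵖ) : Sᵐᵒᵖ →* S'ᵐᵒᵖ) (opUnit x) =
      opUnit (Units.map (f : S →* S') x) := by
  ext; rfl

theorem scalar_one (S : Type*) {R : Type*} [CommRing R] [Ring S] [Algebra R S] :
    scalar S (1 : Rˣ) = 1 := map_one _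

theorem scalar_pow {S : Type*} {R : Type*} [CommRing R] [Ring S] [Algebra R S] (a : Rˣ) (n : ℕ) :
    scalar S (a ^ n) = scalar S a ^ n := map_pow _ _ _

/-- Both sides are ring homomorphisms in `h`, hence are compared on parameters and generators. The
exchange `u_0 ↔ v_0` is invisible after `σ_1`, where both become `1`. The other compatibilities
follow the same pattern. -/
theorem xi_tauPlus (h : CC.H) : xi (CC.tauPlus h) = A1.tauPlus (xi h) := by
  suffices e : xi.comp CC.tauPlusHom = A1.tauPlusHom.comp xi from DFunLike.congr_fun e h
  refine Pres.param_hom_ext ?_ ?_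
  · rintro (_ | _ | _ | _ | _) <;>
      simp only [Pres.map_comp, CC.tauPlusHom, CC.lift_scalar, CC.parTauPlus, xi_scalar, par1,
        A1.tauPlus_scalar, scalar_one, map_one]
  · rintro (_ | _ | _ | _) <;>
      simp only [Pres.map_comp, CC.tauPlusHom, CC.lift_gen, map_mul, map_inv, xi_U0, xi_U1, xi_V0,
        xi_V1, A1.tauPlus_scalar, A1.tauPlus_X, A1.tauPlus_Y, A1.tauPlus_T] <;>
      simp [A1.X_eq, A1.Y_eq, A1.T_eq, mul_assoc]

theorem xi_tauMinus (h : CC.H) : xi (CC.tauMinus h) = A1.tauMinus (xi h) := by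
  suffices e : xi.comp CC.tauMinusHom = A1.tauMinusHom.comp xi from DFunLike.congr_fun e h
  refine Pres.param_hom_ext ?_ ?_
  · rintro (_ | _ | _ | _ | _) <;>
      simp only [Pres.map_comp, CC.tauMinusHom, CC.lift_scalar, CC.parTauMinus, xi_scalar, par1,
        A1.tauMinus_scalar, scalar_one, map_one]
  · rintro (_ | _ | _ | _) <;>
      simp only [Pres.map_comp, CC.tauMinusHom, CC.lift_gen, map_mul, map_inv, xi_U0, xi_U1, xi_V0,
        xi_V1, A1.tauMinus_scalar, A1.tauMinus_X, A1.tauMinus_Y, A1.tauMinus_T] <;>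
      simp [A1.X_eq, A1.Y_eq, A1.T_eq, mul_assoc]

theorem xi_eta (h : CC.H) : xi (CC.eta h) = A1.eta (xi h) := by
  suffices e : xi.comp CC.etaHom = A1.etaHom.comp xi from DFunLike.congr_fun e h
  refine Pres.param_hom_ext ?_ ?_
  · rintro (_ | _ | _ | _ | _) <;>
      simp only [Pres.map_comp, CC.etaHom, CC.lift_scalar, CC.parInv, scalar_inv, map_inv,
        xi_scalar, par1, A1.eta_scalar, A1.parInv, scalar_one, map_one, inv_one]
  · rintro (_ | _ | _ | _) <;>
      simp only [Pres.map_comp, CC.etaHom, CC.lift_gen, map_mul, map_inv, xi_U0, xi_U1, xi_V0,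
        xi_V1, A1.eta_scalar, A1.eta_X, A1.eta_Y, A1.eta_T, A1.parInv, scalar_inv] <;>
      simp [A1.X_eq, A1.Y_eq, A1.T_eq, mul_assoc]

theorem xi_phi (h : CC.H) : xi (CC.phi h).unop = (A1.phi (xi h)).unop := by
  suffices e : (RingHom.op xi).comp CC.phi = A1.phi.comp xi from
    congrArg MulOpposite.unop (DFunLike.congr_fun e h)
  refine Pres.param_hom_ext ?_ ?_
  · rintro (_ | _ | _ | _ | _) <;>
      simp only [Pres.map_comp, CC.phi, CC.lift_scalar, CC.parPhi, ← opUnit_scalar, map_op_opUnit,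
        xi_scalar, par1, A1.phi_scalar, scalar_one, opUnit_one, map_one]
  · rintro (_ | _ | _ | _) <;>
      simp only [Pres.map_comp, CC.phi, CC.lift_gen, map_op_opUnit, map_mul, map_inv, xi_U0, xi_U1,
        xi_V0, xi_V1, A1.phi_scalar, A1.phi_X, A1.phi_Y, A1.phi_T, ← opUnit_mul, ← opUnit_inv] <;>
      simp [A1.X_eq, A1.Y_eq, A1.T_eq, mul_assoc]

theorem xi_star (h : CC.H) : xi (CC.star h).unop = (A1.star (xi h)).unop := by
  suffices e : (RingHom.op xi).comp CC.star = A1.star.comp xi from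
    congrArg MulOpposite.unop (DFunLike.congr_fun e h)
  refine Pres.param_hom_ext ?_ ?_
  · rintro (_ | _ | _ | _ | _) <;>
      simp only [Pres.map_comp, CC.star_scalar, map_op_opUnit,
        scalar_inv, map_inv, xi_scalar, par1, A1.star_scalar, scalar_one, opUnit_one, map_one,
        inv_one]
  · rintro (_ | _ | _ | _) <;>
      simp only [Pres.map_comp, CC.star_gen, map_op_opUnit, map_mul, map_inv, xi_U0, xi_U1,
        xi_V0, xi_V1, A1.star_scalar, A1.star_gen, ← opUnit_mul, ← opUnit_inv] <;>
      simp [A1.X_eq, A1.Y_eq, A1.T_eq, mul_assoc]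

/-- Only the square of `τ_+` is compatible with `σ_2`: `τ_+` exchanges `u_0` and `v_0`, whose
specializations `t` and `1` differ. By contrast `τ_-` exchanges `v_0` and `v_1`, which both become
`1`. -/
theorem zeta_tauPlus_tauPlus (h : CC.H) :
    zeta (CC.tauPlus (CC.tauPlus h)) =
      A1.tauMinus.symm (A1.tauPlus (A1.tauMinus (zeta h))) := by
  suffices e : zeta.comp (CC.tauPlusHom.comp CC.tauPlusHom) =
      A1.tauMinusInvHom.comp (A1.tauPlusHom.comp (A1.tauMinusHom.comp zeta)) from
    DFunLike.congr_fun e h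
  refine Pres.param_hom_ext ?_ ?_
  · rintro (_ | _ | _ | _ | _) <;>
      simp only [Pres.map_comp, CC.tauPlusHom, CC.lift_scalar, CC.parTauPlus, zeta_scalar, par2,
        scalar_pow, scalar_one, map_pow, map_one,
        A1.tauMinus_scalar, A1.tauPlus_scalar, A1.tauMinusInv_scalar]
  · rintro (_ | _ | _ | _) <;>
      simp only [Pres.map_comp, CC.tauPlusHom, CC.lift_gen, map_mul, map_inv, map_pow,
        zeta_U0, zeta_U1, zeta_V0, zeta_V1,
        A1.tauPlus_scalar, A1.tauPlus_X, A1.tauPlus_Y, A1.tauPlus_T,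
        A1.tauMinus_scalar, A1.tauMinus_X, A1.tauMinus_Y, A1.tauMinus_T,
        A1.tauMinusInv_scalar, A1.tauMinusInv_X, A1.tauMinusInv_Y, A1.tauMinusInv_T] <;>
      simp [A1.X_eq, A1.Y_eq, A1.T_eq, mul_assoc, sq]

theorem zeta_tauMinus (h : CC.H) :
    zeta (CC.tauMinus h) = A1.tauMinus (A1.tauMinus (zeta h)) := by
  suffices e : zeta.comp CC.tauMinusHom = A1.tauMinusHom.comp (A1.tauMinusHom.comp zeta) from
    DFunLike.congr_fun e h
  refine Pres.param_hom_ext ?_ ?_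
  · rintro (_ | _ | _ | _ | _) <;>
      simp only [Pres.map_comp, CC.tauMinusHom, CC.lift_scalar, CC.parTauMinus, zeta_scalar, par2,
        scalar_pow, scalar_one, map_pow, map_one, A1.tauMinus_scalar]
  · rintro (_ | _ | _ | _) <;>
      simp only [Pres.map_comp, CC.tauMinusHom, CC.lift_gen, map_mul, map_inv, map_pow,
        zeta_U0, zeta_U1, zeta_V0, zeta_V1,
        A1.tauMinus_scalar, A1.tauMinus_X, A1.tauMinus_Y, A1.tauMinus_T] <;>
      simp [A1.X_eq, A1.Y_eq, A1.T_eq, mul_assoc, sq]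

theorem zeta_eta (h : CC.H) :
    zeta (CC.eta h) = A1.tauMinus.symm (A1.eta (A1.tauMinus (zeta h))) := by
  suffices e : zeta.comp CC.etaHom =
      A1.tauMinusInvHom.comp (A1.etaHom.comp (A1.tauMinusHom.comp zeta)) from
    DFunLike.congr_fun e h
  refine Pres.param_hom_ext ?_ ?_
  · rintro (_ | _ | _ | _ | _) <;>
      simp only [Pres.map_comp, CC.etaHom, CC.lift_scalar, CC.parInv, zeta_scalar, par2,
        scalar_pow, scalar_one, scalar_inv, map_pow, map_one, map_inv, inv_one,
        A1.tauMinus_scalar, A1.eta_scalar, A1.parInv, A1.tauMinusInv_scalar, inv_pow]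
  · rintro (_ | _ | _ | _) <;>
      simp only [Pres.map_comp, CC.etaHom, CC.lift_gen, map_mul, map_inv, map_pow,
        zeta_U0, zeta_U1, zeta_V0, zeta_V1, scalar_inv,
        A1.eta_scalar, A1.eta_X, A1.eta_Y, A1.eta_T, A1.parInv,
        A1.tauMinus_scalar, A1.tauMinus_X, A1.tauMinus_Y, A1.tauMinus_T,
        A1.tauMinusInv_scalar, A1.tauMinusInv_X, A1.tauMinusInv_Y, A1.tauMinusInv_T] <;>
      simp [A1.X_eq, A1.Y_eq, A1.T_eq, mul_assoc, sq]

/-! ### The homomorphism `ζ_*` -/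

/-- A permutation of `G × Fin 3` given by a monomial matrix with entries in `G`. -/
def monomialPerm {G : Type*} [Group G] (σ : Equiv.Perm (Fin 3)) (c : Fin 3 → G) :
    Equiv.Perm (G × Fin 3) where
  toFun x := (c x.2 * x.1, σ x.2)
  invFun x := ((c (σ.symm x.2))⁻¹ * x.1, σ.symm x.2)
  left_inv x := by simp
  right_inv x := by simp

theorem monomialPerm_apply {G : Type*} [Group G] (σ : Equiv.Perm (Fin 3)) (c : Fin 3 → G)
    (x : G × Fin 3) : monomialPerm σ c x = (c x.2 * x.1, σ x.2) := rfl

theorem monomialPerm_mul {G : Type*} [Group G] (σ τ : Equiv.Perm (Fin 3)) (c d : Fin 3 → G) :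
    monomialPerm σ c * monomialPerm τ d = monomialPerm (σ * τ) (fun i => c (τ i) * d i) := by
  ext x <;> simp [monomialPerm_apply, mul_assoc]

theorem monomialPerm_one {G : Type*} [Group G] : monomialPerm 1 (1 : Fin 3 → G) = 1 := by
  ext x <;> simp [monomialPerm_apply]

theorem monomialPerm_inv {G : Type*} [Group G] (σ : Equiv.Perm (Fin 3)) (c : Fin 3 → G) :
    (monomialPerm σ c)⁻¹ = monomialPerm σ⁻¹ (fun i => (c (σ⁻¹ i))⁻¹) := by
  ext x <;> rfl

namespace GLHat

section Lift

variable {G : Type*} [Group G] {a b e : G} (h1 : a * b⁻¹ * a = b⁻¹ * a * b⁻¹) (h2 : e * e = 1)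
    (h3 : e * a * e = a⁻¹) (h4 : e * b * e = b⁻¹)

theorem lift_tauPlus : lift a b e h1 h2 h3 h4 tauPlus = a := by
  rw [lift, tauPlus, PresentedGroup.toGroup.of]

theorem lift_tauMinus : lift a b e h1 h2 h3 h4 tauMinus = b := by
  rw [lift, tauMinus, PresentedGroup.toGroup.of]

theorem lift_eta : lift a b e h1 h2 h3 h4 eta = e := by
  rw [lift, eta, PresentedGroup.toGroup.of]

end Lift


theorem braid : tauPlus * tauMinus⁻¹ * tauPlus = tauMinus⁻¹ * tauPlus * tauMinus⁻¹ := by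
  rw [← mul_inv_eq_one]
  exact PresentedGroup.one_of_mem (rels := glRels) (by simp [glRels])

theorem eta_mul_eta : eta * eta = 1 := by
  rw [← sq]
  exact PresentedGroup.one_of_mem (rels := glRels) (by simp [glRels])

theorem eta_tauPlus : eta * tauPlus * eta = tauPlus⁻¹ := by
  rw [← mul_eq_one_iff_eq_inv]
  exact PresentedGroup.one_of_mem (rels := glRels) (by simp [glRels])

theorem eta_tauMinus : eta * tauMinus * eta = tauMinus⁻¹ := by
  rw [← mul_eq_one_iff_eq_inv]
  exact PresentedGroup.one_of_mem (rels := glRels) (by simp [glRels])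

/-- The image of `τ_+²` under `ζ_*`. -/
def zetaA : GLHat := tauMinus⁻¹ * tauPlus * tauMinus
/-- The image of `τ_-` under `ζ_*`. -/
def zetaB : GLHat := tauMinus ^ 2
/-- The image of `η` under `ζ_*`. -/
def zetaE : GLHat := tauMinus⁻¹ * eta * tauMinus

/-- The relation of the Artin group of type `B_2`, from the braid relation. -/
theorem artinB2_of_braid {G : Type*} [Group G] {s r : G} (h : s * r * s = r * s * r) :
    (r * s * r⁻¹) * (r * r) * (r * s * r⁻¹) * (r * r) =
      (r * r) * (r * s * r⁻¹) * (r * r) * (r * s * r⁻¹) := by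
  -- The element `s r² s` commutes with `r`; the claim is a multiple of this commutation.
  have hk : s * r * r * s * r = r * s * r * r * s := by
    calc _ = s * r * (r * s * r) := by group
      _ = (s * r * s) * r * s := by rw [← h]; group
      _ = _ := by rw [h]
  calc _ = r * (s * r * r * s * r) := by group
    _ = r * (r * s * r * r * s) := by rw [hk]
    _ = r * r * (s * r * r * s * r) * r⁻¹ := by group
    _ = r * r * (r * s * r * r * s) * r⁻¹ := by rw [hk]
    _ = _ := by group

section Induced

variable {G : Type*} [Group G] {A B E : G}

/-- The monomial matrix of `τ_+` in the induced representation. -/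
def indTauPlus (A B : G) : Equiv.Perm (G × Fin 3) :=
  monomialPerm (Equiv.swap 0 1) ![1, A, A⁻¹ * B⁻¹ * A]
/-- The monomial matrix of `τ_-` in the induced representation. -/
def indTauMinus (A B : G) : Equiv.Perm (G × Fin 3) :=
  monomialPerm (Equiv.swap 1 2) ![B, 1, B⁻¹ * A⁻¹ * B]
/-- The monomial matrix of `η` in the induced representation. -/
def indEta (A B E : G) : Equiv.Perm (G × Fin 3) :=
  monomialPerm 1 ![E, A⁻¹ * E, B⁻¹ * A * B * A⁻¹ * E]

/-- The matrix identities below reduce to equalities of words in `A, B, E`. Those that are not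
consequences of cancellation and of moving `E` are recorded here and in `zeta_word_eta`, in the
right-associated form that `simp` meets. -/
theorem zeta_word_braid (h : A * B⁻¹ * A * B⁻¹ = B⁻¹ * A * B⁻¹ * A) :
    A⁻¹ * (B⁻¹ * (A * (B⁻¹ * (A * B)))) = B⁻¹ * A := by
  calc _ = A⁻¹ * (B⁻¹ * A * B⁻¹ * A) * B := by group
    _ = _ := by rw [← h]; group

theorem zeta_word_eta (h : A * B⁻¹ * A * B⁻¹ = B⁻¹ * A * B⁻¹ * A) :
    B⁻¹ * (A * (B * (A⁻¹ * (B * (A⁻¹ * (B⁻¹ * A)))))) = 1 ∧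
    B⁻¹ * (A * (B * (B * (A⁻¹ * (B * (A⁻¹ * (B⁻¹ * A))))))) = A⁻¹ * (B * A) := by
  have k : B * A⁻¹ * B * A⁻¹ = A⁻¹ * B * A⁻¹ * B := by
    have := congrArg (fun x => x⁻¹) h
    simpa [mul_assoc] using this
  constructor
  · calc _ = B⁻¹ * A * (B * A⁻¹ * B * A⁻¹) * B⁻¹ * A := by group
      _ = 1 := by rw [k]; group
  · calc _ = B⁻¹ * A * B * (B * A⁻¹ * B * A⁻¹) * B⁻¹ * A := by group
      _ = B⁻¹ * A * B * (A⁻¹ * B * A⁻¹ * B) * B⁻¹ * A := by rw [k]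
      _ = B⁻¹ * A * (B * A⁻¹ * B * A⁻¹) * A := by group
      _ = _ := by rw [k]; group

/-- Rewriting rules that move `E` to the right of a word and invert the letters it passes, so that
pairs of `E` meet and cancel. -/
theorem conj_push {x : G} (hE : E * E = 1) (hx : E * x * E = x⁻¹) :
    E * x = x⁻¹ * E ∧ (∀ z, E * (x * z) = x⁻¹ * (E * z)) ∧
    E * x⁻¹ = x * E ∧ ∀ z, E * (x⁻¹ * z) = x * (E * z) := by
  have h1 : E * x = x⁻¹ * E := by rw [← hx, mul_assoc, hE, mul_one]
  have h2 : E * x⁻¹ = x * E := by rw [← hx, ← mul_assoc, ← mul_assoc, hE, one_mul]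
  exact ⟨h1, fun z => by rw [← mul_assoc, h1, mul_assoc], h2,
    fun z => by rw [← mul_assoc, h2, mul_assoc]⟩

/-- The underlying permutations `(0 1)` and `(1 2)` satisfy the braid relation in `S_3`. What
remains is one word identity for each of the three cosets. -/
theorem ind_braid (h : A * B⁻¹ * A * B⁻¹ = B⁻¹ * A * B⁻¹ * A) :
    indTauPlus A B * (indTauMinus A B)⁻¹ * indTauPlus A B =
      (indTauMinus A B)⁻¹ * indTauPlus A B * (indTauMinus A B)⁻¹ := by
  have e : (Equiv.swap 0 1 : Equiv.Perm (Fin 3)) * (Equiv.swap 1 2)⁻¹ * Equiv.swap 0 1 =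
      (Equiv.swap 1 2)⁻¹ * Equiv.swap 0 1 * (Equiv.swap 1 2)⁻¹ := by decide
  have e0 : (Equiv.swap 0 1 : Equiv.Perm (Fin 3)) 2 = 2 := by decide
  have e1 : (Equiv.swap 1 2 : Equiv.Perm (Fin 3)) 0 = 0 := by decide
  rw [indTauPlus, indTauMinus, monomialPerm_inv]
  simp only [monomialPerm_mul]
  rw [e]
  congr 1
  funext i
  fin_cases i <;> simp [e0, e1, mul_assoc, zeta_word_braid h]

theorem indEta_sq (hE : E * E = 1) (hA : E * A * E = A⁻¹) (hB : E * B * E = B⁻¹)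
     (h : A * B⁻¹ * A * B⁻¹ = B⁻¹ * A * B⁻¹ * A) :
    indEta A B E * indEta A B E = 1 := by
  obtain ⟨a1, a2, a3, a4⟩ := conj_push hE hA
  obtain ⟨b1, b2, b3, b4⟩ := conj_push hE hB
  rw [indEta, monomialPerm_mul, ← monomialPerm_one]
  congr 1
  funext i
  fin_cases i <;> simp [mul_assoc, a1, a2, a3, a4, b1, b2, b3, b4, hE, zeta_word_eta h]

theorem indEta_indTauPlus (hE : E * E = 1) (hA : E * A * E = A⁻¹) (hB : E * B * E = B⁻¹)
     (h : A * B⁻¹ * A * B⁻¹ = B⁻¹ * A * B⁻¹ * A) :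
    indEta A B E * indTauPlus A B * indEta A B E = (indTauPlus A B)⁻¹ := by
  have e0 : (Equiv.swap 0 1 : Equiv.Perm (Fin 3)) 2 = 2 := by decide
  obtain ⟨a1, a2, a3, a4⟩ := conj_push hE hA
  obtain ⟨b1, b2, b3, b4⟩ := conj_push hE hB
  rw [indEta, indTauPlus, monomialPerm_inv]
  simp only [monomialPerm_mul]
  rw [Equiv.swap_inv, mul_one, one_mul]
  congr 1
  funext i
  fin_cases i <;> simp [e0, mul_assoc, a1, a2, a3, a4, b1, b2, b3, b4, hE, zeta_word_eta h]

theorem indEta_indTauMinus (hE : E * E = 1) (hA : E * A * E = A⁻¹) (hB : E * B * E = B⁻¹) :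
    indEta A B E * indTauMinus A B * indEta A B E = (indTauMinus A B)⁻¹ := by
  have e0 : (Equiv.swap 1 2 : Equiv.Perm (Fin 3)) 0 = 0 := by decide
  obtain ⟨a1, a2, a3, a4⟩ := conj_push hE hA
  obtain ⟨b1, b2, b3, b4⟩ := conj_push hE hB
  rw [indEta, indTauMinus, monomialPerm_inv]
  simp only [monomialPerm_mul]
  rw [Equiv.swap_inv, mul_one, one_mul]
  congr 1
  funext i
  fin_cases i <;> simp [e0, mul_assoc, a1, a2, a3, a4, b1, b2, b3, b4, hE]

end Induced

/-- With `s = τ_+` and `r = τ_-⁻¹` one has `zetaA = r s r⁻¹` and `zetaB⁻¹ = r²`, and `s, r` satisfy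
the braid relation. -/
theorem zetaA_zetaB : zetaA * zetaB⁻¹ * zetaA * zetaB⁻¹ = zetaB⁻¹ * zetaA * zetaB⁻¹ * zetaA := by
  have h := artinB2_of_braid braid
  simpa [zetaA, zetaB, sq] using h

/-- The image of `η` is its conjugate by `τ_-`, so the relations of `η` carry over to elements
conjugated in the same way; `τ_-²` is its own conjugate. -/
theorem zetaE_eq (x : GLHat) : zetaE * (tauMinus⁻¹ * x * tauMinus) * zetaE =
    tauMinus⁻¹ * (eta * x * eta) * tauMinus := by
  rw [zetaE]; group

theorem zetaE_mul_zetaE : zetaE * zetaE = 1 := by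
  calc _ = tauMinus⁻¹ * (eta * eta) * tauMinus := by rw [zetaE]; group
    _ = 1 := by rw [eta_mul_eta]; group

theorem zetaE_zetaA : zetaE * zetaA * zetaE = zetaA⁻¹ := by
  rw [zetaA, zetaE_eq, eta_tauPlus]; group

theorem zetaE_zetaB : zetaE * zetaB * zetaE = zetaB⁻¹ := by
  have h : zetaB = tauMinus⁻¹ * (tauMinus * tauMinus) * tauMinus := by rw [zetaB, sq]; group
  have h2 : eta * (tauMinus * tauMinus) * eta = (eta * tauMinus * eta) * (eta * tauMinus * eta) := by
    simp only [mul_assoc, ← mul_assoc eta eta, eta_mul_eta, one_mul]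
  rw [h, zetaE_eq, h2, eta_tauMinus]; group

/-- The representation of `GL_2^∧(ℤ)` induced from the homomorphism `ζ_*` of `Γ_0^∧(2)`, with
respect to the representatives `1, τ_+, τ_- τ_+` of the cosets. -/
def induced : GLHat →* Equiv.Perm (GLHat × Fin 3) :=
  GLHat.lift (indTauPlus zetaA zetaB) (indTauMinus zetaA zetaB) (indEta zetaA zetaB zetaE)
    (ind_braid zetaA_zetaB)
    (indEta_sq zetaE_mul_zetaE zetaE_zetaA zetaE_zetaB zetaA_zetaB)
    (indEta_indTauPlus zetaE_mul_zetaE zetaE_zetaA zetaE_zetaB zetaA_zetaB)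
    (indEta_indTauMinus zetaE_mul_zetaE zetaE_zetaA zetaE_zetaB)

theorem induced_tauPlus : induced tauPlus = indTauPlus zetaA zetaB := GLHat.lift_tauPlus _ _ _ _

theorem induced_tauMinus : induced tauMinus = indTauMinus zetaA zetaB := GLHat.lift_tauMinus _ _ _ _

theorem induced_eta : induced eta = indEta zetaA zetaB zetaE := GLHat.lift_eta _ _ _ _

/-- The block of the induced representation at the trivial coset. -/
theorem induced_apply {γ : GLHat} (h : γ ∈ Gamma0) :
    ∃ z : GLHat, ∀ g, induced γ (g, 0) = (z * g, 0) := by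
  induction h using Subgroup.closure_induction with
  | mem x hx =>
    rcases hx with rfl | rfl | rfl
    -- `τ_+²` takes the coset `0` to `1` with entry `1` and back to `0` with entry `zetaA`.
    · refine ⟨zetaA, fun g => ?_⟩
      rw [map_pow, induced_tauPlus, sq, Equiv.Perm.mul_apply]
      simp [indTauPlus, monomialPerm_apply]
    · refine ⟨zetaB, fun g => ?_⟩
      rw [induced_tauMinus, indTauMinus, monomialPerm_apply]
      rfl
    · refine ⟨zetaE, fun g => ?_⟩
      rw [induced_eta]
      simp [indEta, monomialPerm_apply]
  | one => exact ⟨1, fun g => by simp⟩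
  | mul x y _ _ hx hy =>
    obtain ⟨z, hz⟩ := hx
    obtain ⟨w, hw⟩ := hy
    exact ⟨z * w, fun g => by rw [map_mul, Equiv.Perm.mul_apply, hw, hz, mul_assoc]⟩
  | inv x _ hx =>
    obtain ⟨z, hz⟩ := hx
    exact ⟨z⁻¹, fun g => by rw [map_inv, Equiv.Perm.inv_eq_iff_eq, hz, mul_inv_cancel_left]⟩

/-- The matrix entries multiply from the left, so the entry at the trivial coset is already
determined by its effect on `(1, 0)`. This makes `zetaStar` multiplicative. -/
theorem induced_apply_eq (γ : Gamma0) (g : GLHat) :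
    induced γ (g, 0) = ((induced γ (1, 0)).1 * g, 0) := by
  obtain ⟨z, hz⟩ := induced_apply γ.2
  rw [hz, hz, mul_one]

/-- The homomorphism `ζ_*`. -/
def zetaStar : Gamma0 →* GLHat where
  toFun γ := (induced γ (1, 0)).1
  map_one' := by simp
  map_mul' γ δ := by
    rw [Subgroup.coe_mul, map_mul, Equiv.Perm.mul_apply, induced_apply_eq δ 1,
      induced_apply_eq γ, mul_one]

theorem zetaStar_tauPlusSq : zetaStar Gamma0.tauPlusSq = tauMinus⁻¹ * tauPlus * tauMinus := by
  change (induced (tauPlus ^ 2) (1, 0)).1 = zetaA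
  rw [map_pow, induced_tauPlus, sq, Equiv.Perm.mul_apply]
  simp [indTauPlus, monomialPerm_apply]

theorem zetaStar_tauMinus : zetaStar Gamma0.tauMinus = tauMinus ^ 2 := by
  change (induced tauMinus (1, 0)).1 = zetaB
  rw [induced_tauMinus]
  simp [indTauMinus, monomialPerm_apply]

theorem zetaStar_eta : zetaStar Gamma0.eta = tauMinus⁻¹ * eta * tauMinus := by
  change (induced eta (1, 0)).1 = zetaE
  rw [induced_eta]
  simp [indEta, monomialPerm_apply]

end GLHat

/-- The equality holds for the three generators of `Γ_0^∧(2)` and is stable under products and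
inverses, since `zetaStar` is already known to be a homomorphism. -/
theorem zeta_act (γ : GLHat.Gamma0) (h : CC.H) :
    zeta (CC.act γ h) = A1.act (GLHat.zetaStar γ) (zeta h) := by
  have c1 : CC.act GLHat.tauPlus = CC.tauPlus := GLHat.lift_tauPlus _ _ _ _
  have c2 : CC.act GLHat.tauMinus = CC.tauMinus := GLHat.lift_tauMinus _ _ _ _
  have c3 : CC.act GLHat.eta = CC.eta := GLHat.lift_eta _ _ _ _
  have d1 : A1.act GLHat.tauPlus = A1.tauPlus := GLHat.lift_tauPlus _ _ _ _
  have d2 : A1.act GLHat.tauMinus = A1.tauMinus := GLHat.lift_tauMinus _ _ _ _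
  have d3 : A1.act GLHat.eta = A1.eta := GLHat.lift_eta _ _ _ _
  obtain ⟨γ, hγ⟩ := γ
  revert h
  induction hγ using Subgroup.closure_induction with
  | mem x hx =>
    intro h
    rcases hx with rfl | rfl | rfl
    · have := GLHat.zetaStar_tauPlusSq
      rw [GLHat.Gamma0.tauPlusSq] at this
      rw [this]
      simp only [map_mul, map_pow, map_inv, c1, d1, d2, sq]
      exact zeta_tauPlus_tauPlus h
    · have := GLHat.zetaStar_tauMinus
      rw [GLHat.Gamma0.tauMinus] at this
      rw [this]
      simp only [map_mul, map_pow, map_inv, c2, d2, sq]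
      exact zeta_tauMinus h
    · have := GLHat.zetaStar_eta
      rw [GLHat.Gamma0.eta] at this
      rw [this]
      simp only [map_mul, map_pow, map_inv, c3, d3, d2, sq]
      exact zeta_eta h
  | one =>
    intro h
    change zeta (CC.act 1 h) = A1.act (GLHat.zetaStar 1) (zeta h)
    simp
  | mul x y hx hy ex ey =>
    intro h
    have e : (⟨x * y, mul_mem hx hy⟩ : GLHat.Gamma0) = ⟨x, hx⟩ * ⟨y, hy⟩ := rfl
    rw [e, map_mul, map_mul]
    change zeta (CC.act (x * y) h) = _
    rw [map_mul]
    change zeta (CC.act x (CC.act y h)) = A1.act _ (A1.act _ (zeta h))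
    rw [ex, ey]
  | inv x hx ex =>
    intro h
    have e : (⟨x⁻¹, inv_mem hx⟩ : GLHat.Gamma0) = ⟨x, hx⟩⁻¹ := rfl
    -- The hypothesis for `x` at the preimage of `h` gives the claim for `x⁻¹` once `A1.act` of the
    -- image of `x` is inverted.
    have e1 := ex ((CC.act x)⁻¹ h)
    have e2 : CC.act x ((CC.act x)⁻¹ h) = h := RingEquiv.apply_symm_apply _ _
    rw [e2] at e1
    rw [e, map_inv, map_inv]
    change zeta (CC.act x⁻¹ h) = _
    rw [map_inv]
    change zeta ((CC.act x)⁻¹ h) = (A1.act _)⁻¹ (zeta h)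
    rw [e1]
    exact (RingEquiv.symm_apply_apply _ _).symm

/-! ### Compatibility of `ζ` with the polynomial representations -/

section

open LaurentPolynomial

theorem Pres.induction {R : Type*} [CommRing R] {G : Type}
    {r : MonoidAlgebra R (FreeGroup G) → MonoidAlgebra R (FreeGroup G) → Prop}
    {P : Pres r → Prop} (scal : ∀ a, P (algebraMap R _ a))
    (gen : ∀ x, P (Pres.gen x : (Pres r)ˣ)) (inv : ∀ x : (Pres r)ˣ, P x → P (x⁻¹ : (Pres r)ˣ))
    (add : ∀ x y, P x → P y → P (x + y)) (mul : ∀ x y, P x → P y → P (x * y)) (x : Pres r) :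
    P x := by
  obtain ⟨x, rfl⟩ : ∃ y, (Pres.mk y : Pres r) = x := RingQuot.mkRingHom_surjective r x
  have hw : ∀ w : FreeGroup G, P (Units.map ((Pres.mk : _ →+* Pres r) : _ →* Pres r)
      (Units.map (MonoidAlgebra.of R _) (toUnits w)) : (Pres r)ˣ) := by
    intro w
    induction w using FreeGroup.induction_on with
    | C1 => simpa using scal 1
    | of x => exact gen x
    | inv_of x h =>
      rw [map_inv, map_inv, map_inv]; exact inv _ h
    | mul x y hx hy =>
      rw [map_mul, map_mul, map_mul, Units.val_mul]; exact mul _ _ hx hy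
  induction x using MonoidAlgebra.induction_on with
  | of w => exact hw w
  | add x y hx hy => rw [map_add]; exact add _ _ hx hy
  | smul a x hx =>
    rw [Algebra.smul_def, map_mul, Pres.mk_algebraMap]
    exact mul _ _ (scal a) hx

theorem CC.V0_eq : CC.V0 = (scalar CC.H (Params.var CC.Par.q4))⁻¹ * CC.X * CC.U0⁻¹ := by
    have h := CC.gen_prod
    have hq := fun x => scalar_comm (S := CC.H) (Params.var CC.Par.q4) x
    rw [CC.X]
    generalize scalar CC.H (Params.var CC.Par.q4) = q at *
    calc CC.V0 = CC.V1⁻¹ * q⁻¹ * (q * CC.V1 * CC.V0 * CC.U0 * CC.U1) * CC.U1⁻¹ * CC.U0⁻¹ := by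
          group
      _ = _ := by rw [h, ← A1.w_central hq]; group

/-- The generators can be traded for `𝕏, U_0, U_1`, as `V_1 = U_1⁻¹ 𝕏⁻¹` and `V_0 = q^{-1/4} 𝕏
U_0⁻¹`. This suits the polynomial representation, where `𝕏` acts by multiplication. -/
theorem CC.scalar_gen_induction {P : CC.H → Prop} (scal : ∀ a, P (algebraMap CC.Z _ a))
    (hX : P CC.X) (h0 : P CC.U0) (h1 : P CC.U1) (inv : ∀ x : CC.Hˣ, P x → P (x⁻¹ : CC.Hˣ))
    (add : ∀ x y, P x → P y → P (x + y)) (mul : ∀ x y, P x → P y → P (x * y)) (x : CC.H) :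
    P x := by
  have hmul : ∀ x y : CC.Hˣ, P x → P y → P (x * y : CC.Hˣ) := fun x y hx hy => by
    rw [Units.val_mul]; exact mul _ _ hx hy
  have hV1 : CC.V1 = CC.U1⁻¹ * CC.X⁻¹ := by rw [CC.X]; group
  refine Pres.induction scal ?_ inv add mul x
  rintro (_ | _ | _ | _)
  · exact h0
  · exact h1
  · change P CC.V0
    rw [CC.V0_eq]
    exact hmul _ _ (hmul _ _ (inv _ (scal _)) hX) (inv _ h0)
  · change P CC.V1
    rw [hV1]
    exact hmul _ _ (inv _ h1) (inv _ hX)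

theorem ofPoly_T_one : A1.ofPoly (T 1) = A1.X := by
  rw [A1.ofPoly]
  change AddMonoidAlgebra.lift A1.Z A1.H ℤ _ (AddMonoidAlgebra.single 1 1) = _
  rw [AddMonoidAlgebra.lift_single]
  simp

/-- Substituting `X`, applying `τ_-⁻¹` and acting are all multiplicative, so the factor `G` alone is
applied to `1`. -/
theorem zetaPoly_mul (F G : LaurentPolynomial CC.Z) : zetaPoly (F * G) =
    A1.polyRep (A1.tauMinus.symm (A1.ofPoly (AddMonoidAlgebra.mapRingHom ℤ spec2 F))) (zetaPoly G) := by
  simp [zetaPoly]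

theorem zetaPoly_add (F G : LaurentPolynomial CC.Z) :
    zetaPoly (F + G) = zetaPoly F + zetaPoly G := by
  simp [zetaPoly]

theorem zetaPoly_one : zetaPoly 1 = 1 := by
  simp [zetaPoly]

theorem tauMinus_symm_algebraMap (a : A1.Z) :
    A1.tauMinus.symm (algebraMap A1.Z A1.H a) = algebraMap A1.Z A1.H a := by
  change A1.tauMinusInvHom (algebraMap A1.Z A1.H a) = _
  rw [A1.tauMinusInvHom, A1.lift_algebraMap]
  have : Params.subst (Params.var : A1.Par → A1.Zˣ) = RingHom.id _ :=
    Params.hom_ext fun i => congrArg Units.val (Params.map_subst_var _ i)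
  rw [this]; rfl

theorem tauMinus_symm_X : A1.tauMinus.symm A1.X = (A1.Q⁻¹ * A1.Y⁻¹ * A1.X : A1.Hˣ) :=
  congrArg Units.val A1.tauMinusInv_X

theorem zetaPoly_C_mul (a : CC.Z) (F : LaurentPolynomial CC.Z) :
    zetaPoly (C a * F) = A1.polyRep (zeta (algebraMap _ _ a)) (zetaPoly F) := by
  have h : AddMonoidAlgebra.mapRingHom ℤ spec2 (C a) = algebraMap A1.Z _ (spec2 a) :=
    by exact AddMonoidAlgebra.mapRingHom_single _ _ _
  rw [zetaPoly_mul, h, AlgHom.commutes, tauMinus_symm_algebraMap, zeta_algebraMap]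

/-- This is the reason for the twist by `τ_-⁻¹` in `zetaPoly`: `ζ(𝕏)` equals `τ_-⁻¹(X)` and not `X`.
-/
theorem zetaPoly_T_mul (F : LaurentPolynomial CC.Z) :
    zetaPoly (T 1 * F) = A1.polyRep (zeta CC.X) (zetaPoly F) := by
  have h : AddMonoidAlgebra.mapRingHom ℤ spec2 (T 1) = T 1 :=
    (AddMonoidAlgebra.mapRingHom_single _ _ _).trans (by rw [map_one]; rfl)
  have e : zeta CC.X = _ := congrArg Units.val zeta_X
  rw [zetaPoly_mul, h, ofPoly_T_one, tauMinus_symm_X, e]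


theorem CC.rep_U0 {k : Type*} [CommRing k] [IsDomain k] (p : CC.Par → kˣ) :
    Units.map (CC.rep p : CC.H →* _) CC.U0 = CC.opU0 p := CC.lift_gen _ _ _ _ CC.Gen.U0

theorem CC.rep_U1 {k : Type*} [CommRing k] [IsDomain k] (p : CC.Par → kˣ) :
    Units.map (CC.rep p : CC.H →* _) CC.U1 = CC.opU1 p := CC.lift_gen _ _ _ _ CC.Gen.U1

theorem CC.rep_V1 {k : Type*} [CommRing k] [IsDomain k] (p : CC.Par → kˣ) :
    Units.map (CC.rep p : CC.H →* _) CC.V1 = CC.opV1 p := CC.lift_gen _ _ _ _ CC.Gen.V1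

theorem CC.rep_X {k : Type*} [CommRing k] [IsDomain k] (p : CC.Par → kˣ) :
    Units.map (CC.rep p : CC.H →* _) CC.X = mulX k := by
  rw [CC.X, map_mul, map_inv, map_inv, CC.rep_U1, CC.rep_V1, CC.opV1]; group

theorem CC.rep_Y {k : Type*} [CommRing k] [IsDomain k] (p : CC.Par → kˣ) :
    Units.map (CC.rep p : CC.H →* _) CC.Y = CC.opU0 p * CC.opU1 p := by
  rw [CC.Y, map_mul, CC.rep_U0, CC.rep_U1]

theorem A1.rep_T {k : Type*} [CommRing k] [IsDomain k] (p : A1.Par → kˣ) :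
    Units.map (A1.rep p : A1.H →* _) A1.T = A1.opT p := A1.lift_gen _ _ _ _ _ _ A1.Gen.T

theorem A1.rep_Y {k : Type*} [CommRing k] [IsDomain k] (p : A1.Par → kˣ) :
    Units.map (A1.rep p : A1.H →* _) A1.Y = A1.opPi p * A1.opT p :=
  A1.lift_gen _ _ _ _ _ _ A1.Gen.Y

theorem demazure_one {k : Type*} [CommRing k] (a b : kˣ) : demazure a b 1 = C (a : k) := by
  have h : divDiff (1 : LaurentPolynomial k) = 0 := by
    have := divDiff_T (k := k) 0
    simpa using this
  simp [demazure, h, smul_eq_C_mul]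

theorem reflect_C {k : Type*} [CommRing k] (a : kˣ) (c : k) : reflect a (C c) = C c :=
  (reflect a).commutes c

theorem CC.polyRep_algebraMap (a : CC.Z) (F : LaurentPolynomial CC.Z) :
    CC.polyRep (algebraMap _ _ a) F = C a * F := by
  have h3 : Params.subst (Params.var : CC.Par → CC.Zˣ) = RingHom.id _ :=
    Params.hom_ext fun i => congrArg Units.val (Params.map_subst_var _ i)
  rw [CC.polyRep, CC.rep, CC.lift_algebraMap, h3]
  exact smul_eq_C_mul _ _

/-- The elements of `H_{q,u,v}` whose action on `F` is compatible with `zetaPoly`. -/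
def IntertwinesAt (h : CC.H) (F : LaurentPolynomial CC.Z) : Prop :=
  zetaPoly (CC.polyRep h F) = A1.polyRep (zeta h) (zetaPoly F)

namespace IntertwinesAt

variable {h h' : CC.H} {F G : LaurentPolynomial CC.Z}

theorem add (e : IntertwinesAt h F) (e' : IntertwinesAt h' F) : IntertwinesAt (h + h') F := by
  unfold IntertwinesAt at *
  simp [zetaPoly_add, e, e']

theorem add_right (e : IntertwinesAt h F) (e' : IntertwinesAt h G) : IntertwinesAt h (F + G) := by
  unfold IntertwinesAt at *
  simp [zetaPoly_add, e, e']

theorem mul (e : IntertwinesAt h (CC.polyRep h' F)) (e' : IntertwinesAt h' F) :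
    IntertwinesAt (h * h') F := by
  unfold IntertwinesAt at *
  rw [map_mul, Module.End.mul_apply, e, e', map_mul, map_mul, Module.End.mul_apply]

theorem of_mul (e : IntertwinesAt (h * h') F) (e' : IntertwinesAt h' F) :
    IntertwinesAt h (CC.polyRep h' F) := by
  unfold IntertwinesAt at *
  rw [map_mul, Module.End.mul_apply, map_mul, map_mul, Module.End.mul_apply] at e
  rw [e, e']

theorem inv {x : CC.Hˣ} (e : ∀ F, IntertwinesAt x F) (F) : IntertwinesAt (x⁻¹ : CC.Hˣ) F := by
  have h1 := e (CC.polyRep (x⁻¹ : CC.Hˣ) F)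
  unfold IntertwinesAt at *
  rw [← Module.End.mul_apply, ← map_mul, Units.mul_inv, map_one, Module.End.one_apply] at h1
  rw [h1, ← Module.End.mul_apply, ← map_mul, ← map_mul, Units.inv_mul, map_one, map_one,
    Module.End.one_apply]

theorem scal (a : CC.Z) (F) : IntertwinesAt (algebraMap _ _ a) F := by
  unfold IntertwinesAt
  rw [CC.polyRep_algebraMap, zetaPoly_C_mul]

theorem X (F) : IntertwinesAt CC.X F := by
  have h1 : CC.polyRep CC.X F = T 1 * F :=
    congrArg (fun u : (Module.End CC.Z (LaurentPolynomial CC.Z))ˣ => u.1 F) (CC.rep_X Params.var)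
  unfold IntertwinesAt
  rw [h1, zetaPoly_T_mul]

/-- An element which satisfies a cross relation with `𝕏` and is compatible at `1` is compatible
with `zetaPoly`. -/
theorem of_cross {U S : CC.H} {c : CC.Zˣ}
    (hU : U * (CC.X⁻¹ : CC.Hˣ) = (scalar CC.H c * CC.X : CC.Hˣ) * U + S)
    (hS : ∀ F, IntertwinesAt S F) (h1 : IntertwinesAt U 1) (F) : IntertwinesAt U F := by
  have hcX : ∀ F, IntertwinesAt (scalar CC.H c * CC.X : CC.Hˣ) F := fun F => by
    rw [Units.val_mul]; exact mul (scal _ _) (X _)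
  -- Compatibility of `U` at `𝕏⁻¹ F` is compatibility of `U 𝕏⁻¹` at `F`, and the cross relation
  -- expresses `U 𝕏⁻¹` by `U` at `F` and compatible elements.
  have down : ∀ F, IntertwinesAt U F → IntertwinesAt U (CC.polyRep (CC.X⁻¹ : CC.Hˣ) F) :=
    fun F hF => by
      refine of_mul ?_ (inv X F)
      rw [hU]
      exact add (mul (hcX _) hF) (hS F)
  -- In the other direction the cross relation is solved as `U = (c𝕏)⁻¹ (U 𝕏⁻¹ - S)`. At `𝕏 F` the
  -- inner `𝕏⁻¹` cancels `𝕏`.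
  have up : ∀ F, IntertwinesAt U F → IntertwinesAt U (CC.polyRep CC.X F) := fun F hF => by
    have e : U = ((scalar CC.H c * CC.X : CC.Hˣ)⁻¹ : CC.Hˣ) *
        (U * (CC.X⁻¹ : CC.Hˣ) + algebraMap CC.Z CC.H (-1) * S) := by
      rw [hU, map_neg, map_one, neg_one_mul, add_neg_cancel_right, Units.inv_mul_cancel_left]
    have e2 : CC.polyRep (CC.X⁻¹ : CC.Hˣ) (CC.polyRep CC.X F) = F := by
      rw [← Module.End.mul_apply, ← map_mul, Units.inv_mul, map_one, Module.End.one_apply]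
    rw [e]
    exact mul (inv hcX _) (add (mul (by rwa [e2]) (inv X _)) (mul (scal _ _) (hS _)))
  have hX : ∀ F, CC.polyRep CC.X F = T 1 * F := fun F =>
    congrArg (fun u : (Module.End CC.Z (LaurentPolynomial CC.Z))ˣ => u.1 F) (CC.rep_X Params.var)
  have hX' : ∀ F, CC.polyRep (CC.X⁻¹ : CC.Hˣ) F = T (-1) * F := fun F =>
    congrArg (fun u : (Module.End CC.Z (LaurentPolynomial CC.Z))ˣ => u⁻¹.1 F) (CC.rep_X Params.var)
  have hT : ∀ n : ℤ, IntertwinesAt U (T n) := by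
    intro n
    induction n using Int.induction_on with
    | zero => exact h1
    | succ n hn =>
      have := up _ hn
      rwa [hX, ← T_add, add_comm] at this
    | pred n hn =>
      have := down _ hn
      rwa [hX', ← T_add, add_comm] at this
  induction F using LaurentPolynomial.induction_on' with
  | add p q hp hq => exact add_right hp hq
  | C_mul_T n a =>
    have h2 := of_mul (h := U) (h' := algebraMap CC.Z CC.H a) (F := T n)
    rw [← CC.polyRep_algebraMap]
    refine h2 ?_ (scal _ _)
    rw [← Algebra.commutes]
    exact mul (scal _ _) (hT n)

end IntertwinesAt

theorem IsHecke.inv_eq {R S : Type*} [CommRing R] [Ring S] [Algebra R S] {a : Rˣ} {x : Sˣ}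
    (h : IsHecke a x) : ((x⁻¹ : Sˣ) : S) = x - algebraMap R S (a - (a⁻¹ : Rˣ)) := by
  have h1 : algebraMap R S a * algebraMap R S ((a⁻¹ : Rˣ) : R) = 1 := by
    rw [← map_mul, Units.mul_inv, map_one]
  have h2 : (x : S) * (x - algebraMap R S (a - (a⁻¹ : Rˣ))) = 1 := by
    unfold IsHecke at h
    rw [sub_mul, mul_add, mul_add, h1, ← Algebra.commutes ((a⁻¹ : Rˣ) : R) (x : S)] at h
    rw [mul_sub, ← Algebra.commutes, map_sub, sub_mul, ← sub_eq_zero, ← h]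
    abel
  rw [← mul_one ((x⁻¹ : Sˣ) : S), ← h2, Units.inv_mul_cancel_left]

/-- The Hecke relation of `V_1 = U_1⁻¹ 𝕏⁻¹` reads `𝕏 U_1 = U_1⁻¹ 𝕏⁻¹ - (v_1^{1/2} - v_1^{-1/2})`,
and that of `U_1` replaces `U_1⁻¹` by `U_1` minus a scalar. -/
theorem CC.U1_mul_X_inv : (CC.U1 : CC.H) * (CC.X⁻¹ : CC.Hˣ) =
    (scalar CC.H (1 : CC.Zˣ) * CC.X : CC.Hˣ) * CC.U1 +
      (algebraMap CC.Z CC.H ((Params.var CC.Par.su1 : CC.Zˣ) -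
          ((Params.var CC.Par.su1)⁻¹ : CC.Zˣ)) * (CC.X⁻¹ : CC.Hˣ) +
        algebraMap CC.Z CC.H ((Params.var CC.Par.sv1 : CC.Zˣ) -
          ((Params.var CC.Par.sv1)⁻¹ : CC.Zˣ))) := by
  have hV : CC.V1 = CC.U1⁻¹ * CC.X⁻¹ := by rw [CC.X]; group
  have e1 := (CC.gen_isHecke .U1).inv_eq
  have e2 := (CC.gen_isHecke .V1).inv_eq
  change ((CC.V1⁻¹ : CC.Hˣ) : CC.H) = (CC.V1 : CC.Hˣ) - _ at e2
  rw [hV, mul_inv_rev, inv_inv, inv_inv, Units.val_mul, Units.val_mul, e1, sub_mul,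
    sub_sub, eq_sub_iff_add_eq] at e2
  rw [scalar_one, one_mul]
  exact e2.symm

/-- By the product relation the left-hand side is `q^{-1/4} V_0⁻¹`. The Hecke relation of `V_0 =
q^{-1/4} 𝕏 U_0⁻¹` and then that of `U_0` remove the inverses; the two factors `q^{-1/4}` give the
coefficient `q^{-1/2}`. -/
theorem CC.U0_mul_X_inv : (CC.U0 : CC.H) * (CC.X⁻¹ : CC.Hˣ) =
    (scalar CC.H ((Params.var CC.Par.q4 : CC.Zˣ) ^ 2)⁻¹ * CC.X : CC.Hˣ) * CC.U0 +
      (algebraMap CC.Z CC.H (-((Params.var CC.Par.q4 ^ 2)⁻¹ : CC.Zˣ) *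
          ((Params.var CC.Par.su0 : CC.Zˣ) - ((Params.var CC.Par.su0)⁻¹ : CC.Zˣ))) * CC.X +
        algebraMap CC.Z CC.H (-((Params.var CC.Par.q4)⁻¹ : CC.Zˣ) *
          ((Params.var CC.Par.sv0 : CC.Zˣ) - ((Params.var CC.Par.sv0)⁻¹ : CC.Zˣ)))) := by
  have e1 : ((CC.U0⁻¹ : CC.Hˣ) : CC.H) = CC.U0 - algebraMap CC.Z CC.H
      ((Params.var CC.Par.su0 : CC.Zˣ) - ((Params.var CC.Par.su0)⁻¹ : CC.Zˣ)) :=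
    (CC.gen_isHecke .U0).inv_eq
  have e2 : ((CC.V0⁻¹ : CC.Hˣ) : CC.H) = CC.V0 - algebraMap CC.Z CC.H
      ((Params.var CC.Par.sv0 : CC.Zˣ) - ((Params.var CC.Par.sv0)⁻¹ : CC.Zˣ)) :=
    (CC.gen_isHecke .V0).inv_eq
  have hq := scalar_comm (S := CC.H) (Params.var CC.Par.q4)
  have e3 : CC.U0 * CC.X⁻¹ = (scalar CC.H (Params.var CC.Par.q4))⁻¹ * CC.V0⁻¹ := by
    rw [CC.V0_eq]
    generalize scalar CC.H (Params.var CC.Par.q4) = q at *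
    calc _ = CC.U0 * CC.X⁻¹ * q * q⁻¹ := by group
      _ = _ := by rw [← A1.w_central hq]; group
  rw [← Units.val_mul, e3, Units.val_mul, e2, CC.V0_eq, ← scalar_inv, Units.val_mul, Units.val_mul,
    e1]
  have es : ∀ a : CC.Zˣ, ((scalar CC.H a : CC.Hˣ) : CC.H) = algebraMap CC.Z CC.H a := fun _ => rfl
  have eq : (((Params.var CC.Par.q4 ^ 2)⁻¹ : CC.Zˣ) : CC.Z) =
      ((Params.var CC.Par.q4)⁻¹ : CC.Zˣ) * ((Params.var CC.Par.q4)⁻¹ : CC.Zˣ) := by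
    rw [← Units.val_mul, sq, mul_inv]
  rw [Units.val_mul, es, es, eq]
  simp only [map_mul, map_neg]
  have c1 := Algebra.commutes (R := CC.Z) (A := CC.H)
    ((Params.var CC.Par.su0 : CC.Zˣ) - ((Params.var CC.Par.su0)⁻¹ : CC.Zˣ)) CC.X
  generalize algebraMap CC.Z CC.H
    ((Params.var CC.Par.su0 : CC.Zˣ) - ((Params.var CC.Par.su0)⁻¹ : CC.Zˣ)) = hu at *
  rw [mul_sub, mul_sub, mul_sub, mul_assoc _ _ hu, ← c1]
  noncomm_ring

theorem A1.polyRep_algebraMap (a : A1.Z) (F : LaurentPolynomial A1.Z) :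
    A1.polyRep (algebraMap _ _ a) F = C a * F := by
  have h3 : Params.subst (Params.var : A1.Par → A1.Zˣ) = RingHom.id _ :=
    Params.hom_ext fun i => congrArg Units.val (Params.map_subst_var _ i)
  have h2 : A1.polyRep (algebraMap _ _ a) = algebraMap A1.Z _ (Params.subst Params.var a) :=
    Pres.lift_algebraMap _ _ _ _
  rw [h2, h3]
  exact smul_eq_C_mul _ _

theorem spec2_var (i : CC.Par) : spec2 (Params.var i : CC.Zˣ) = par2 i := by
  rw [spec2_eq]; exact congrArg Units.val (Params.map_subst_var par2 i)

theorem spec1_var (i : CC.Par) : spec1 (Params.var i : CC.Zˣ) = par1 i := by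
  rw [spec1_eq]; exact congrArg Units.val (Params.map_subst_var par1 i)

/-- By the cross relations only the action of `U_0` and `U_1` on `1` matters. There they are the
scalars `u_i^{1/2}`, matching `T(1) = t^{1/2}` and `Y² T⁻¹(1) = t^{1/2}`. -/
theorem zetaPoly_polyRep (h : CC.H) (F : LaurentPolynomial CC.Z) :
    zetaPoly (CC.polyRep h F) = A1.polyRep (zeta h) (zetaPoly F) := by
  have hT : A1.polyRep A1.T 1 = C ((Params.var A1.Par.st : A1.Zˣ) : A1.Z) := by
    have e : A1.polyRep A1.T = A1.opT Params.var := congrArg Units.val (A1.rep_T Params.var)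
    rw [e]
    exact demazure_one _ _
  have hY : A1.polyRep A1.Y 1 = C ((Params.var A1.Par.st : A1.Zˣ) : A1.Z) := by
    have e : A1.polyRep A1.Y = (A1.opPi Params.var * A1.opT Params.var : (Module.End _ _)ˣ) :=
      congrArg Units.val (A1.rep_Y Params.var)
    rw [e]
    exact (congrArg _ (demazure_one _ _)).trans (reflect_C _ _)
  have hz : ∀ a : CC.Z, zetaPoly (C a) = C (spec2 a) := fun a => by
    have := zetaPoly_C_mul a 1
    rwa [zetaPoly_one, zeta_algebraMap, A1.polyRep_algebraMap, mul_one, mul_one] at this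
  have base1 : IntertwinesAt CC.U1 1 := by
    have e : CC.polyRep CC.U1 1 = C ((Params.var CC.Par.su1 : CC.Zˣ) : CC.Z) :=
      (congrArg (fun u : (Module.End CC.Z (LaurentPolynomial CC.Z))ˣ => u.1 1)
        (CC.rep_U1 Params.var)).trans (demazure_one _ _)
    have e2 : zeta CC.U1 = A1.T := congrArg Units.val zeta_U1
    unfold IntertwinesAt
    rw [e, hz, zetaPoly_one, e2, hT, spec2_var]
    rfl
  have base0 : IntertwinesAt CC.U0 1 := by
    have e : CC.polyRep CC.U0 1 = C ((Params.var CC.Par.su0 : CC.Zˣ) : CC.Z) := by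
      refine (congrArg (fun u : (Module.End CC.Z (LaurentPolynomial CC.Z))ˣ => u.1 1)
        (CC.rep_U0 Params.var)).trans ?_
      change reflect _ (demazure _ _ (reflect _ 1)) = _
      rw [map_one, demazure_one, reflect_C]
    have e2 : zeta CC.U0 = (A1.Y ^ 2 * A1.T⁻¹ : A1.Hˣ) := congrArg Units.val zeta_U0
    have hT' : A1.polyRep (A1.T⁻¹ : A1.Hˣ) (C ((Params.var A1.Par.st : A1.Zˣ) : A1.Z)) = 1 := by
      rw [← hT, ← Module.End.mul_apply, ← map_mul, Units.inv_mul, map_one A1.polyRep, Module.End.one_apply]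
    have hc : ∀ (h : A1.H), A1.polyRep h (C ((Params.var A1.Par.st : A1.Zˣ) : A1.Z)) =
        ((Params.var A1.Par.st : A1.Zˣ) : A1.Z) • A1.polyRep h 1 := fun h => by
      rw [← map_smul, smul_eq_C_mul, mul_one]
    rw [hc] at hT'
    unfold IntertwinesAt
    rw [e, hz, zetaPoly_one, e2, spec2_var, sq, Units.val_mul, Units.val_mul]
    simp only [map_mul, Module.End.mul_apply]
    change C ((Params.var A1.Par.st : A1.Zˣ) : A1.Z) = _
    -- Multiplying by `t^{1/2}` absorbs `T⁻¹(1)`, since `t^{1/2} T⁻¹(1) = 1`; two applications of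
    -- `Y(1) = t^{1/2}` finish.
    refine (Units.isUnit (Params.var A1.Par.st : A1.Zˣ)).smul_left_cancel.mp ?_
    rw [← map_smul (A1.polyRep A1.Y), ← map_smul (A1.polyRep A1.Y), hT', hY, hc, hY]
  suffices ∀ F, IntertwinesAt h F from this F
  have hX' := IntertwinesAt.inv IntertwinesAt.X
  induction h using CC.scalar_gen_induction with
  | scal a => exact IntertwinesAt.scal a
  | hX => exact IntertwinesAt.X
  | h0 =>
    exact IntertwinesAt.of_cross CC.U0_mul_X_inv (fun F => .add (.mul (.scal _ _) (.X _)) (.scal _ _))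
      base0
  | h1 =>
    exact IntertwinesAt.of_cross CC.U1_mul_X_inv (fun F => .add (.mul (.scal _ _) (hX' _)) (.scal _ _))
      base1
  | inv x hx => exact IntertwinesAt.inv hx
  | add x y hx hy => exact fun F => (hx F).add (hy F)
  | mul x y hx hy => exact fun F => .mul (hx _) (hy F)

end

section

open LaurentPolynomial

/-! ### Triangular operators on Laurent polynomials -/

section Triangular

variable {k : Type*} [CommRing k]

/-- The Laurent polynomials with exponents in a given set. -/
def supportedIn (k : Type*) [CommRing k] (s : Set ℤ) : Submodule k (LaurentPolynomial k) where
  carrier := {f | ∀ m ∉ s, f.coeff m = 0}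
  zero_mem' := fun m _ => rfl
  add_mem' := fun {f g} hf hg m hm => by
    change f.coeff m + g.coeff m = 0
    rw [hf m hm, hg m hm, add_zero]
  smul_mem' := fun c f hf m hm => by
    change c * f.coeff m = 0
    rw [hf m hm, mul_zero]

theorem coeff_T (n m : ℤ) : (T n : LaurentPolynomial k).coeff m = if n = m then 1 else 0 :=
  Finsupp.single_apply

theorem coeff_smul' (c : k) (f : LaurentPolynomial k) (m : ℤ) :
    (c • f).coeff m = c * f.coeff m := rfl

theorem coeff_add' (f g : LaurentPolynomial k) (m : ℤ) :
    (f + g).coeff m = f.coeff m + g.coeff m := rfl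

theorem coeff_sub' (f g : LaurentPolynomial k) (m : ℤ) :
    (f - g).coeff m = f.coeff m - g.coeff m := by
  rw [eq_sub_iff_add_eq, ← coeff_add', sub_add_cancel]

theorem T_mem_supportedIn {s : Set ℤ} {n : ℤ} (h : n ∈ s) : T n ∈ supportedIn k s := fun m hm => by
  rw [coeff_T, if_neg]
  rintro rfl
  exact hm h

theorem supportedIn_mono {s t : Set ℤ} (h : s ⊆ t) : supportedIn k s ≤ supportedIn k t :=
  fun _ hf m hm => hf m fun hs => hm (h hs)

theorem supportedIn_le {s : Set ℤ} {P : Submodule k (LaurentPolynomial k)}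
    (h : ∀ n ∈ s, T n ∈ P) : supportedIn k s ≤ P := by
  intro f hf
  have e : f = f.coeff.sum fun n c => c • (T n : LaurentPolynomial k) := by
    refine (AddMonoidAlgebra.sum_coeff_single f).symm.trans (Finsupp.sum_congr fun n _ => ?_)
    rw [smul_eq_C_mul, single_eq_C_mul_T]
  rw [e]
  refine Submodule.sum_mem _ fun n hn => P.smul_mem _ (h n ?_)
  by_contra hs
  exact Finsupp.mem_support_iff.mp hn (hf n hs)

/-- The position of an exponent in the order `0, 1, -1, 2, -2, …`. -/
def ord (n : ℤ) : ℕ := if 0 < n then 2 * n.natAbs - 1 else 2 * n.natAbs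

theorem ord_injective : Function.Injective ord := by
  intro m n h
  unfold ord at h
  split_ifs at h <;> omega

theorem ord_surjective : Function.Surjective ord := by
  intro j
  rcases Nat.even_or_odd' j with ⟨i, rfl | rfl⟩
  · exact ⟨-i, by unfold ord; split_ifs <;> omega⟩
  · exact ⟨i + 1, by unfold ord; split_ifs <;> omega⟩

/-- The span of the first `j` monomials in the order `0, 1, -1, 2, -2, …` of the exponents. -/
def lowerSpan (k : Type*) [CommRing k] (j : ℕ) : Submodule k (LaurentPolynomial k) :=
  supportedIn k {m | ord m < j}

theorem lowerSpan_mono {i j : ℕ} (h : i ≤ j) : lowerSpan k i ≤ lowerSpan k j :=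
  supportedIn_mono fun _ hm => lt_of_lt_of_le hm h

theorem T_mem_lowerSpan {n : ℤ} {j : ℕ} (h : ord n < j) : T n ∈ lowerSpan k j :=
  T_mem_supportedIn h

theorem mem_lowerSpan_of_succ {n : ℤ} {f : LaurentPolynomial k} (hf : f ∈ lowerSpan k (ord n + 1))
    (h : f.coeff n = 0) : f ∈ lowerSpan k (ord n) := fun m hm => by
  by_cases e : m = n
  · rw [e, h]
  · refine hf m fun h' => ?_
    have h1 : ord m < ord n + 1 := h'
    have h2 : ¬ ord m < ord n := hm
    exact e (ord_injective (by omega))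

theorem exists_mem_lowerSpan (f : LaurentPolynomial k) : ∃ j, f ∈ lowerSpan k j := by
  refine ⟨f.coeff.support.sup ord + 1, fun m hm => ?_⟩
  by_contra h
  exact hm (Nat.lt_succ_of_le (Finset.le_sup (f := ord) (Finsupp.mem_support_iff.mpr h)))

theorem lowerSpan_zero {f : LaurentPolynomial k} (h : f ∈ lowerSpan k 0) : f = 0 :=
  LaurentPolynomial.ext fun m => h m (Nat.not_lt_zero _)

/-- A linear operator is triangular with diagonal entries `lam n`. -/
def IsTriangular (L : Module.End k (LaurentPolynomial k)) (lam : ℤ → k) : Prop :=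
  ∀ n, L (T n) - lam n • T n ∈ lowerSpan k (ord n)

namespace IsTriangular

variable {L : Module.End k (LaurentPolynomial k)} {lam : ℤ → k}

/-- On `x^n` this is triangularity; each lower monomial is mapped into the span of itself and still
lower ones, and its own multiple does no harm. -/
theorem apply_sub_mem (h : IsTriangular L lam) (n : ℤ) {f : LaurentPolynomial k}
    (hf : f ∈ lowerSpan k (ord n + 1)) : L f - lam n • f ∈ lowerSpan k (ord n) := by
  have : lowerSpan k (ord n + 1) ≤ (lowerSpan k (ord n)).comap (L - lam n • 1) := by
    refine supportedIn_le fun m hm => ?_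
    change L (T m) - lam n • T m ∈ lowerSpan k (ord n)
    rcases (Nat.lt_succ_iff.mp hm).eq_or_lt with e | e
    · rw [ord_injective e]; exact h n
    · have h1 := lowerSpan_mono e.le (h m)
      have h2 := (lowerSpan k (ord n)).smul_mem (lam m - lam n) (T_mem_lowerSpan e)
      have := add_mem h1 h2
      rwa [sub_smul, sub_add_sub_cancel] at this
  exact this hf

/-- `L - lam n` is surjective on the span of the monomials below `x^n`. -/
theorem exists_preimage (h : IsTriangular L lam) (n : ℤ)
    (hu : ∀ m, ord m < ord n → IsUnit (lam m - lam n)) (j : ℕ) (hj : j ≤ ord n) :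
    ∀ r ∈ lowerSpan k j, ∃ g ∈ lowerSpan k j, L g - lam n • g = r := by
  induction j with
  | zero => exact fun r hr => ⟨0, zero_mem _, by simp [lowerSpan_zero hr]⟩
  | succ j ih =>
    intro r hr
    obtain ⟨i, rfl⟩ := ord_surjective j
    obtain ⟨u, hu⟩ := hu i hj
    -- The leading coefficient of `(L - lam n)(c x^i)` is `c (lam i - lam n)`, which this choice
    -- makes equal to that of `r`. The remainder is lower and falls under the induction hypothesis.
    set c := r.coeff i * (u⁻¹ : kˣ) with hc
    have hT : T i ∈ lowerSpan k (ord i + 1) := T_mem_lowerSpan (Nat.lt_succ_self _)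
    have e : r - (L (c • T i) - lam n • c • T i) ∈ lowerSpan k (ord i) := by
      have h1 : (r - r.coeff i • T i) ∈ lowerSpan k (ord i) :=
        mem_lowerSpan_of_succ (sub_mem hr (Submodule.smul_mem _ _ hT))
          (by rw [coeff_sub', coeff_smul', coeff_T, if_pos rfl, mul_one, sub_self])
      have h2 := (lowerSpan k (ord i)).smul_mem c (h i)
      have h3 : r.coeff i = c * (lam i - lam n) := by
        rw [hc, ← hu, mul_assoc, Units.inv_mul, mul_one]
      have h4 := sub_mem h1 h2
      rw [h3] at h4
      convert h4 using 1
      rw [map_smul, smul_sub, smul_smul, smul_smul, mul_sub, sub_smul, mul_comm (lam n)]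
      abel
    obtain ⟨g, hg, hg'⟩ := ih (by omega) _ e
    refine ⟨g + c • T i, add_mem (lowerSpan_mono (Nat.le_succ _) hg) (Submodule.smul_mem _ _ hT), ?_⟩
    rw [map_add, smul_add, add_sub_add_comm, hg', sub_add_cancel]

/-- Solving `(L - lam n) g = (L - lam n) x^n` with `g` below `x^n` gives the eigenvector `x^n - g`.
Only units are divided by, and this is what allows the later use over a localization. -/
theorem exists_eigenvector (h : IsTriangular L lam) (n : ℤ)
    (hu : ∀ m, ord m < ord n → IsUnit (lam m - lam n)) :
    ∃ f ∈ lowerSpan k (ord n + 1), L f = lam n • f ∧ f.coeff n = 1 := by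
  obtain ⟨g, hg, e⟩ := h.exists_preimage n hu _ le_rfl _ (h n)
  refine ⟨T n - g, sub_mem (T_mem_lowerSpan (Nat.lt_succ_self _))
    (lowerSpan_mono (Nat.le_succ _) hg), ?_, ?_⟩
  · rw [map_sub, smul_sub, sub_eq_sub_iff_sub_eq_sub, e]
  · rw [coeff_sub', coeff_T, if_pos rfl, hg n (lt_irrefl (ord n)), sub_zero]

/-- The highest monomial `x^i` of an eigenvector forces `lam i = lam n`, hence `i = n`, where the
coefficient is assumed to vanish. No bound on the exponents of `f` is needed, so the definition of
`E_n` can do without one. -/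
theorem eigenvector_eq_zero [IsDomain k] (h : IsTriangular L lam) (n : ℤ)
    (hne : ∀ m, m ≠ n → lam m ≠ lam n) {f : LaurentPolynomial k} (hf : L f = lam n • f)
    (h0 : f.coeff n = 0) : f = 0 := by
  obtain ⟨j, hj⟩ := exists_mem_lowerSpan f
  induction j with
  | zero => exact lowerSpan_zero hj
  | succ j ih =>
    obtain ⟨i, rfl⟩ := ord_surjective j
    refine ih ?_
    by_cases e : i = n
    · exact mem_lowerSpan_of_succ hj (e ▸ h0)
    · intro m hm
      have := h.apply_sub_mem i hj m hm
      rw [hf, ← sub_smul, coeff_smul'] at this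
      exact (mul_eq_zero.mp this).resolve_left (sub_ne_zero.mpr (hne i e).symm)

theorem eigenvector_unique [IsDomain k] (h : IsTriangular L lam) (n : ℤ)
    (hne : ∀ m, m ≠ n → lam m ≠ lam n) {f g : LaurentPolynomial k} (hf : L f = lam n • f)
    (hf1 : f.coeff n = 1) (hg : L g = lam n • g) (hg1 : g.coeff n = 1) : f = g :=
  sub_eq_zero.mp (h.eigenvector_eq_zero n hne (by rw [map_sub, hf, hg, smul_sub])
    (by rw [coeff_sub', hf1, hg1, sub_self]))

end IsTriangular

end Triangular

/-! ### Triangularity of `𝕐` -/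

section Demazure

variable {k : Type*} [CommRing k]

/-- The span of the monomials `x^m` with `|m| < n`. -/
def degLT (k : Type*) [CommRing k] (n : ℕ) : Submodule k (LaurentPolynomial k) :=
  supportedIn k {m | m.natAbs < n}

theorem T_mem_degLT {m : ℤ} {n : ℕ} (h : m.natAbs < n) : T m ∈ degLT k n := T_mem_supportedIn h

/-- The divided difference of `x^n` is `-(x^{-n} + x^{-n+2} + … + x^{n-2})`. Its term `x^{-n}`
corrects the coefficient `a` coming from `a s` to `a - (a - a⁻¹) = a⁻¹`. The part with `b` is
shifted by `x`, so its exponents lie strictly between `-n` and `n`. -/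
theorem demazure_T_pos (a b : kˣ) {n : ℕ} (hn : 0 < n) :
    demazure a b (T n) - ((a⁻¹ : kˣ) : k) • T (-n) ∈ degLT k n := by
  obtain ⟨n, rfl⟩ := Nat.exists_eq_add_one_of_ne_zero hn.ne'
  have h1 : ∑ j ∈ Finset.range n, (T (2 * ((j + 1 : ℕ) : ℤ) - (n + 1 : ℕ)) : LaurentPolynomial k) ∈
      degLT k (n + 1) := Submodule.sum_mem _ fun j hj => T_mem_degLT (by
        have := Finset.mem_range.mp hj; omega)
  have h2 : ∑ j ∈ Finset.range (n + 1), (T (1 + (2 * (j : ℤ) - (n + 1 : ℕ))) : LaurentPolynomial k) ∈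
      degLT k (n + 1) := Submodule.sum_mem _ fun j hj => T_mem_degLT (by
        have := Finset.mem_range.mp hj; omega)
  have e : demazure a b (T ((n + 1 : ℕ) : ℤ)) - ((a⁻¹ : kˣ) : k) • T (-((n + 1 : ℕ) : ℤ)) =
      -(((a : k) - (a⁻¹ : kˣ)) • ∑ j ∈ Finset.range n, T (2 * ((j + 1 : ℕ) : ℤ) - (n + 1 : ℕ))) -
      ((b : k) - (b⁻¹ : kˣ)) • ∑ j ∈ Finset.range (n + 1), T (1 + (2 * (j : ℤ) - (n + 1 : ℕ))) := by
    have hd : divDiff (T ((n + 1 : ℕ) : ℤ) : LaurentPolynomial k) =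
        -∑ j ∈ Finset.range (n + 1), T (2 * (j : ℤ) - (n + 1 : ℕ)) := by
      rw [divDiff_T, if_pos (by omega), Int.toNat_natCast]
    have hT : ∑ j ∈ Finset.range (n + 1), (T (1 + (2 * (j : ℤ) - (n + 1 : ℕ))) : LaurentPolynomial k)
        = T 1 * ∑ j ∈ Finset.range (n + 1), T (2 * (j : ℤ) - (n + 1 : ℕ)) := by
      rw [Finset.mul_sum]
      exact Finset.sum_congr rfl fun j _ => T_add _ _
    rw [hT, demazure, LinearMap.add_apply, LinearMap.smul_apply, LinearMap.comp_apply, hd,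
      LinearMap.mulLeft_apply]
    change _ • reflect 1 _ + _ - _ = _
    -- The summand `j = 0` is the extreme monomial; it is split off.
    rw [reflect_T, Finset.sum_range_succ', one_zpow, Units.val_one, map_one, one_mul]
    simp only [smul_eq_C_mul, map_sub]
    push_cast
    rw [zero_sub]
    ring
  rw [e]
  exact sub_mem (neg_mem (Submodule.smul_mem _ _ h1)) (Submodule.smul_mem _ _ h2)

/-- For `x^{-n}` the divided difference is `x^{-n} + … + x^{n-2}`, so the extreme term `(a - a⁻¹)
x^{-n}` stays beside `a x^n`. -/
theorem demazure_T_neg (a b : kˣ) {n : ℕ} (hn : 0 < n) :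
    demazure a b (T (-n)) - (a : k) • T n - ((a : k) - (a⁻¹ : kˣ)) • T (-n) ∈ degLT k n := by
  obtain ⟨n, rfl⟩ := Nat.exists_eq_add_one_of_ne_zero hn.ne'
  have h1 : ∑ j ∈ Finset.range n, (T (2 * ((j + 1 : ℕ) : ℤ) + -(n + 1 : ℕ)) : LaurentPolynomial k) ∈
      degLT k (n + 1) := Submodule.sum_mem _ fun j hj => T_mem_degLT (by
        have := Finset.mem_range.mp hj; omega)
  have h2 : ∑ j ∈ Finset.range (n + 1), (T (1 + (2 * (j : ℤ) + -(n + 1 : ℕ))) : LaurentPolynomial k) ∈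
      degLT k (n + 1) := Submodule.sum_mem _ fun j hj => T_mem_degLT (by
        have := Finset.mem_range.mp hj; omega)
  have e : demazure a b (T (-((n + 1 : ℕ) : ℤ))) - (a : k) • T ((n + 1 : ℕ) : ℤ) -
      ((a : k) - (a⁻¹ : kˣ)) • T (-((n + 1 : ℕ) : ℤ)) =
      (((a : k) - (a⁻¹ : kˣ)) • ∑ j ∈ Finset.range n, T (2 * ((j + 1 : ℕ) : ℤ) + -(n + 1 : ℕ))) +
      ((b : k) - (b⁻¹ : kˣ)) • ∑ j ∈ Finset.range (n + 1), T (1 + (2 * (j : ℤ) + -(n + 1 : ℕ))) := by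
    have hd : divDiff (T (-((n + 1 : ℕ) : ℤ)) : LaurentPolynomial k) =
        ∑ j ∈ Finset.range (n + 1), T (2 * (j : ℤ) + -(n + 1 : ℕ)) := by
      rw [divDiff_T, if_neg (by omega), neg_neg, Int.toNat_natCast]
    have hT : ∑ j ∈ Finset.range (n + 1), (T (1 + (2 * (j : ℤ) + -(n + 1 : ℕ))) : LaurentPolynomial k)
        = T 1 * ∑ j ∈ Finset.range (n + 1), T (2 * (j : ℤ) + -(n + 1 : ℕ)) := by
      rw [Finset.mul_sum]
      exact Finset.sum_congr rfl fun j _ => T_add _ _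
    rw [hT, demazure, LinearMap.add_apply, LinearMap.smul_apply, LinearMap.comp_apply, hd,
      LinearMap.mulLeft_apply]
    change _ • reflect 1 _ + _ - _ - _ = _
    rw [reflect_T, Finset.sum_range_succ', one_zpow, Units.val_one, map_one, one_mul]
    simp only [smul_eq_C_mul, map_sub, neg_neg]
    push_cast
    rw [zero_add]
    ring
  rw [e]
  exact add_mem (Submodule.smul_mem _ _ h1) (Submodule.smul_mem _ _ h2)

theorem demazure_mem_degLT (a b : kˣ) {n : ℕ} {f : LaurentPolynomial k} (hf : f ∈ degLT k n) :
    demazure a b f ∈ degLT k n := by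
  have : degLT k n ≤ (degLT k n).comap (demazure a b) := by
    refine supportedIn_le fun m hm => ?_
    change demazure a b (T m) ∈ degLT k n
    have hm : m.natAbs < n := hm
    have mono : degLT k m.natAbs ≤ degLT k n := supportedIn_mono fun _ h => lt_trans h hm
    have t1 : T (m.natAbs : ℤ) ∈ degLT k n := T_mem_degLT (by omega)
    have t2 : T (-(m.natAbs : ℤ)) ∈ degLT k n := T_mem_degLT (by omega)
    rcases lt_trichotomy m 0 with h | h | h
    · have := mono (demazure_T_neg a b (n := m.natAbs) (by omega))
      rw [← sub_add_cancel (demazure a b (T m)) ((a : k) • T (m.natAbs : ℤ)),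
        ← sub_add_cancel (demazure a b (T m) - _) (((a : k) - (a⁻¹ : kˣ)) • T (-(m.natAbs : ℤ)))]
      have e : -(m.natAbs : ℤ) = m := by omega
      rw [e] at this t2 ⊢
      exact add_mem (add_mem this (Submodule.smul_mem _ _ t2)) (Submodule.smul_mem _ _ t1)
    · have e : demazure a b (T m) = (a : k) • T 0 := by
        rw [h, T_zero, demazure_one, smul_eq_C_mul, mul_one]
      rw [e]
      exact Submodule.smul_mem _ _ (T_mem_degLT (by simpa [h] using hm))
    · have := mono (demazure_T_pos a b (n := m.natAbs) (by omega))
      have e : (m.natAbs : ℤ) = m := by omega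
      rw [← sub_add_cancel (demazure a b (T m)) (((a⁻¹ : kˣ) : k) • T (-(m.natAbs : ℤ)))]
      rw [e] at this t2 ⊢
      exact add_mem this (Submodule.smul_mem _ _ t2)
  exact this hf

theorem reflect_mem_degLT (a : kˣ) {n : ℕ} {f : LaurentPolynomial k} (hf : f ∈ degLT k n) :
    reflect a f ∈ degLT k n := by
  have : degLT k n ≤ (degLT k n).comap (reflect a).toLinearMap := by
    refine supportedIn_le fun m hm => ?_
    have hm : m.natAbs < n := hm
    change reflect a (T m) ∈ degLT k n
    rw [reflect_T, ← smul_eq_C_mul]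
    exact Submodule.smul_mem _ _ (T_mem_degLT (by omega))
  exact this hf

end Demazure


namespace CC

section Eigenvectors

variable {k : Type*} [CommRing k]

/-- The operator `𝕐`. -/
def opY [IsDomain k] (p : Par → kˣ) : Module.End k (LaurentPolynomial k) :=
  (opU0 p * opU1 p : (Module.End k (LaurentPolynomial k))ˣ)

theorem rep_Y_apply [IsDomain k] (p : Par → kˣ) :
    rep p (Y : H) = opY p := congrArg Units.val (rep_Y p)

theorem opY_apply [IsDomain k] (p : Par → kˣ) (f : LaurentPolynomial k) :
    opY p f = reflect (p .q4) (demazure (p .su0) (p .sv0) (reflect (p .q4)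
      (demazure (p .su1) (p .sv1) f))) := rfl

/-- The eigenvalues `(u_0 u_1)^{-sgn(n)/2} q^{-n/2}` of `𝕐`. -/
def eigenvalue (p : Par → kˣ) (n : ℤ) : kˣ := (p .su0 * p .su1) ^ (-sgn n) * p .q4 ^ (-2 * n)

/-- The operator `Û_0` on `𝕏^n`, `n > 0`. -/
theorem opU0_T_pos (p : Par → kˣ) {n : ℕ} (hn : 0 < n) :
    reflect (p .q4) (demazure (p .su0) (p .sv0) (reflect (p .q4) (T n))) -
      ((p .q4 ^ (2 * n : ℤ) * p .su0 : kˣ) : k) • T (-n) -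
      ((p .su0 : k) - ((p .su0)⁻¹ : kˣ)) • T n ∈ degLT k n := by
  have h := (degLT k n).smul_mem ((p .q4 ^ (n : ℤ) : kˣ) : k)
    (reflect_mem_degLT (p .q4) (demazure_T_neg (p .su0) (p .sv0) hn))
  convert h using 1
  rw [reflect_T, ← smul_eq_C_mul]
  simp only [map_sub, map_smul, reflect_T, ← smul_eq_C_mul, smul_sub, smul_smul, neg_neg]
  congr 2
  · congr 1
    rw [← Units.val_mul, ← Units.val_mul, ← mul_assoc, mul_right_comm, ← zpow_add]
    congr 3; ring
  · rw [mul_comm, mul_assoc, ← Units.val_mul, ← zpow_add]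
    simp

/-- The operator `Û_0` on `𝕏^{-n}`, `n > 0`. -/
theorem opU0_T_neg (p : Par → kˣ) {n : ℕ} (hn : 0 < n) :
    reflect (p .q4) (demazure (p .su0) (p .sv0) (reflect (p .q4) (T (-n)))) -
      ((p .q4 ^ (-2 * n : ℤ) * (p .su0)⁻¹ : kˣ) : k) • T n ∈ degLT k n := by
  have h := (degLT k n).smul_mem ((p .q4 ^ (-n : ℤ) : kˣ) : k)
    (reflect_mem_degLT (p .q4) (demazure_T_pos (p .su0) (p .sv0) hn))
  convert h using 1
  rw [reflect_T, ← smul_eq_C_mul]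
  simp only [map_sub, map_smul, reflect_T, ← smul_eq_C_mul, smul_sub, smul_smul, neg_neg]
  congr 2
  rw [← Units.val_mul, ← Units.val_mul, ← mul_assoc, mul_right_comm, ← zpow_add]
  congr 3; ring

/-- Modulo exponents smaller in absolute value, `Û_1` and then `Û_0` send `𝕏^n` (`n > 0`) to
`𝕏^{-n}` and back, producing the eigenvalue and no term `𝕏^{-n}`. Starting from `𝕏^{-n}` a multiple
of `𝕏^n` appears as well, and it is lower because the order puts `n` before `-n`. -/
theorem opY_isTriangular [IsDomain k] (p : Par → kˣ) :
    IsTriangular (opY p) (fun n => (eigenvalue p n : k)) := by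
  intro n
  have hle : ∀ {n : ℕ} {m : ℤ}, n ≤ m.natAbs → degLT k n ≤ lowerSpan k (ord m) := fun h =>
    supportedIn_mono fun i hi => by
      have hi : i.natAbs < _ := hi
      change ord i < _
      unfold ord
      split_ifs <;> omega
  have hU0 : ∀ {n : ℕ} {f}, f ∈ degLT k n →
      reflect (p .q4) (demazure (p .su0) (p .sv0) (reflect (p .q4) f)) ∈ degLT k n := fun h =>
    reflect_mem_degLT _ (demazure_mem_degLT _ _ (reflect_mem_degLT _ h))
  rw [opY_apply]
  beta_reduce
  rcases lt_trichotomy n 0 with h | h | h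
  · obtain ⟨n, rfl⟩ : ∃ m : ℕ, n = -m := ⟨n.natAbs, by omega⟩
    have hn : 0 < n := by omega
    have e1 := hU0 (demazure_T_neg (p .su1) (p .sv1) hn)
    have e2 := opU0_T_pos p hn
    have e3 := opU0_T_neg p hn
    have hT : T (n : ℤ) ∈ lowerSpan k (ord (-n)) := T_mem_lowerSpan (by
      unfold ord; split_ifs <;> omega)
    have hle := hle (n := n) (m := -n) (by omega)
    -- `Û_1` gives `u_1^{1/2} 𝕏^n + (u_1^{1/2} - u_1^{-1/2}) 𝕏^{-n}`. The operator `Û_0` is applied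
    -- to both terms, and the two resulting multiples of `𝕏^n` are put among the lower terms.
    have := add_mem (add_mem (hle (add_mem (add_mem e1 ((degLT k n).smul_mem (p .su1 : k) e2))
        ((degLT k n).smul_mem ((p .su1 : k) - ((p .su1)⁻¹ : kˣ)) e3)))
        (Submodule.smul_mem _ ((p .su1 : k) * ((p .su0 : k) - ((p .su0)⁻¹ : kˣ))) hT))
      (Submodule.smul_mem _ (((p .su1 : k) - ((p .su1)⁻¹ : kˣ)) *
        ((p .q4 ^ (-2 * n : ℤ) * (p .su0)⁻¹ : kˣ) : k)) hT)
    have ev : (eigenvalue p (-n) : k) = p .su1 * ((p .q4 ^ (2 * n : ℤ) * p .su0 : kˣ) : k) := by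
      rw [← Units.val_mul, eigenvalue, sgn, if_neg (by omega), neg_neg, zpow_one]
      congr 1
      rw [neg_mul_neg, mul_comm (p .q4 ^ _), ← mul_assoc, mul_comm (p .su1)]
    convert this using 1
    rw [ev]
    simp only [map_sub, map_smul, smul_sub, smul_smul]
    abel
  · subst h
    have e : reflect (p .q4) (demazure (p .su0) (p .sv0) (reflect (p .q4)
        (demazure (p .su1) (p .sv1) (T 0)))) - (eigenvalue p 0 : k) • T 0 = 0 := by
      have hC : (C (p .su1 : k) : LaurentPolynomial k) = (p .su1 : k) • 1 := by
        rw [smul_eq_C_mul, mul_one]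
      rw [T_zero, demazure_one, reflect_C, hC, map_smul, demazure_one, map_smul, reflect_C,
        smul_eq_C_mul, smul_eq_C_mul, mul_one, ← map_mul, eigenvalue, sgn, if_neg (lt_irrefl 0)]
      simp [mul_comm]
    rw [e]
    exact zero_mem _
  · obtain ⟨n, rfl⟩ : ∃ m : ℕ, n = m := ⟨n.natAbs, by omega⟩
    have hn : 0 < n := by omega
    have e1 := hU0 (demazure_T_pos (p .su1) (p .sv1) hn)
    have e3 := opU0_T_neg p hn
    refine hle (n := n) (by omega) ?_
    have := add_mem e1 ((degLT k n).smul_mem (((p .su1)⁻¹ : kˣ) : k) e3)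
    convert this using 1
    simp only [map_sub, map_smul, smul_sub, smul_smul, sub_add_sub_cancel]
    congr 2
    rw [← Units.val_mul, eigenvalue, sgn, if_pos h]
    congr 1
    rw [zpow_neg, zpow_one, mul_inv, mul_comm (p .q4 ^ _), ← mul_assoc, mul_comm (p .su1)⁻¹]

end Eigenvectors

end CC

end

section

open LaurentPolynomial

/-! ### Base change -/

section BaseChange

variable {k l : Type*} [CommRing k] [CommRing l] (φ : k →+* l)

/-- Base change of Laurent polynomials. -/
abbrev baseChange : LaurentPolynomial k →+* LaurentPolynomial l := AddMonoidAlgebra.mapRingHom ℤ φ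

/-- Base change of an invertible element. -/
abbrev mapUnit (a : kˣ) : lˣ := Units.map (φ : k →* l) a

theorem baseChange_T (n : ℤ) : baseChange φ (T n) = T n :=
  (AddMonoidAlgebra.mapRingHom_single _ _ _).trans (by rw [map_one]; rfl)

theorem baseChange_C (a : k) : baseChange φ (C a) = C (φ a) :=
  AddMonoidAlgebra.mapRingHom_single _ _ _

theorem baseChange_smul (a : k) (f : LaurentPolynomial k) :
    baseChange φ (a • f) = φ a • baseChange φ f := by
  rw [smul_eq_C_mul, smul_eq_C_mul, map_mul, baseChange_C]

theorem coeff_baseChange (f : LaurentPolynomial k) (m : ℤ) :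
    (baseChange φ f).coeff m = φ (f.coeff m) := AddMonoidAlgebra.coeff_mapRingHom _ _ _

/-- An operator given on monomials by a formula with universal coefficients commutes with every
change of coefficients. The operator `𝕐` will be compared in this way over the localization and over
the two fields. -/
theorem baseChange_linearMap {L : LaurentPolynomial k →ₗ[k] LaurentPolynomial k}
    {M : LaurentPolynomial l →ₗ[l] LaurentPolynomial l}
    (h : ∀ n, baseChange φ (L (T n)) = M (T n)) (f : LaurentPolynomial k) :
    baseChange φ (L f) = M (baseChange φ f) := by
  induction f using LaurentPolynomial.induction_on' with
  | add p q hp hq => simp only [map_add, hp, hq]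
  | C_mul_T n a =>
    rw [← smul_eq_C_mul, map_smul, baseChange_smul, baseChange_smul, map_smul, h, baseChange_T]

theorem baseChange_reflect (a : kˣ) (f : LaurentPolynomial k) :
    baseChange φ (reflect a f) = reflect (mapUnit φ a) (baseChange φ f) := by
  refine baseChange_linearMap φ (L := (reflect a).toLinearMap)
    (M := (reflect (mapUnit φ a)).toLinearMap) (fun n => ?_) f
  change baseChange φ (reflect a (T n)) = reflect _ (T n)
  rw [reflect_T, reflect_T, map_mul, baseChange_C, baseChange_T, ← map_zpow]
  rfl

theorem baseChange_divDiff (f : LaurentPolynomial k) :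
    baseChange φ (divDiff f) = divDiff (baseChange φ f) := by
  refine baseChange_linearMap φ (fun n => ?_) f
  rw [divDiff_T, divDiff_T]
  split_ifs
  · rw [map_neg, map_sum]; simp only [baseChange_T]
  · rw [map_sum]; simp only [baseChange_T]

theorem baseChange_demazure (a b : kˣ) (f : LaurentPolynomial k) :
    baseChange φ (demazure a b f) = demazure (mapUnit φ a) (mapUnit φ b) (baseChange φ f) := by
  simp only [demazure, LinearMap.add_apply, LinearMap.smul_apply, LinearMap.comp_apply,
    LinearMap.mulLeft_apply, map_add, map_mul, baseChange_divDiff, baseChange_C, baseChange_T,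
    baseChange_smul, map_sub]
  congr 2
  exact (baseChange_reflect φ 1 f).trans (by rw [mapUnit, map_one]; rfl)

theorem CC.baseChange_opY [IsDomain k] [IsDomain l] (p : CC.Par → kˣ) (f : LaurentPolynomial k) :
    baseChange φ (CC.opY p f) = CC.opY (fun i => mapUnit φ (p i)) (baseChange φ f) := by
  simp only [CC.opY_apply, baseChange_reflect, baseChange_demazure]

theorem CC.eigenvalue_map (p : CC.Par → kˣ) (n : ℤ) :
    CC.eigenvalue (fun i => mapUnit φ (p i)) n = mapUnit φ (CC.eigenvalue p n) := by
  simp [CC.eigenvalue]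

theorem eval₂_baseChange {m : Type*} [CommRing m] (ψ : l →+* m) (x : mˣ) (f : LaurentPolynomial k) :
    eval₂ ψ x (baseChange φ f) = eval₂ (ψ.comp φ) x f := by
  induction f using LaurentPolynomial.induction_on' with
  | add p q hp hq => simp only [map_add, hp, hq]
  | C_mul_T n a =>
    rw [map_mul, baseChange_C, baseChange_T, map_mul, map_mul, eval₂_C, eval₂_C, eval₂_T, eval₂_T]
    rfl

theorem map_eval₂ {m n : Type*} [CommRing m] [CommRing n] (φ : m →+* n) (ψ : k →+* m) (x : mˣ)
    (f : LaurentPolynomial k) : φ (eval₂ ψ x f) = eval₂ (φ.comp ψ) (mapUnit φ x) f := by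
  induction f using LaurentPolynomial.induction_on' with
  | add p q hp hq => simp only [map_add, hp, hq]
  | C_mul_T n a =>
    rw [map_mul, map_mul, map_mul, eval₂_C, eval₂_C, eval₂_T, eval₂_T, ← map_zpow]
    rfl

end BaseChange

/-! ### Normalized eigenvectors of `𝕐` -/

/-- `f` is an eigenvector of `𝕐` with the eigenvalue number `n`, lies in the span of the
monomials up to `𝕏^n`, and has the coefficient `1` of `𝕏^n`. -/
structure CC.IsEigen {k : Type*} [CommRing k] [IsDomain k] (p : CC.Par → kˣ) (n : ℤ)
    (f : LaurentPolynomial k) : Prop where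
  mem : f ∈ lowerSpan k (ord n + 1)
  eigen : CC.opY p f = (CC.eigenvalue p n : k) • f
  coeff_eq_one : f.coeff n = 1

theorem CC.IsEigen.baseChange {k l : Type*} [CommRing k] [IsDomain k] [CommRing l] [IsDomain l]
    (φ : k →+* l) {p : CC.Par → kˣ} {n : ℤ} {f : LaurentPolynomial k} (h : CC.IsEigen p n f) :
    CC.IsEigen (fun i => mapUnit φ (p i)) n (baseChange φ f) where
  mem m hm := by rw [coeff_baseChange, h.mem m hm, map_zero]
  eigen := by rw [← CC.baseChange_opY, h.eigen, baseChange_smul, CC.eigenvalue_map]; rfl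
  coeff_eq_one := by rw [coeff_baseChange, h.coeff_eq_one, map_one]

theorem CC.isE_iff (n : ℤ) (f : LaurentPolynomial CC.K) : CC.IsE n f ↔ CC.IsEigen CC.par n f := by
  have key : f.coeff n = 1 → ((0 < n → f.coeff (-n) = 0) ∧ (∀ m, |n| < |m| → f.coeff m = 0) ↔
      f ∈ lowerSpan CC.K (ord n + 1)) := by
    intro h1
    constructor
    · rintro ⟨h2, h3⟩ m hm
      have hm : ¬ ord m < ord n + 1 := hm
      by_cases hmn : |n| < |m|
      · exact h3 m hmn
      · simp only [Int.abs_eq_natAbs] at hmn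
        -- The only exponent with `|m| ≤ |n|` that comes after `n` is `-n`, for positive `n`; this
        -- is the exponent excluded separately in the definition of `𝓔_n`.
        have : 0 < n ∧ m = -n := by
          unfold ord at hm
          split_ifs at hm <;> omega
        rw [this.2, h2 this.1]
    · intro h
      refine ⟨fun hn => h _ fun hm => ?_, fun m hmn => h _ fun hm => ?_⟩
      · have hm : ord (-n) < ord n + 1 := hm
        unfold ord at hm
        split_ifs at hm <;> omega
      · have hm : ord m < ord n + 1 := hm
        simp only [Int.abs_eq_natAbs] at hmn
        unfold ord at hm
        split_ifs at hm <;> omega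
  constructor
  · rintro ⟨h1, h2, h3⟩
    rw [CC.rep_Y_apply] at h1
    exact ⟨(key h2).mp h3, h1, h2⟩
  · rintro ⟨h1, h2, h3⟩
    refine ⟨?_, h3, (key h3).mpr h1⟩
    rw [CC.rep_Y_apply]
    exact h2

/-! ### Specializations -/

section Specialization

variable {A B : Type*} [CommRing A] [CommRing B] (σ : A →+* B)

/-- The elements which do not vanish under a specialization. -/
def denominators : Submonoid A := (nonZeroDivisors B).comap σ

theorem mem_denominators [IsDomain B] {d : A} : d ∈ denominators σ ↔ σ d ≠ 0 :=
  mem_nonZeroDivisors_iff_ne_zero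

theorem denominators_le [IsDomain A] [IsDomain B] : denominators σ ≤ nonZeroDivisors A :=
  fun d hd => by
  rw [mem_nonZeroDivisors_iff_ne_zero]
  rintro rfl
  exact (mem_denominators σ).mp hd (map_zero σ)

/-- The ring of fractions to which a specialization extends. -/
abbrev SpecRing : Type _ := Localization (denominators σ)

instance [IsDomain A] [IsDomain B] : IsDomain (SpecRing σ) :=
  IsLocalization.isDomain_localization (denominators_le σ)

/-- The inclusion into the field of fractions. -/
def specIncl [IsDomain A] [IsDomain B] : SpecRing σ →+* FractionRing A :=
  IsLocalization.map (FractionRing A) (RingHom.id A)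
    (show denominators σ ≤ (nonZeroDivisors A).comap (RingHom.id A) from denominators_le σ)

/-- The specialization of fractions. -/
def specMap : SpecRing σ →+* FractionRing B :=
  IsLocalization.map (FractionRing B) σ (le_refl (denominators σ))

theorem specIncl_algebraMap [IsDomain A] [IsDomain B] (a : A) :
    specIncl σ (algebraMap A (SpecRing σ) a) = algebraMap A (FractionRing A) a :=
  IsLocalization.map_eq _ _

theorem specMap_algebraMap (a : A) :
    specMap σ (algebraMap A (SpecRing σ) a) = algebraMap B (FractionRing B) (σ a) :=
  IsLocalization.map_eq _ _

/-- An element of the localization is a fraction with an admissible denominator, and its two images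
are this fraction and the specialized one. A specialization statement therefore follows from any
construction over `SpecRing σ`. -/
theorem specializesTo_of_specRing [IsDomain A] [IsDomain B] (x : SpecRing σ) :
    SpecializesTo σ (specIncl σ x) (specMap σ x) := by
  obtain ⟨a, d, rfl⟩ := IsLocalization.exists_mk'_eq (denominators σ) x
  have hd : σ d ≠ 0 := (mem_denominators σ).mp d.2
  refine ⟨a, d, hd, ?_, ?_⟩
  · rw [eq_div_iff, ← specIncl_algebraMap σ, ← map_mul, IsLocalization.mk'_spec, specIncl_algebraMap]
    intro h
    exact hd (by rw [(IsFractionRing.injective A (FractionRing A)) (h.trans (map_zero _).symm),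
      map_zero])
  · rw [eq_div_iff, ← specMap_algebraMap σ, ← map_mul, IsLocalization.mk'_spec, specMap_algebraMap]
    intro h
    exact hd ((IsFractionRing.injective B (FractionRing B)) (h.trans (map_zero _).symm))

theorem isUnit_algebraMap_specRing [IsDomain B] {a : A} (h : σ a ≠ 0) :
    IsUnit (algebraMap A (SpecRing σ) a) :=
  IsLocalization.map_units (SpecRing σ) (⟨a, (mem_denominators σ).mpr h⟩ : denominators σ)

end Specialization

/-! ### Eigenvectors over the localization of the parameter ring -/

/-- The specialized parameters as elements of the field of fractions. -/
def specPar (p : CC.Par → A1.Zˣ) (i : CC.Par) : A1.Kˣ := mapUnit (algebraMap A1.Z A1.K) (p i)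

/-- Distinct eigenvalues of `𝕐` stay distinct under a specialization which is injective on powers of
`q`. -/
theorem CC.exists_eigen_specialization (p : CC.Par → A1.Zˣ)
    (hp : ∀ m n : ℤ, m ≠ n → (CC.eigenvalue p m : A1.Z) - CC.eigenvalue p n ≠ 0) (n : ℤ) :
    ∃ f : LaurentPolynomial (SpecRing (Params.subst p : CC.Z →+* A1.Z)),
      CC.IsEigen CC.par n (baseChange (specIncl _) f) ∧
      CC.IsEigen (specPar p) n (baseChange (specMap _) f) := by
  set σ : CC.Z →+* A1.Z := Params.subst p
  set q : CC.Par → (SpecRing σ)ˣ := fun i => mapUnit (algebraMap CC.Z (SpecRing σ)) (Params.var i)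
  have hσ : (fun i => mapUnit σ (Params.var i)) = p := funext fun i => Params.map_subst_var p i
  -- A difference of eigenvalues lies in `ℤ_{q,u,v}` and is not killed by `σ`, so it is a unit in
  -- the localization.
  obtain ⟨f, h1, h2, h3⟩ := (CC.opY_isTriangular q).exists_eigenvector n (fun m hm => by
    have e : ((CC.eigenvalue q m : (SpecRing σ)ˣ) : SpecRing σ) - CC.eigenvalue q n =
        algebraMap CC.Z (SpecRing σ) ((CC.eigenvalue Params.var m : CC.Zˣ) -
          (CC.eigenvalue Params.var n : CC.Zˣ)) := by
      rw [map_sub, CC.eigenvalue_map, CC.eigenvalue_map]; rfl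
    rw [e]
    refine isUnit_algebraMap_specRing σ ?_
    have hmn : m ≠ n := by rintro rfl; exact lt_irrefl _ hm
    convert hp m n hmn using 1
    rw [map_sub, ← hσ, CC.eigenvalue_map, CC.eigenvalue_map]; rfl)
  have hf : CC.IsEigen q n f := ⟨h1, h2, h3⟩
  -- The same `f` is mapped to both fields; its defining properties survive base change.
  refine ⟨f, ?_, ?_⟩
  · convert hf.baseChange (specIncl σ) using 1
    funext i
    ext
    exact (specIncl_algebraMap σ _).symm
  · convert hf.baseChange (specMap σ) using 1
    funext i
    ext
    refine Eq.trans ?_ (specMap_algebraMap σ _).symm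
    rw [← hσ]
    rfl

/-! ### Comparison of the specialized `𝕐` with `Y` and `Y²`, and distinctness of the eigenvalues -/

theorem demazure_one_one {k : Type*} [CommRing k] (f : LaurentPolynomial k) :
    demazure 1 1 f = reflect 1 f := by
  simp [demazure]

theorem A1.rep_Y_apply {k : Type*} [CommRing k] [IsDomain k] (p : A1.Par → kˣ)
    (f : LaurentPolynomial k) :
    A1.rep p (A1.Y : A1.H) f = reflect (p .q4 ^ 2) (demazure (p .st) 1 f) :=
  congrArg (fun u : (Module.End k (LaurentPolynomial k))ˣ => u.1 f) (A1.rep_Y p)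

theorem specPar_eq_one {p : CC.Par → A1.Zˣ} {i : CC.Par} (h : p i = 1) : specPar p i = 1 := by
  rw [specPar, h, mapUnit, map_one]

/-- With `u_0 = v_0 = 1` the operator `Û_0` is the reflection `s_0`, which is `π`, and with `v_1 =
1` the operator `Û_1` is `T`. -/
theorem A1.opY_par1 (f : LaurentPolynomial A1.K) :
    CC.opY (specPar par1) f = A1.rep A1.par (A1.Y : A1.H) f := by
  have h0 : specPar par1 .su0 = 1 := specPar_eq_one rfl
  have h1 : specPar par1 .sv0 = 1 := specPar_eq_one rfl
  have h2 : specPar par1 .sv1 = 1 := specPar_eq_one rfl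
  rw [CC.opY_apply, h0, h1, h2, demazure_one_one, reflect_conj, A1.rep_Y_apply]
  rfl

/-- After `q^{1/4} ↦ q^{1/2}` the reflection that conjugates `Û_0` is `π` itself, so `Û_0 = π T π`
and `𝕐 = π T π T`. -/
theorem A1.opY_par2 (f : LaurentPolynomial A1.K) : CC.opY (specPar par2) f =
    A1.rep A1.par (A1.Y : A1.H) (A1.rep A1.par (A1.Y : A1.H) f) := by
  have h1 : specPar par2 .sv0 = 1 := specPar_eq_one rfl
  have h2 : specPar par2 .sv1 = 1 := specPar_eq_one rfl
  have h3 : specPar par2 .q4 = A1.par .q4 ^ 2 := map_pow _ _ _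
  rw [CC.opY_apply, h1, h2, h3, A1.rep_Y_apply, A1.rep_Y_apply]
  rfl

/-- The eigenvalues `t^{-sgn(n)/2} q^{-n/2}` of `Y`. -/
def A1.eigenvalue (n : ℤ) : A1.Kˣ := A1.par .st ^ (-sgn n) * A1.par .q4 ^ (-2 * n)

theorem A1.eigenvalue_par1 (n : ℤ) : CC.eigenvalue (specPar par1) n = A1.eigenvalue n := by
  rw [CC.eigenvalue, specPar_eq_one (i := .su0) rfl, one_mul]
  rfl

theorem A1.eigenvalue_par2 (n : ℤ) :
    CC.eigenvalue (specPar par2) n = A1.eigenvalue n * A1.eigenvalue n := by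
  have h3 : specPar par2 .q4 = A1.par .q4 ^ 2 := map_pow _ _ _
  have h4 : specPar par2 .su0 = A1.par .st := rfl
  have h5 : specPar par2 .su1 = A1.par .st := rfl
  rw [CC.eigenvalue, h3, h4, h5, A1.eigenvalue, mul_zpow, mul_mul_mul_comm, sq, mul_zpow]

/-- The homomorphism `q^{1/4} ↦ 2`, `t^{1/2} ↦ 1`, which is used to show that a Laurent polynomial
in the parameters is not zero. -/
def evalTwo : A1.Z →+* ℚ := Params.subst fun | .q4 => Units.mk0 2 two_ne_zero | .st => 1

theorem evalTwo_st : mapUnit evalTwo (Params.var A1.Par.st) = 1 := Params.map_subst_var _ _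

theorem evalTwo_q4 : mapUnit evalTwo (Params.var A1.Par.q4) = Units.mk0 2 two_ne_zero :=
  Params.map_subst_var _ _

/-- At `t = 1` and `q^{1/4} = 2` the eigenvalues are distinct powers of `2`, so no difference can
vanish identically. -/
theorem eigenvalue_par1_sub_ne_zero (m n : ℤ) (h : m ≠ n) :
    (CC.eigenvalue par1 m : A1.Z) - CC.eigenvalue par1 n ≠ 0 := by
  have key : ∀ n : ℤ, evalTwo (CC.eigenvalue par1 n) = (2 : ℚ) ^ (-2 * n) := fun n => by
    change ((mapUnit evalTwo (CC.eigenvalue par1 n) : ℚˣ) : ℚ) = _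
    simp [CC.eigenvalue, par1, evalTwo_st, evalTwo_q4]
  intro h0
  have := congrArg evalTwo h0
  rw [map_sub, key, key, map_zero, sub_eq_zero, zpow_right_inj₀ two_pos (by norm_num)] at this
  omega

theorem eigenvalue_par2_sub_ne_zero (m n : ℤ) (h : m ≠ n) :
    (CC.eigenvalue par2 m : A1.Z) - CC.eigenvalue par2 n ≠ 0 := by
  have key : ∀ n : ℤ, evalTwo (CC.eigenvalue par2 n) = (2 : ℚ) ^ (2 * (-2 * n)) := fun n => by
    change ((mapUnit evalTwo (CC.eigenvalue par2 n) : ℚˣ) : ℚ) = _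
    simp [CC.eigenvalue, par2, evalTwo_st, evalTwo_q4, zpow_mul]
  intro h0
  have := congrArg evalTwo h0
  rw [map_sub, key, key, map_zero, sub_eq_zero, zpow_right_inj₀ two_pos (by norm_num)] at this
  omega

theorem specPar_eigenvalue_ne {p : CC.Par → A1.Zˣ}
    (hp : ∀ m n : ℤ, m ≠ n → (CC.eigenvalue p m : A1.Z) - CC.eigenvalue p n ≠ 0) (m n : ℤ)
    (h : m ≠ n) : (CC.eigenvalue (specPar p) m : A1.K) ≠ CC.eigenvalue (specPar p) n := by
  have e : ∀ n, (CC.eigenvalue (specPar p) n : A1.K) =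
      algebraMap A1.Z A1.K (CC.eigenvalue p n : A1.Z) := fun n =>
    congrArg Units.val (CC.eigenvalue_map (algebraMap A1.Z A1.K) p n)
  rw [e, e]
  exact fun h' => hp m n h (sub_eq_zero.mpr (IsFractionRing.injective A1.Z A1.K h'))

/-- An equality of generic eigenvalues would persist under `σ_1`, where they are known to differ. -/
theorem par_eigenvalue_ne (m n : ℤ) (h : m ≠ n) :
    (CC.eigenvalue CC.par m : CC.K) ≠ CC.eigenvalue CC.par n := by
  have e : ∀ n, (CC.eigenvalue CC.par n : CC.K) =
      algebraMap CC.Z CC.K (CC.eigenvalue Params.var n : CC.Zˣ) := fun n =>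
    congrArg Units.val (CC.eigenvalue_map (algebraMap CC.Z CC.K) Params.var n)
  have hσ : (fun i => mapUnit (Params.subst par1 : CC.Z →+* A1.Z) (Params.var i)) = par1 :=
    funext fun i => Params.map_subst_var par1 i
  rw [e, e]
  intro h'
  have h2 := congrArg (Params.subst par1) (IsFractionRing.injective CC.Z CC.K h')
  refine eigenvalue_par1_sub_ne_zero m n h (sub_eq_zero.mpr ?_)
  rw [← hσ, CC.eigenvalue_map, CC.eigenvalue_map]
  exact h2

/-! ### Existence, uniqueness and specialization of `𝓔_n` and `E_n` -/

theorem CC.isE_unique {n : ℤ} {f g : LaurentPolynomial CC.K} (hf : CC.IsE n f) (hg : CC.IsE n g) :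
    f = g := by
  rw [CC.isE_iff] at hf hg
  exact (CC.opY_isTriangular CC.par).eigenvector_unique n (fun m h => par_eigenvalue_ne m n h)
    hf.eigen hf.coeff_eq_one hg.eigen hg.coeff_eq_one

/-- `Y` is the specialization of `𝕐` under `σ_1`, hence triangular with distinct diagonal entries.
-/
theorem A1.isE_unique {n : ℤ} {f g : LaurentPolynomial A1.K} (hf : A1.IsE n f) (hg : A1.IsE n g) :
    f = g := by
  refine (CC.opY_isTriangular (specPar par1)).eigenvector_unique n
    (fun m h => specPar_eigenvalue_ne eigenvalue_par1_sub_ne_zero m n h) ?_ hf.2 ?_ hg.2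
  · rw [A1.opY_par1, hf.1, A1.eigenvalue_par1]; rfl
  · rw [A1.opY_par1, hg.1, A1.eigenvalue_par1]; rfl

theorem A1.isE_of_isEigen {n : ℤ} {f : LaurentPolynomial A1.K}
    (h : CC.IsEigen (specPar par1) n f) : A1.IsE n f := by
  refine ⟨?_, h.coeff_eq_one⟩
  rw [← A1.opY_par1, h.eigen, A1.eigenvalue_par1]; rfl

theorem CC.existsUnique_isE (n : ℤ) : ∃! f, CC.IsE n f := by
  obtain ⟨f, hf, -⟩ := CC.exists_eigen_specialization par1 eigenvalue_par1_sub_ne_zero n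
  have h := (CC.isE_iff _ _).mpr hf
  exact ⟨_, h, fun g hg => CC.isE_unique hg h⟩

theorem A1.exists_isEigen (n : ℤ) : ∃ f, CC.IsEigen (specPar par1) n f := by
  obtain ⟨f, -, hf⟩ := CC.exists_eigen_specialization par1 eigenvalue_par1_sub_ne_zero n
  exact ⟨_, hf⟩

theorem A1.existsUnique_isE (n : ℤ) : ∃! f, A1.IsE n f := by
  obtain ⟨f, hf⟩ := A1.exists_isEigen n
  exact ⟨f, A1.isE_of_isEigen hf, fun g hg => A1.isE_unique hg (A1.isE_of_isEigen hf)⟩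

/-- The polynomial `E_n` is also the eigenvector of the operator `Y²`. -/
theorem A1.isE_of_isEigen_par2 {n : ℤ} {f : LaurentPolynomial A1.K}
    (h : CC.IsEigen (specPar par2) n f) : A1.IsE n f := by
  obtain ⟨g, hg, -⟩ := A1.existsUnique_isE n
  have hY : A1.rep A1.par (A1.Y : A1.H) g = (A1.eigenvalue n : A1.K) • g := hg.1
  -- `E_n` is an eigenvector of `Y²` for the squared eigenvalue. These squares are still distinct,
  -- so it coincides with the normalized eigenvector `f` of `Y²`.
  have : f = g := by
    refine (CC.opY_isTriangular (specPar par2)).eigenvector_unique n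
      (fun m h => specPar_eigenvalue_ne eigenvalue_par2_sub_ne_zero m n h) h.eigen h.coeff_eq_one
      ?_ hg.2
    rw [A1.opY_par2, hY, map_smul, hY, smul_smul, A1.eigenvalue_par2]; rfl
  rwa [this]

/-- Common to both substitutions: by uniqueness `𝓔_n` and `E_n` are the two images of one polynomial
over the localization. Its coefficients, and its value at `(u_1 v_1)^{-1/2}`, lie in the
localization and hence specialize. -/
theorem specializes_of_isEigen (p : CC.Par → A1.Zˣ) (hsu1 : p .su1 = Params.var .st)
    (hsv1 : p .sv1 = 1)
    (hp : ∀ m n : ℤ, m ≠ n → (CC.eigenvalue p m : A1.Z) - CC.eigenvalue p n ≠ 0) (n : ℤ)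
    (hE : ∀ g, CC.IsEigen (specPar p) n g → A1.IsE n g)
    {f : LaurentPolynomial CC.K} {g : LaurentPolynomial A1.K} (hf : CC.IsE n f) (hg : A1.IsE n g) :
    PolySpecializesTo (Params.subst p : CC.Z →+* A1.Z) f g ∧
      SpecializesTo (Params.subst p : CC.Z →+* A1.Z) (CC.value f) (A1.value g) := by
  obtain ⟨r, h1, h2⟩ := CC.exists_eigen_specialization p hp n
  obtain rfl := CC.isE_unique ((CC.isE_iff _ _).mpr h1) hf
  obtain rfl := A1.isE_unique (hE _ h2) hg
  clear hf hg h1 h2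
  have hv : ∀ i, mapUnit (Params.subst p : CC.Z →+* A1.Z) (Params.var i) = p i :=
    Params.map_subst_var p
  generalize (Params.subst p : CC.Z →+* A1.Z) = σ at *
  constructor
  · intro m
    rw [coeff_baseChange, coeff_baseChange]
    exact specializesTo_of_specRing σ _
  · set x : (SpecRing σ)ˣ := mapUnit (algebraMap CC.Z (SpecRing σ))
      (Params.var CC.Par.su1 * Params.var CC.Par.sv1)⁻¹
    have e1 : CC.value (baseChange (specIncl σ) r) = specIncl σ (eval₂ (RingHom.id _) x r) := by
      rw [CC.value, eval₂_baseChange, map_eval₂]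
      congr 2
      change _ = mapUnit (specIncl σ) (mapUnit (algebraMap CC.Z (SpecRing σ)) _)
      simp only [mapUnit, map_inv, map_mul]
      congr 2 <;> exact Units.ext (specIncl_algebraMap σ _).symm
    have e2 : A1.value (baseChange (specMap σ) r) = specMap σ (eval₂ (RingHom.id _) x r) := by
      rw [A1.value, eval₂_baseChange, map_eval₂]
      congr 2
      change _ = mapUnit (specMap σ) (mapUnit (algebraMap CC.Z (SpecRing σ)) _)
      simp only [mapUnit, map_inv, map_mul]
      have e : ∀ i, mapUnit (specMap σ) (mapUnit (algebraMap CC.Z (SpecRing σ)) (Params.var i)) =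
          specPar p i := fun i => Units.ext ((specMap_algebraMap σ _).trans (by
            rw [specPar, ← hv]; rfl))
      simp only [mapUnit] at e
      rw [e, e, specPar_eq_one hsv1, mul_one, specPar, hsu1]
      rfl
    rw [e1, e2]
    exact specializesTo_of_specRing σ _

end

section

open LaurentPolynomial

/-! ### The evaluation formula -/

/-- At `x = a⁻¹`, where `1 - a² x²` vanishes, a Demazure-Lusztig operator acts as the scalar `a`. -/
theorem eval₂_demazure_one {k : Type*} [CommRing k] [IsDomain k] (a : kˣ)
    (f : LaurentPolynomial k) :
    eval₂ (RingHom.id k) a⁻¹ (demazure a 1 f) = a * eval₂ (RingHom.id k) a⁻¹ f := by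
  have h : (a : k) * ((a⁻¹ : kˣ) : k) = 1 := a.mul_inv
  have hT : (T 2 : LaurentPolynomial k) = T 1 * T 1 := by rw [← T_add]; rfl
  simp only [demazure_eq, hT, map_add, map_mul, map_sub, eval₂_C, eval₂_T, map_one, zpow_one,
    RingHom.id_apply, inv_one, sub_self, zero_mul, add_zero]
  linear_combination (eval₂ (RingHom.id k) a⁻¹ (divDiff f)) * ((a⁻¹ : kˣ) : k) * h

/-- The coefficients of a polynomial multiplied by `x`. -/
theorem coeff_T_one_mul {k : Type*} [CommRing k] (f : LaurentPolynomial k) (m : ℤ) :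
    (T 1 * f).coeff (m + 1) = f.coeff m := by
  induction f using LaurentPolynomial.induction_on' with
  | add p q hp hq => rw [mul_add, coeff_add', coeff_add', hp, hq]
  | C_mul_T n a =>
    rw [mul_left_comm, ← T_add, ← smul_eq_C_mul, ← smul_eq_C_mul, coeff_smul', coeff_smul',
      coeff_T, coeff_T, add_comm 1 n]
    simp only [add_left_inj]

theorem coeff_reflect {k : Type*} [CommRing k] (a : kˣ) (f : LaurentPolynomial k) (m : ℤ) :
    (reflect a f).coeff m = ((a ^ (-m) : kˣ) : k) * f.coeff (-m) := by
  induction f using LaurentPolynomial.induction_on' with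
  | add p q hp hq => rw [map_add, coeff_add', coeff_add', hp, hq, mul_add]
  | C_mul_T n c =>
    rw [← smul_eq_C_mul, map_smul, reflect_T, ← smul_eq_C_mul, coeff_smul', coeff_smul',
      coeff_smul', coeff_T, coeff_T]
    by_cases h : n = -m
    · subst h; simp [mul_comm]
    · rw [if_neg h, if_neg (by omega)]; simp

namespace A1

theorem value_smul (c : K) (f : LaurentPolynomial K) : value (c • f) = c * value f := by
  rw [value, smul_eq_C_mul, map_mul, eval₂_C]; rfl

theorem value_add (f g : LaurentPolynomial K) : value (f + g) = value f + value g := map_add _ _ _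

theorem value_T_one_mul (f : LaurentPolynomial K) :
    value (LaurentPolynomial.T 1 * f) = ((par .st)⁻¹ : Kˣ) * value f := by
  rw [value, map_mul, eval₂_T, zpow_one]; rfl

theorem value_demazure (f : LaurentPolynomial K) :
    value (demazure (par .st) 1 f) = par .st * value f := eval₂_demazure_one _ f

theorem isE_iff (n : ℤ) (f : LaurentPolynomial K) : IsE n f ↔
    reflect (par .q4 ^ 2) (demazure (par .st) 1 f) = (eigenvalue n : K) • f ∧ f.coeff n = 1 := by
  rw [← rep_Y_apply]; rfl

theorem isE_zero : IsE 0 1 := by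
  rw [isE_iff, demazure_one, reflect_C, smul_eq_C_mul, mul_one]
  refine ⟨?_, ?_⟩
  · simp [eigenvalue, sgn]
  · rw [← T_zero, coeff_T, if_pos rfl]

/-- The creation operator `E_{-n} ↦ E_{n+1}`. -/
theorem IsE.succ {n : ℕ} {g : LaurentPolynomial K} (h : IsE (-n) g) :
    IsE (n + 1) (((par .q4 ^ (2 * n : ℤ) : Kˣ) : K) •
      (LaurentPolynomial.T 1 * reflect (par .q4 ^ 2) g)) := by
  rw [isE_iff] at h ⊢
  obtain ⟨h1, h2⟩ := h
  have hD : demazure (par .st) 1 g = (eigenvalue (-n) : K) • reflect (par .q4 ^ 2) g := by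
    rw [← reflect_reflect (par .q4 ^ 2) (demazure (par .st) 1 g), h1, map_smul]
  have hR : reflect (par .q4 ^ 2) g =
      (((eigenvalue (-n))⁻¹ : Kˣ) : K) • demazure (par .st) 1 g := by
    rw [hD, smul_smul, Units.inv_mul, one_smul]
  constructor
  · have hm := mul_demazure (par .st) 1 g
    rw [inv_one, sub_self, zero_mul, zero_add] at hm
    have hm' : demazure (par .st) 1 (LaurentPolynomial.T 1 * demazure (par .st) 1 g) =
        LaurentPolynomial.T (-1) * g := by
      rw [← hm, ← mul_assoc, ← T_add, hm]; simp
    rw [map_smul, map_smul, smul_comm]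
    congr 1
    conv_lhs => rw [hR, mul_smul_comm, map_smul, map_smul, hm', map_mul, reflect_T,
      ← smul_eq_C_mul, neg_neg, smul_mul_assoc, smul_smul]
    congr 1
    rw [← Units.val_mul]
    congr 1
    rw [eigenvalue, eigenvalue, sgn, sgn, if_neg (by omega), if_pos (by omega)]
    rw [mul_inv, ← zpow_neg, ← zpow_neg, mul_assoc, ← zpow_natCast, ← zpow_mul, ← zpow_add]
    congr 2
    push_cast
    ring
  · rw [coeff_smul', coeff_T_one_mul, coeff_reflect, h2, mul_one, ← Units.val_mul,
      ← zpow_natCast, ← zpow_mul, ← zpow_add]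
    simp

/-- On an eigenvector `π` may be replaced by `λ⁻¹ T`, and `T` contributes `t^{1/2}` at `t^{-1/2}`.
All powers of `q` cancel, leaving `t^{-1/2}`. -/
theorem IsE.value_succ {n : ℕ} {g : LaurentPolynomial K} (h : IsE (-n) g) :
    value (((par .q4 ^ (2 * n : ℤ) : Kˣ) : K) • (LaurentPolynomial.T 1 * reflect (par .q4 ^ 2) g)) =
      ((par .st)⁻¹ : Kˣ) * value g := by
  have h1 := ((isE_iff _ _).mp h).1
  have hR : reflect (par .q4 ^ 2) g =
      (((eigenvalue (-n))⁻¹ : Kˣ) : K) • demazure (par .st) 1 g := by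
    rw [← reflect_reflect (par .q4 ^ 2) (demazure (par .st) 1 g), h1, map_smul, smul_smul,
      Units.inv_mul, one_smul]
  rw [value_smul, value_T_one_mul, hR, value_smul, value_demazure, mul_left_comm]
  congr 1
  rw [← mul_assoc, ← mul_assoc, ← Units.val_mul, ← Units.val_mul]
  convert one_mul (value g)
  rw [Units.val_eq_one, eigenvalue, sgn, if_neg (by omega), neg_neg, zpow_one, mul_neg, neg_mul,
    neg_neg]
  group

theorem one_sub_ne_zero (j : ℕ) (hj : 0 < j) (i : ℕ) :
    (1 : K) - (par .q4 : K) ^ j * (par .st : K) ^ i ≠ 0 := by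
  have e : (1 : K) - (par .q4 : K) ^ j * (par .st : K) ^ i = algebraMap Z K
      (1 - (Params.var Par.q4 : Zˣ) ^ j * (Params.var Par.st : Zˣ) ^ i) := by
    simp [par]
  rw [e]
  intro h
  have h2 := congrArg evalTwo (IsFractionRing.injective Z K (h.trans (map_zero _).symm))
  have e1 : evalTwo (Params.var Par.st : Zˣ) = 1 := congrArg Units.val evalTwo_st
  have e2 : evalTwo (Params.var Par.q4 : Zˣ) = 2 := congrArg Units.val evalTwo_q4
  rw [map_sub, map_mul, map_pow, map_pow, e1, e2, map_one, map_zero, one_pow, mul_one, sub_eq_zero]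
    at h2
  exact (one_lt_pow₀ (one_lt_two : (1 : ℚ) < 2) hj.ne').ne h2

/-- The creation operator `E_n ↦ E_{-n}`. -/
theorem IsE.neg {n : ℕ} (hn : 0 < n) {f : LaurentPolynomial K} (h : IsE n f) (c : K)
    (hc : c * ((par .q4 : K) ^ (4 * n) * (par .st : K) ^ 2 - 1) = par .st - ((par .st)⁻¹ : Kˣ)) :
    IsE (-n) ((par .st : K) • (demazure (par .st) 1 f + c • f)) := by
  -- The bound on the exponents is not part of `A1.IsE`; it is inherited, by uniqueness, from the
  -- triangular construction.
  have hf : f ∈ lowerSpan K (ord n + 1) := by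
    obtain ⟨g, hg⟩ := exists_isEigen n
    rw [isE_unique h (isE_of_isEigen hg)]
    exact hg.mem
  rw [isE_iff] at h ⊢
  obtain ⟨h1, h2⟩ := h
  set l : Kˣ := eigenvalue n with hl
  have hl' : eigenvalue (-n) = l⁻¹ := by
    rw [hl, eigenvalue, eigenvalue, sgn, sgn, if_neg (by omega), if_pos (by omega), mul_inv,
      ← zpow_neg, ← zpow_neg]
    congr 2; ring
  -- The factor `q^n t` is `l⁻²`, the ratio of the eigenvalues of `E_{-n}` and `E_n`.
  have hl2 : (par .q4 : K) ^ (4 * n) * (par .st : K) ^ 2 * l = (l⁻¹ : Kˣ) := by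
    rw [← Units.val_pow_eq_pow_val, ← Units.val_pow_eq_pow_val, ← Units.val_mul, ← Units.val_mul]
    congr 1
    rw [eq_inv_iff_mul_eq_one, hl, eigenvalue, sgn, if_pos (by omega), ← zpow_natCast,
      ← zpow_natCast]
    generalize par .q4 = q
    generalize par .st = s
    calc _ = (q ^ ((4 * n : ℕ) : ℤ) * q ^ (-2 * (n : ℤ)) * q ^ (-2 * (n : ℤ))) *
          (s ^ ((2 : ℕ) : ℤ) * s ^ (-1 : ℤ) * s ^ (-1 : ℤ)) := by ac_rfl
      _ = 1 := by
        rw [← zpow_add, ← zpow_add, ← zpow_add, ← zpow_add]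
        convert one_mul (1 : Kˣ)
        · convert zpow_zero q; push_cast; ring
        · convert zpow_zero s; norm_num
  have hD : demazure (par .st) 1 f = (l : K) • reflect (par .q4 ^ 2) f := by
    rw [← reflect_reflect (par .q4 ^ 2) (demazure (par .st) 1 f), h1, map_smul]
  have hR : reflect (par .q4 ^ 2) f = ((l⁻¹ : Kˣ) : K) • demazure (par .st) 1 f := by
    rw [hD, smul_smul, Units.inv_mul, one_smul]
  constructor
  -- On the span of `f` and `T f` one has `Y f = l f` and `Y T f = l⁻¹ T f + (t^{1/2} - t^{-1/2}) l
  -- f`. So `T f + c f` has eigenvalue `l⁻¹` when `c (l⁻² - 1) = t^{1/2} - t^{-1/2}`, which is `hc`.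
  · rw [map_smul, map_smul, smul_comm _ (par .st : K)]
    congr 1
    rw [map_add, map_add, demazure_demazure, ← map_sub, ← smul_eq_C_mul, map_add, map_smul, map_smul,
      map_smul, h1, hR, hl', smul_add, smul_smul, smul_smul, smul_smul, add_right_comm, ← add_smul,
      add_comm]
    congr 2
    linear_combination (-(l : K)) * hc + c * hl2
  · rw [coeff_smul', coeff_add', coeff_smul']
    have hz : f.coeff (-n) = 0 := hf _ fun hm => by
      have hm : ord (-n) < ord n + 1 := hm
      unfold ord at hm
      split_ifs at hm <;> omega
    -- The coefficient of `X^{-n}` in `T f` comes from the leading term `X^n` alone and equals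
    -- `t^{-1/2}`; the factor `t^{1/2}` normalizes it to `1`.
    have hlt : f - LaurentPolynomial.T n ∈ degLT K n := fun m hm => by
      have hm : ¬ m.natAbs < n := hm
      rw [coeff_sub', coeff_T]
      by_cases e : (n : ℤ) = m
      · rw [if_pos e, ← e, h2, sub_self]
      · rw [if_neg e, sub_zero]
        refine hf m fun hm' => ?_
        have hm' : ord m < ord n + 1 := hm'
        unfold ord at hm'
        split_ifs at hm' <;> omega
    have := add_mem (demazure_mem_degLT (par .st) 1 hlt) (demazure_T_pos (par .st) 1 hn) (-n)
      (fun h => by have h : (-(n : ℤ)).natAbs < n := h; omega)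
    rw [map_sub, sub_add_sub_cancel, coeff_sub', coeff_smul', coeff_T, if_pos rfl, mul_one,
      sub_eq_zero] at this
    rw [this, hz, mul_zero, add_zero, Units.mul_inv]

theorem neg_factor {F : Type*} [Field F] (s x v : F) (hs : s ≠ 0) (h : 1 - x * s ^ 2 ≠ 0) :
    s * (s * v + (s - s⁻¹) / (x * s ^ 2 - 1) * v) =
      (1 - x * s ^ 4) / (1 - x * s ^ 2) * v := by
  obtain ⟨d, hd⟩ : ∃ d, 1 - x * s ^ 2 = d := ⟨_, rfl⟩
  have e : 1 - x * s ^ 4 = 1 - s ^ 2 + d * s ^ 2 := by rw [← hd]; ring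
  rw [hd] at h
  rw [← neg_sub 1 (x * s ^ 2), hd, e]
  field_simp
  ring

theorem value_of_isE_neg {n : ℕ} (hn : 0 < n) {f : LaurentPolynomial K} (h : IsE n f) :
    ∃ g, IsE (-n) g ∧ value g = (1 - (par .q4 : K) ^ (4 * n) * (par .st : K) ^ 4) /
        (1 - (par .q4 : K) ^ (4 * n) * (par .st : K) ^ 2) * value f := by
  have h2 := one_sub_ne_zero (4 * n) (by omega) 2
  have h2' : (par .q4 : K) ^ (4 * n) * (par .st : K) ^ 2 - 1 ≠ 0 := by
    rwa [← neg_sub, neg_ne_zero]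
  refine ⟨_, h.neg hn _ (div_mul_cancel₀ _ h2'), ?_⟩
  rw [value_smul, value_add, value_smul, value_demazure, Units.val_inv_eq_inv_val]
  exact neg_factor _ _ _ (Units.ne_zero _) h2

theorem value_eq (n : ℕ) : (∀ g, IsE (-n) g → value g = evalFormula (-n)) ∧
    ∀ g, IsE (n + 1) g → value g = evalFormula (n + 1) := by
  have succ : ∀ n : ℕ, (∀ g, IsE (-n) g → value g = evalFormula (-n)) →
      ∀ g, IsE (n + 1) g → value g = evalFormula (n + 1) := fun n hn f hf => by
    obtain ⟨g, hg, -⟩ := existsUnique_isE (-n)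
    rw [isE_unique hf hg.succ, hg.value_succ, hn g hg, evalFormula, evalFormula,
      if_neg (by omega), if_pos (by omega)]
    have e1 : (-(n : ℤ)).natAbs = n := by omega
    have e2 : ((n : ℤ) + 1).natAbs = n + 1 := by omega
    rw [e1, e2, Nat.add_sub_cancel, ← mul_assoc, pow_succ' (par .st : K)⁻¹ n,
      Units.val_inv_eq_inv_val]
  have zero : ∀ g, IsE (-(0 : ℕ)) g → value g = evalFormula (-(0 : ℕ)) := fun g hg => by
    rw [isE_unique hg (by simpa using isE_zero), value, map_one, evalFormula]
    simp
  induction n with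
  | zero => exact ⟨zero, succ 0 zero⟩
  -- The chain is `E_{-n} → E_{n+1} → E_{-n-1}`: the first arrow multiplies the value by `t^{-1/2}`,
  -- the second by the factor of the product with `j = n + 1`.
  | succ n ih =>
    refine (fun h => ⟨h, succ _ h⟩) fun g hg => ?_
    obtain ⟨f, hf, -⟩ := existsUnique_isE (n + 1)
    obtain ⟨g', hg', e⟩ := value_of_isE_neg (n := n + 1) n.succ_pos (f := f) (by exact_mod_cast hf)
    rw [isE_unique hg hg', e, ih.2 f hf, evalFormula, evalFormula,
      if_pos (by omega), if_neg (by omega)]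
    have e1 : (-((n + 1 : ℕ) : ℤ)).natAbs = n + 1 := by omega
    have e2 : ((n : ℤ) + 1).natAbs = n + 1 := by omega
    rw [e1, e2, Nat.add_sub_cancel, Finset.prod_Icc_succ_top (Nat.le_add_left 1 n)]
    ring

/-- The evaluation formula for the polynomials `E_n`. -/
theorem value_of_isE {n : ℤ} {g : LaurentPolynomial K} (h : IsE n g) :
    value g = evalFormula n := by
  rcases le_or_gt n 0 with hn | hn
  · obtain ⟨m, rfl⟩ : ∃ m : ℕ, n = -m := ⟨n.natAbs, by omega⟩
    exact (value_eq m).1 g h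
  · obtain ⟨m, rfl⟩ : ∃ m : ℕ, n = m + 1 := ⟨n.natAbs - 1, by omega⟩
    exact (value_eq m).2 g h

end A1

end

/-! ### Specialization of the evaluation formulas -/

namespace SpecializesTo

variable {A B : Type*} [CommRing A] [CommRing B] [IsDomain A] [IsDomain B] {σ : A →+* B}
  {x x' : FractionRing A} {y y' : FractionRing B}

theorem of_algebraMap (σ : A →+* B) (a : A) : SpecializesTo σ (algebraMap A (FractionRing A) a)
    (algebraMap B (FractionRing B) (σ a)) := ⟨a, 1, by simp, by simp, by simp⟩

theorem mul (h : SpecializesTo σ x y) (h' : SpecializesTo σ x' y') :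
    SpecializesTo σ (x * x') (y * y') := by
  obtain ⟨a, d, hd, rfl, rfl⟩ := h
  obtain ⟨a', d', hd', rfl, rfl⟩ := h'
  refine ⟨a * a', d * d', ?_, ?_, ?_⟩
  · rw [map_mul]; exact mul_ne_zero hd hd'
  · rw [map_mul, map_mul, div_mul_div_comm]
  · rw [map_mul, map_mul, map_mul, map_mul, div_mul_div_comm]

/-- The numerator becomes the new denominator, which is admissible because the specialized value is
not zero. -/
theorem inv (h : SpecializesTo σ x y) (hy : y ≠ 0) : SpecializesTo σ x⁻¹ y⁻¹ := by
  obtain ⟨a, d, hd, rfl, rfl⟩ := h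
  refine ⟨d, a, fun h => hy ?_, inv_div _ _, inv_div _ _⟩
  rw [h, map_zero, zero_div]

theorem one : SpecializesTo σ 1 1 := by simpa using of_algebraMap σ 1

theorem prod {ι : Type*} (s : Finset ι) {x : ι → FractionRing A} {y : ι → FractionRing B}
    (h : ∀ i ∈ s, SpecializesTo σ (x i) (y i)) :
    SpecializesTo σ (∏ i ∈ s, x i) (∏ i ∈ s, y i) := by
  classical
  induction s using Finset.induction_on with
  | empty => simpa using one
  | insert i s hi ih =>
    rw [Finset.prod_insert hi, Finset.prod_insert hi]
    exact (h i (Finset.mem_insert_self _ _)).mul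
      (ih fun j hj => h j (Finset.mem_insert_of_mem hj))

theorem pow (h : SpecializesTo σ x y) (n : ℕ) : SpecializesTo σ (x ^ n) (y ^ n) := by
  simpa using prod (Finset.range n) fun _ _ => h

end SpecializesTo

/-- The common form of the right-hand sides of the evaluation formulas in type `C^∨C_1`. -/
def CC.evalProduct (m N M : ℕ) : CC.K :=
  ((CC.par .su1 * CC.par .sv0 * CC.par .sv1 : CC.Kˣ) : CC.K)⁻¹ ^ (m + 1) *
    (∏ j ∈ Finset.Icc 1 N, (1 + (CC.par .q4 : CC.K) ^ (2 * j) * (CC.par .su1 : CC.K) ^ 2)) /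
    (∏ j ∈ Finset.Icc (N + 1) M,
      (1 - (CC.par .q4 : CC.K) ^ (2 * j) * (CC.par .su0 : CC.K) ^ 2 * (CC.par .su1 : CC.K) ^ 2)) *
    ∏ i ∈ Finset.range (m + 1),
      (((CC.par .sv0 : CC.K) + (CC.par .q4 : CC.K) ^ (2 * i + 1) * CC.par .su0 * CC.par .su1 *
          CC.par .sv1) *
        (1 - (CC.par .q4 : CC.K) ^ (2 * i + 1) * CC.par .su0 * CC.par .su1 * CC.par .sv0 *
          CC.par .sv1))

theorem CC.evalProduct_specializesTo (m N M : ℕ) : SpecializesTo spec1 (CC.evalProduct m N M)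
    ((A1.par .st : A1.K)⁻¹ ^ (m + 1) *
      (∏ j ∈ Finset.Icc 1 N, (1 + (A1.par .q4 : A1.K) ^ (2 * j) * (A1.par .st : A1.K) ^ 2)) /
      (∏ j ∈ Finset.Icc (N + 1) M, (1 - (A1.par .q4 : A1.K) ^ (2 * j) * (A1.par .st : A1.K) ^ 2)) *
      ∏ i ∈ Finset.range (m + 1), (1 - (A1.par .q4 : A1.K) ^ (2 * (2 * i + 1)) *
        (A1.par .st : A1.K) ^ 2)) := by
  have hv : ∀ i, (CC.par i : CC.K) = algebraMap CC.Z CC.K (Params.var i : CC.Zˣ) := fun _ => rfl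
  have hw : ∀ i, (A1.par i : A1.K) = algebraMap A1.Z A1.K (Params.var i : A1.Zˣ) := fun _ => rfl
  refine (SpecializesTo.mul ((SpecializesTo.mul ?_ ?_)) ?_).mul ?_
  · refine SpecializesTo.pow (SpecializesTo.inv ?_ (Units.ne_zero _)) _
    convert SpecializesTo.of_algebraMap spec1
      ((Params.var CC.Par.su1 * Params.var CC.Par.sv0 * Params.var CC.Par.sv1 : CC.Zˣ) : CC.Z) using 1
    · simp [hv]
    · simp [hw, spec1_var, par1]
  · refine SpecializesTo.prod _ fun j _ => ?_
    convert SpecializesTo.of_algebraMap spec1 (1 + ((Params.var CC.Par.q4 : CC.Zˣ) : CC.Z) ^ (2 * j) *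
      ((Params.var CC.Par.su1 : CC.Zˣ) : CC.Z) ^ 2) using 1
    · simp [hv]
    · simp [hw, spec1_var, par1]
  · refine SpecializesTo.inv (SpecializesTo.prod _ fun j _ => ?_)
      (Finset.prod_ne_zero_iff.mpr fun j hj => A1.one_sub_ne_zero _
        (by have := Finset.mem_Icc.mp hj; omega) _)
    convert SpecializesTo.of_algebraMap spec1 (1 - ((Params.var CC.Par.q4 : CC.Zˣ) : CC.Z) ^ (2 * j) *
      ((Params.var CC.Par.su0 : CC.Zˣ) : CC.Z) ^ 2 *
      ((Params.var CC.Par.su1 : CC.Zˣ) : CC.Z) ^ 2) using 1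
    · simp [hv]
    · simp [hw, spec1_var, par1]
  · refine SpecializesTo.prod _ fun i _ => ?_
    convert SpecializesTo.of_algebraMap spec1 ((((Params.var CC.Par.sv0 : CC.Zˣ) : CC.Z) +
      ((Params.var CC.Par.q4 : CC.Zˣ) : CC.Z) ^ (2 * i + 1) *
      (Params.var CC.Par.su0 : CC.Zˣ) * (Params.var CC.Par.su1 : CC.Zˣ) *
      (Params.var CC.Par.sv1 : CC.Zˣ)) *
      (1 - ((Params.var CC.Par.q4 : CC.Zˣ) : CC.Z) ^ (2 * i + 1) *
      (Params.var CC.Par.su0 : CC.Zˣ) * (Params.var CC.Par.su1 : CC.Zˣ) *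
      (Params.var CC.Par.sv0 : CC.Zˣ) * (Params.var CC.Par.sv1 : CC.Zˣ))) using 1
    · simp [hv]
    -- The two factors become `1 + z` and `1 - z` with `z = q^{(2i+1)/4} t^{1/2}`, so their product
    -- is `1 - q^{(2i+1)/2} t`.
    · simp only [hw, spec1_var, par1, map_mul, map_add, map_sub, map_pow, map_one, Units.val_one]
      ring

theorem prod_odd_mul_prod_even {R : Type*} [CommRing R] (f : ℕ → R) (m : ℕ) :
    (∏ i ∈ Finset.range (m + 1), f (2 * i + 1)) * ∏ j ∈ Finset.Icc 1 m, f (2 * j) =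
      ∏ j ∈ Finset.Icc 1 (2 * m + 1), f j := by
  induction m with
  | zero => simp
  | succ m ih =>
    rw [Finset.prod_range_succ, Finset.prod_Icc_succ_top (by omega : 1 ≤ m + 1),
      show 2 * (m + 1) + 1 = 2 * m + 1 + 1 + 1 by ring,
      Finset.prod_Icc_succ_top (by omega : 1 ≤ 2 * m + 1 + 1 + 1),
      Finset.prod_Icc_succ_top (by omega : 1 ≤ 2 * m + 1 + 1), ← ih,
      show 2 * (m + 1) = 2 * m + 1 + 1 by ring]
    ring

theorem prod_Icc_mul_prod_Icc {R : Type*} [CommRing R] (f : ℕ → R) {N M : ℕ} (h : N ≤ M) :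
    (∏ j ∈ Finset.Icc 1 N, f j) * ∏ j ∈ Finset.Icc (N + 1) M, f j = ∏ j ∈ Finset.Icc 1 M, f j := by
  induction M, h using Nat.le_induction with
  | base => simp
  | succ M h ih =>
    rw [Finset.prod_Icc_succ_top (by omega : N + 1 ≤ M + 1), ← mul_assoc, ih,
      Finset.prod_Icc_succ_top (by omega : 1 ≤ M + 1)]

/-- The specialized product is the product in the evaluation formula of type `A_1`. -/
theorem A1.prod_eq {m N M : ℕ} (hNM : N ≤ M)
    (h : ∀ f : ℕ → A1.K, (∏ i ∈ Finset.range (m + 1), f (2 * i + 1)) *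
      ∏ j ∈ Finset.Icc 1 N, f (2 * j) = ∏ j ∈ Finset.Icc 1 M, f j) :
    (A1.par .st : A1.K)⁻¹ ^ (m + 1) *
      (∏ j ∈ Finset.Icc 1 N, (1 + (A1.par .q4 : A1.K) ^ (2 * j) * (A1.par .st : A1.K) ^ 2)) /
      (∏ j ∈ Finset.Icc (N + 1) M, (1 - (A1.par .q4 : A1.K) ^ (2 * j) * (A1.par .st : A1.K) ^ 2)) *
      ∏ i ∈ Finset.range (m + 1), (1 - (A1.par .q4 : A1.K) ^ (2 * (2 * i + 1)) *
        (A1.par .st : A1.K) ^ 2) =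
    (A1.par .st : A1.K)⁻¹ ^ (m + 1) * ∏ j ∈ Finset.Icc 1 N,
      ((1 - (A1.par .q4 : A1.K) ^ (4 * j) * (A1.par .st : A1.K) ^ 4) /
        (1 - (A1.par .q4 : A1.K) ^ (4 * j) * (A1.par .st : A1.K) ^ 2)) := by
  -- All factors are expressed by `f j = 1 - q^{j/2} t`: one has `1 - q^j t² = f j (1 + q^{j/2} t)`
  -- and `1 - q^j t = f (2j)`. The product over `i` consists of the `f` at odd indices; with those
  -- at even indices it fills `1, …, M`, and the indices above `N` cancel.
  set f : ℕ → A1.K := fun j => 1 - (A1.par .q4 : A1.K) ^ (2 * j) * (A1.par .st : A1.K) ^ 2 with hf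
  have hne : ∀ i > 0, f i ≠ 0 := fun i hi => A1.one_sub_ne_zero _ (by omega) _
  have e1 : ∏ j ∈ Finset.Icc 1 N, (1 - (A1.par .q4 : A1.K) ^ (4 * j) * (A1.par .st : A1.K) ^ 4) =
      (∏ j ∈ Finset.Icc 1 N, f j) *
      ∏ j ∈ Finset.Icc 1 N, (1 + (A1.par .q4 : A1.K) ^ (2 * j) * (A1.par .st : A1.K) ^ 2) := by
    rw [← Finset.prod_mul_distrib]
    exact Finset.prod_congr rfl fun j _ => by rw [hf]; ring
  have e2 : ∏ j ∈ Finset.Icc 1 N, (1 - (A1.par .q4 : A1.K) ^ (4 * j) * (A1.par .st : A1.K) ^ 2) =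
      ∏ j ∈ Finset.Icc 1 N, f (2 * j) :=
    Finset.prod_congr rfl fun j _ => by rw [hf]; ring
  have h3 := (h f).trans (prod_Icc_mul_prod_Icc f hNM).symm
  have n1 : ∏ j ∈ Finset.Icc (N + 1) M, f j ≠ 0 := Finset.prod_ne_zero_iff.mpr fun j hj =>
    hne j (by have := Finset.mem_Icc.mp hj; omega)
  have n2 : ∏ j ∈ Finset.Icc 1 N, f (2 * j) ≠ 0 := Finset.prod_ne_zero_iff.mpr fun j hj =>
    hne _ (by have := Finset.mem_Icc.mp hj; omega)
  rw [Finset.prod_div_distrib, e1, e2, mul_div_assoc, mul_assoc]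
  congr 1
  rw [div_mul_eq_mul_div, div_eq_div_iff n1 n2]
  linear_combination (∏ j ∈ Finset.Icc 1 N,
    (1 + (A1.par .q4 : A1.K) ^ (2 * j) * (A1.par .st : A1.K) ^ 2)) * h3

theorem CC.evalPos_specializesTo (m : ℕ) :
    SpecializesTo spec1 (CC.evalPos m) (A1.evalFormula (m + 1)) := by
  have h := CC.evalProduct_specializesTo m m (2 * m + 1)
  rw [A1.prod_eq (by omega) fun f => prod_odd_mul_prod_even f m] at h
  have e : ((m : ℤ) + 1).natAbs = m + 1 := by omega
  rw [A1.evalFormula, if_pos (by omega), e]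
  exact h

theorem CC.evalNeg_specializesTo (m : ℕ) :
    SpecializesTo spec1 (CC.evalNeg m) (A1.evalFormula (-(m + 1))) := by
  have h := CC.evalProduct_specializesTo m (m + 1) (2 * m + 2)
  -- For negative `n` there is one more even index, `2m + 2`, which completes the range up to `M =
  -- 2m + 2`.
  rw [A1.prod_eq (by omega) fun f => by
    rw [Finset.prod_Icc_succ_top (by omega : 1 ≤ m + 1), ← mul_assoc, prod_odd_mul_prod_even f m,
      Finset.prod_Icc_succ_top (by omega : 1 ≤ 2 * m + 1 + 1)]
    rfl] at h
  have e : (-((m : ℤ) + 1)).natAbs = m + 1 := by omega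
  rw [A1.evalFormula, if_neg (by omega), e]
  exact h

end DAHA

end

theorem theorem2p1 :
    -- the first specialization: the homomorphism `ξ`
    (∃ ξ : DAHA.CC.H →+* DAHA.A1.H,
      (∀ a, ξ (algebraMap DAHA.CC.Z DAHA.CC.H a) =
        algebraMap DAHA.A1.Z DAHA.A1.H (DAHA.spec1 a)) ∧
      ξ DAHA.CC.U1 = DAHA.A1.T ∧
      ξ DAHA.CC.U0 = (DAHA.A1.Y * DAHA.A1.T⁻¹ : DAHA.A1.Hˣ) ∧
      ξ DAHA.CC.V0 = (DAHA.A1.Q * DAHA.A1.Y * DAHA.A1.T⁻¹ * DAHA.A1.X⁻¹ : DAHA.A1.Hˣ) ∧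
      ξ DAHA.CC.V1 = (DAHA.A1.X * DAHA.A1.T : DAHA.A1.Hˣ) ∧
      ξ DAHA.CC.X = DAHA.A1.X ∧
      ξ DAHA.CC.Y = DAHA.A1.Y ∧
      (∀ h, ξ (DAHA.CC.tauPlus h) = DAHA.A1.tauPlus (ξ h)) ∧
      (∀ h, ξ (DAHA.CC.tauMinus h) = DAHA.A1.tauMinus (ξ h)) ∧
      (∀ h, ξ (DAHA.CC.eta h) = DAHA.A1.eta (ξ h)) ∧
      (∀ h, ξ (DAHA.CC.phi h).unop = (DAHA.A1.phi (ξ h)).unop) ∧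
      (∀ h, ξ (DAHA.CC.star h).unop = (DAHA.A1.star (ξ h)).unop)) ∧
    -- the polynomials `𝓔_n` and `E_n`
    (∀ n : ℤ, (∃! f, DAHA.CC.IsE n f) ∧ (∃! g, DAHA.A1.IsE n g)) ∧
    -- the first specialization of `𝓔_n`, of its value and of the evaluation formulas
    (∀ (n : ℤ) (f : LaurentPolynomial DAHA.CC.K) (g : LaurentPolynomial DAHA.A1.K),
      DAHA.CC.IsE n f → DAHA.A1.IsE n g →
        DAHA.PolySpecializesTo DAHA.spec1 f g ∧
        DAHA.SpecializesTo DAHA.spec1 (DAHA.CC.value f) (DAHA.A1.value g) ∧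
        DAHA.A1.value g = DAHA.A1.evalFormula n) ∧
    (∀ m : ℕ,
      DAHA.SpecializesTo DAHA.spec1 (DAHA.CC.evalPos m) (DAHA.A1.evalFormula (m + 1)) ∧
      DAHA.SpecializesTo DAHA.spec1 (DAHA.CC.evalNeg m) (DAHA.A1.evalFormula (-(m + 1)))) ∧
    -- the second specialization: the homomorphism `ζ`
    (∃ ζ : DAHA.CC.H →+* DAHA.A1.H,
      (∀ a, ζ (algebraMap DAHA.CC.Z DAHA.CC.H a) =
        algebraMap DAHA.A1.Z DAHA.A1.H (DAHA.spec2 a)) ∧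
      ζ DAHA.CC.U1 = DAHA.A1.T ∧
      ζ DAHA.CC.U0 = (DAHA.A1.Y ^ 2 * DAHA.A1.T⁻¹ : DAHA.A1.Hˣ) ∧
      ζ DAHA.CC.V0 = (DAHA.A1.Q * DAHA.A1.Y * DAHA.A1.T⁻¹ * DAHA.A1.X⁻¹ : DAHA.A1.Hˣ) ∧
      ζ DAHA.CC.V1 = (DAHA.A1.Q * DAHA.A1.X * DAHA.A1.T * DAHA.A1.Y : DAHA.A1.Hˣ) ∧
      ζ DAHA.CC.X = (DAHA.A1.Q⁻¹ * DAHA.A1.Y⁻¹ * DAHA.A1.X : DAHA.A1.Hˣ) ∧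
      ζ DAHA.CC.X = DAHA.A1.tauMinus.symm DAHA.A1.X ∧
      ζ DAHA.CC.Y = (DAHA.A1.Y ^ 2 : DAHA.A1.Hˣ) ∧
      -- the induced homomorphism of groups
      (∃ Z : DAHA.GLHat.Gamma0 →* DAHA.GLHat,
        Z DAHA.GLHat.Gamma0.tauPlusSq =
          DAHA.GLHat.tauMinus⁻¹ * DAHA.GLHat.tauPlus * DAHA.GLHat.tauMinus ∧
        Z DAHA.GLHat.Gamma0.tauMinus = DAHA.GLHat.tauMinus ^ 2 ∧
        Z DAHA.GLHat.Gamma0.eta =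
          DAHA.GLHat.tauMinus⁻¹ * DAHA.GLHat.eta * DAHA.GLHat.tauMinus ∧
        ∀ (γ : DAHA.GLHat.Gamma0) (h : DAHA.CC.H),
          ζ (DAHA.CC.act γ h) = DAHA.A1.act (Z γ) (ζ h)) ∧
      -- compatibility with the polynomial representations
      (∀ (h : DAHA.CC.H) (F : LaurentPolynomial DAHA.CC.Z),
        DAHA.zetaPoly (DAHA.CC.polyRep h F) =
          DAHA.A1.polyRep (ζ h) (DAHA.zetaPoly F))) ∧
    -- the second specialization of `𝓔_n` and of its value
    (∀ (n : ℤ) (f : LaurentPolynomial DAHA.CC.K) (g : LaurentPolynomial DAHA.A1.K),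
      DAHA.CC.IsE n f → DAHA.A1.IsE n g →
        DAHA.PolySpecializesTo DAHA.spec2 f g ∧
        DAHA.SpecializesTo DAHA.spec2 (DAHA.CC.value f) (DAHA.A1.value g)) := by
  refine ⟨⟨DAHA.xi, DAHA.xi_algebraMap, congrArg Units.val DAHA.xi_U1, congrArg Units.val DAHA.xi_U0,
      congrArg Units.val DAHA.xi_V0, congrArg Units.val DAHA.xi_V1, congrArg Units.val DAHA.xi_X,
      congrArg Units.val DAHA.xi_Y, DAHA.xi_tauPlus, DAHA.xi_tauMinus, DAHA.xi_eta, DAHA.xi_phi,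
      DAHA.xi_star⟩, fun n => ⟨DAHA.CC.existsUnique_isE n, DAHA.A1.existsUnique_isE n⟩,
    fun n f g hf hg => ?_,
    fun m => ⟨DAHA.CC.evalPos_specializesTo m, DAHA.CC.evalNeg_specializesTo m⟩,
    ⟨DAHA.zeta, DAHA.zeta_algebraMap, congrArg Units.val DAHA.zeta_U1,
      congrArg Units.val DAHA.zeta_U0, congrArg Units.val DAHA.zeta_V0,
      congrArg Units.val DAHA.zeta_V1, congrArg Units.val DAHA.zeta_X,
      (congrArg Units.val DAHA.zeta_X).trans DAHA.tauMinus_symm_X.symm,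
      congrArg Units.val DAHA.zeta_Y,
      ⟨DAHA.GLHat.zetaStar, DAHA.GLHat.zetaStar_tauPlusSq, DAHA.GLHat.zetaStar_tauMinus,
        DAHA.GLHat.zetaStar_eta, DAHA.zeta_act⟩, DAHA.zetaPoly_polyRep⟩,
    fun n f g hf hg => ?_⟩
  -- The product formula for `E_n(t^{-1/2})` is supplied by type `A_1` itself, independently of the
  -- evaluation formula for `𝓔_n`.
  · have h := DAHA.specializes_of_isEigen DAHA.par1 rfl rfl DAHA.eigenvalue_par1_sub_ne_zero n
      (fun _ => DAHA.A1.isE_of_isEigen) hf hg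
    rw [DAHA.spec1_eq]
    exact ⟨h.1, h.2, DAHA.A1.value_of_isE hg⟩
  · rw [DAHA.spec2_eq]
    exact DAHA.specializes_of_isEigen DAHA.par2 rfl rfl DAHA.eigenvalue_par2_sub_ne_zero n
      (fun _ => DAHA.A1.isE_of_isEigen_par2) hf hg
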